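/- For a law $P$ on $\mathbb R$ write $M_k(P)=\int x^k\,P(\mathrm dx)$. Let $(P_n)_{n\ge 1}$ be probability laws on $\mathbb{R}$ with finite moments of all orders, zero mean and $M_2(P_n)>0$, and suppose that for every $k\ge 1$ the limit $$A_k=\lim_{n\to\infty}\frac{M_k(P_n)}{n^{k/2-1}M_2(P_n)^{k/2}}$$ exists and is finite. Put $\mathcal A=(A_k)_{k\ge1}$. Let $m=m(n)$ with $m/n\to\alpha>0$, and for each $n\ge 1$ let $X_n$ be a random $n\times m$ matrix with i.i.d. entries of law $P_n$. Let $W_n=\frac{1}{nM_2(P_n)}X_nX_n^T$, and let $\mu_{W_n}=\frac1n\sum_{\lambda}\delta_\lambda$ be its spectral measure (eigenvalues counted with multiplicity). A probability law $\mu$ is the limit of $\mu_{W_n}$ weakly in probability if for all $\varepsilon>0$ and all bounded continuous $f:\mathbb R\to\mathbb R$, $\mathbb P\left(\left|\int f\,\mathrm d\mu_{W_n}-\int f\,\mathrm d\mu\right|>\varepsilon\right)\to 0$. The law $\mu_{\mathcal A,\alpha}$ is the limit of $\mu_{W_n}$ in this sense, and it is characterized by having finite moments of all orders, given for all $k\ge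 1$ by $$M_k(\mu_{\mathcal A,\alpha})=\sum_{a=1}^{k}\sum_{l=1}^{a}\alpha^l\sum_{\substack{b_1\ge\dots\ge b_a\ge2\\ b_1+\dots+b_a=2k}}|\mathcal W_k(a,a+1,l,\mathbf b)|\prod_{i=1}^aA_{b_i},$$ where $\mathcal W_k(a,a+1,l,\mathbf b)$ is a set of representatives, up to relabelling of the vertices, of the closed words (walks) with $2k$ steps, starting from the root, on labelled rooted trees having $a$ edges, of which $l$ are odd (the endpoint away from the root is at odd distance from the root), such that the edges are browsed, in either direction, $b_1,\dots,b_a$ times in some order. Let $\mu_\alpha$ be the Marchenko–Pastur law $$\mu_\alpha(\mathrm dx)=\frac{\sqrt{(b-x)(x-a)}}{2\pi x}\mathbf 1_{[a,b]}(x)\,\mathrm dx+\mathbf 1_{\alpha<1}(1-\alpha)\,\delta_0(\mathrm dx),\qquad a=(1-\sqrt\alpha)^2,\quad b=(1+\sqrt\alpha)^2.$$ If $A_k=0$ for all $k>2$, then $\mu_{\mathcal A,\alpha}=\mu_\alpha$; that is, $\mu_\alpha$ is the unique probability law that is the limit of $\mu_{W_n}$ weakly in probability, and it is the unique probability law with the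 moments displayed above. Moreover, if all the laws $P_n$ are equal to one law $P$ with finite moments of all orders, zero mean and $M_2(P)>0$, then the limits $A_k$ exist and $A_k=0$ for all $k>2$. -/

import Mathlib

open MeasureTheory ProbabilityTheory Filter Topology
open scoped ENNReal BoundedContinuousFunction Matrix

/-- The admissible entry laws: probability laws on `ℝ` with finite moments of all orders, zero mean
and non-zero variance. -/
structure IsEntryLaw (P : Measure ℝ) : Prop where
  isProb : IsProbabilityMeasure P
  integrable_pow : ∀ k : ℕ, Integrable (fun x : ℝ => x ^ k) P
  mean_zero : ∫ x, x ∂P = 0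
  second_moment_pos : 0 < ∫ x, x ^ 2 ∂P

/-- `A` is the asymptotic of the sequence of laws `(P n)_{n ≥ 1}`: for all `k ≥ 1`,
`A k = lim_n M_k(P n) / (n ^ (k/2 - 1) * M_2(P n) ^ (k/2))`, with `M_k(P) = ∫ x ^ k dP`. -/
def IsAsymptotic (P : ℕ → Measure ℝ) (A : ℕ → ℝ) : Prop :=
  ∀ k : ℕ, 1 ≤ k →
    Tendsto
      (fun n : ℕ => (∫ x, x ^ k ∂(P n)) /
        ((n : ℝ) ^ ((k : ℝ) / 2 - 1) * (∫ x, x ^ 2 ∂(P n)) ^ ((k : ℝ) / 2)))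
      atTop (𝓝 (A k))

/-- The random matrix `X` on the probability space `(Ω, Pr)` has i.i.d. entries with law `P`. -/
structure HasIIDEntries {Ω : Type*} [MeasurableSpace Ω] (Pr : Measure Ω) {n m : ℕ}
    (X : Ω → Matrix (Fin n) (Fin m) ℝ) (P : Measure ℝ) : Prop where
  hasLaw : ∀ i j, HasLaw (fun ω => X ω i j) P Pr
  indep : iIndepFun (fun (p : Fin n × Fin m) (ω : Ω) => X ω p.1 p.2) Pr

/-- The Wishart matrix `(1 / (n v)) X Xᵀ` of an `n × m` matrix `X`. -/
noncomputable def wishart {n m : ℕ} (v : ℝ) (X : Matrix (Fin n) (Fin m) ℝ) :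
    Matrix (Fin n) (Fin n) ℝ :=
  (1 / ((n : ℝ) * v)) • (X * Xᵀ)

theorem wishart_isHermitian {n m : ℕ} (v : ℝ) (X : Matrix (Fin n) (Fin m) ℝ) :
    (wishart v X).IsHermitian := by
  unfold wishart Matrix.IsHermitian
  simp [Matrix.conjTranspose_eq_transpose_of_trivial, Matrix.transpose_mul]

/-- The spectral measure `(1 / n) ∑ δ_λ` of a symmetric matrix, the sum running over the
eigenvalues counted with multiplicity. -/
noncomputable def spectralMeasure {n : ℕ} {W : Matrix (Fin n) (Fin n) ℝ} (hW : W.IsHermitian) :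
    Measure ℝ :=
  (n : ℝ≥0∞)⁻¹ • ∑ i : Fin n, Measure.dirac (hW.eigenvalues i)

/-- `μ` is a probability law and the spectral measures of the Wishart matrices
`(1 / (n M_2(P n))) (X n) (X n)ᵀ` converge weakly to `μ` in probability. -/
def IsSpectralLimit {Ω : ℕ → Type*} [∀ n, MeasurableSpace (Ω n)] (Pr : ∀ n, Measure (Ω n))
    {m : ℕ → ℕ} (X : ∀ n, Ω n → Matrix (Fin n) (Fin (m n)) ℝ) (P : ℕ → Measure ℝ)
    (μ : Measure ℝ) : Prop :=
  IsProbabilityMeasure μ ∧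
    ∀ ε : ℝ, 0 < ε → ∀ f : ℝ →ᵇ ℝ,
      Tendsto
        (fun n : ℕ => Pr n {ω |
          ε < |(∫ x, f x ∂(spectralMeasure (wishart_isHermitian (∫ y, y ^ 2 ∂(P n)) (X n ω))))
                - ∫ x, f x ∂μ|})
        atTop (𝓝 0)

/-- The number of times that the word `w` (a sequence of `N + 1` labels, hence `N` steps) browses
the edge `e`, in either direction. -/
def browseCount {N s : ℕ} (w : Fin (N + 1) → Fin s) (e : Sym2 (Fin s)) : ℕ :=
  (Finset.univ.filter fun j : Fin N => s(w j.castSucc, w j.succ) = e).card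

/-- The odd edges of a tree `G` rooted at `r`: those whose endpoint away from the root lies at odd
distance from the root (so the edges at the root are odd). -/
def oddEdges {s : ℕ} (G : SimpleGraph (Fin s)) (r : Fin s) : Set (Sym2 (Fin s)) :=
  {e | e ∈ G.edgeSet ∧
    ∃ u v, e = s(u, v) ∧ G.dist r v = G.dist r u + 1 ∧ Odd (G.dist r v)}

/-- The closed words with `2k` steps on a labelled tree with `a` edges (and `a + 1` vertices),
starting from the root, where the tree has exactly `l` odd edges and the edges are browsed
`b 0, …, b (a - 1)` times. -/
def IsTreeWord (k a l : ℕ) (b : Fin a → ℕ) (w : Fin (2 * k + 1) → Fin (a + 1)) : Prop :=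
  w (Fin.last (2 * k)) = w 0 ∧
    ∃ G : SimpleGraph (Fin (a + 1)), G.IsTree ∧
      (∀ j : Fin (2 * k), G.Adj (w j.castSucc) (w j.succ)) ∧
      (oddEdges G (w 0)).ncard = l ∧
      ∃ e : Fin a ≃ G.edgeSet, ∀ i, browseCount w (e i : Sym2 (Fin (a + 1))) = b i

/-- Two words are equivalent when a relabelling of the vertices maps the one to the other. -/
def treeWordSetoid (k a l : ℕ) (b : Fin a → ℕ) :
    Setoid {w : Fin (2 * k + 1) → Fin (a + 1) // IsTreeWord k a l b w} where
  r w w' := ∃ σ : Equiv.Perm (Fin (a + 1)), ∀ j, σ (w.1 j) = w'.1 j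
  iseqv :=
    { refl := fun _ => ⟨1, fun _ => rfl⟩
      symm := fun {_ _} ⟨σ, h⟩ => ⟨σ.symm, fun j => by rw [← h j, Equiv.symm_apply_apply]⟩
      trans := fun {_ _ _} ⟨σ, h⟩ ⟨τ, h'⟩ =>
        ⟨σ.trans τ, fun j => by rw [Equiv.trans_apply, h j, h' j]⟩ }

/-- The number `|W_k(a, a+1, l, b)|` of equivalence classes of words. -/
noncomputable def treeWordCount (k a l : ℕ) (b : Fin a → ℕ) : ℕ :=
  Nat.card (Quotient (treeWordSetoid k a l b))

open Classical in
/-- The tuples `b_1 ≥ … ≥ b_a ≥ 2` with `b_1 + ⋯ + b_a = 2k`. -/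
noncomputable def multiplicityTuples (k a : ℕ) : Finset (Fin a → ℕ) :=
  (Fintype.piFinset fun _ : Fin a => Finset.Icc 2 (2 * k)).filter
    fun b => Antitone b ∧ ∑ i, b i = 2 * k

/-- The `k`-th limiting moment
`∑_{a=1}^k ∑_{l=1}^a α^l ∑_b |W_k(a, a+1, l, b)| ∏_i A_{b_i}`. -/
noncomputable def limitMoment (A : ℕ → ℝ) (α : ℝ) (k : ℕ) : ℝ :=
  ∑ a ∈ Finset.Icc 1 k, ∑ l ∈ Finset.Icc 1 a,
    α ^ l * ∑ b ∈ multiplicityTuples k a, (treeWordCount k a l b : ℝ) * ∏ i, A (b i)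

/-- `μ` is a probability law with finite moments of all orders, whose `k`-th moment is
`limitMoment A α k` for all `k ≥ 1`. -/
def HasLimitMoments (A : ℕ → ℝ) (α : ℝ) (μ : Measure ℝ) : Prop :=
  IsProbabilityMeasure μ ∧
    ∀ k : ℕ, 1 ≤ k → Integrable (fun x : ℝ => x ^ k) μ ∧ ∫ x, x ^ k ∂μ = limitMoment A α k

/-- The Marchenko–Pastur law
`μ_α(dx) = √((b - x)(x - a)) / (2πx) 1_{[a,b]}(x) dx + 1_{α < 1} (1 - α) δ_0(dx)`,
`a = (1 - √α)²`, `b = (1 + √α)²`. -/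
noncomputable def marchenkoPastur (α : ℝ) : Measure ℝ :=
  (volume.restrict (Set.Icc ((1 - √α) ^ 2) ((1 + √α) ^ 2))).withDensity
      (fun x => ENNReal.ofReal
        (√(((1 + √α) ^ 2 - x) * (x - (1 - √α) ^ 2)) / (2 * Real.pi * x)))
    + if α < 1 then ENNReal.ofReal (1 - α) • Measure.dirac 0 else 0

/-! The limit is reached in two independent ways, one for each characterization, and both meet at
the quadratic equation of the Marchenko–Pastur law.

Moments. If `A k = 0` for `k > 2`, then only words that browse every edge exactly twice contribute,
and these have `a = k`. Such a closed walk on a tree is a depth-first contour, so up to relabelling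
it is a plane forest with `k` vertices, an odd edge being a vertex at odd level
(`treeWordCount_two`). Cutting off the first root gives a quadratic recursion for the generating
polynomials (`parityPoly_true_rec`). On the other side, an angle parametrization of the
Marchenko–Pastur law yields its Stieltjes transform explicitly (`stieltjes_marchenkoPastur`); the
quadratic equation of this transform, expanded at infinity, is the same recursion for the moments
(`moment_marchenkoPastur_rec`). A compactly supported law is determined by its moments
(`eq_of_forall_moment_eq`).

Convergence. For `t > 0` let `s` be the normalized trace of `(W + t)⁻¹`. Removing one column is a
rank-one perturbation, and the exact identity `card_sub_mul_trace_gramResolvent` expresses `1 - t s`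
as an average of `q / (1 + q)` over the columns, where `q` is a quadratic form of a column in a
resolvent independent of it. A second-moment bound puts `q` close to `s`, with an error governed by
`M_4 / (n M_2 ^ 2)`, which tends to `A 4 = 0`. So `s` almost solves `1 - t s = α s / (1 + s)`; this
equation is stable and is solved by the Marchenko–Pastur transform. The functions `1 / (x + t)` and
the constants span a dense space of continuous functions on the compactified half-line, which turns
convergence of transforms into weak convergence in probability. Limits in probability are unique.

For a constant sequence of laws, `n ^ (k/2 - 1)` tends to infinity when `k > 2`, and this forces `A
k = 0`. -/

/-! ### Contour walks of plane forests -/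

/-- The number of vertices of the plane forest encoded by a binary tree (left child: first child,
right child: next sibling) at odd level (`b = true`) or even level (`b = false`), the roots having
level `1`. -/
def parityCount : Bool → BinaryTree Unit → ℕ
  | _, .nil => 0
  | b, .node _ l r => (if b then 1 else 0) + parityCount (!b) l + parityCount b r

/-- `IsContour t r L`: the list `r :: L` is the contour walk of the plane forest `t`, whose roots
are the children of `r`. -/
inductive IsContour {V : Type*} : BinaryTree Unit → V → List V → Prop
  | nil (r : V) : IsContour .nil r []
  | node {t u : BinaryTree Unit} {r v : V} {L M : List V} :
      IsContour t v L → IsContour u r M → List.Disjoint (v :: L) (r :: M) →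
      IsContour (.node () t u) r (v :: (L ++ r :: M))

/-- The edges browsed by the walk `r :: L`. -/
def walkSteps {V : Type*} : V → List V → List (Sym2 V)
  | _, [] => []
  | r, x :: L => s(r, x) :: walkSteps x L

section Contour

variable {V V' : Type*}

theorem walkSteps_append (r : V) (L : List V) (x : V) (M : List V) :
    walkSteps r (L ++ x :: M) = walkSteps r L ++ s(L.getLastD r, x) :: walkSteps x M := by
  induction L generalizing r with
  | nil => simp [walkSteps]
  | cons y L ih => simp only [List.cons_append, walkSteps, ih y, List.getLastD_cons]

theorem getLastD_append_cons (r : V) (L : List V) (x : V) (M : List V) :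
    (L ++ x :: M).getLastD r = M.getLastD x := by
  induction L generalizing r with
  | nil => simp only [List.nil_append, List.getLastD_cons]
  | cons y L ih => simp only [List.cons_append, List.getLastD_cons, ih]

theorem mem_of_mem_walkSteps {r : V} {L : List V} {e : Sym2 V} (he : e ∈ walkSteps r L) {x : V}
    (hx : x ∈ e) : x ∈ r :: L := by
  induction L generalizing r with
  | nil => simp [walkSteps] at he
  | cons y L ih =>
    rcases List.mem_cons.1 he with rfl | he
    · rcases Sym2.mem_iff.1 hx with rfl | rfl <;> simp
    · exact List.mem_cons_of_mem _ (ih he)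

/-- Cuts the walk at the first traversal of `e`, so that the initial piece avoids `e`. -/
theorem exists_split_of_mem_walkSteps {r : V} {L : List V} {e : Sym2 V} (he : e ∈ walkSteps r L) :
    ∃ L₁ x L₂, L = L₁ ++ x :: L₂ ∧ e = s(L₁.getLastD r, x) ∧ e ∉ walkSteps r L₁ := by
  classical
  induction L generalizing r with
  | nil => simp [walkSteps] at he
  | cons y L ih =>
    by_cases h : e = s(r, y)
    · exact ⟨[], y, L, rfl, h, by simp [walkSteps]⟩
    · obtain ⟨L₁, x, L₂, rfl, h1, h2⟩ := ih ((List.mem_cons.1 he).resolve_left h)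
      exact ⟨y :: L₁, x, L₂, rfl, by rwa [List.getLastD_cons], by simp [walkSteps, h, h2]⟩

theorem reachable_of_walkSteps {G : SimpleGraph V} {r : V} {L : List V}
    (h : ∀ e ∈ walkSteps r L, e ∈ G.edgeSet) {x : V} (hx : x ∈ r :: L) : G.Reachable r x := by
  induction L generalizing r with
  | nil => simp at hx; rw [hx]
  | cons y L ih =>
    rcases List.mem_cons.1 hx with rfl | hx
    · rfl
    · have h1 : G.Adj r y := h s(r, y) (by simp [walkSteps])
      exact h1.reachable.trans (ih (fun e he => h e (List.mem_cons_of_mem _ he)) hx)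

theorem getLastD_mem_cons (r : V) (L : List V) : L.getLastD r ∈ r :: L := by
  induction L generalizing r with
  | nil => simp
  | cons y L ih => rw [List.getLastD_cons]; exact List.mem_cons_of_mem _ (ih y)

namespace IsContour

theorem getLastD {t : BinaryTree Unit} {r : V} {L : List V} (h : IsContour t r L) :
    L.getLastD r = r := by
  induction h with
  | nil r => rfl
  | @node t u r v L M _ _ _ _ ih =>
    rw [List.getLastD_cons, getLastD_append_cons, ih]

theorem walkSteps_node {t : BinaryTree Unit} {r v : V} {L M : List V} (h : IsContour t v L) :
    walkSteps r (v :: (L ++ r :: M)) =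
      s(r, v) :: (walkSteps v L ++ s(r, v) :: walkSteps r M) := by
  rw [walkSteps, walkSteps_append, h.getLastD, Sym2.eq_swap]

/-- The forest can be read off the walk: the first subtree avoids `r`, so it ends exactly at the
first return to `r`. -/
theorem unique {t t' : BinaryTree Unit} {r : V} {L : List V} (h : IsContour t r L)
    (h' : IsContour t' r L) : t = t' := by
  induction h generalizing t' with
  | nil r => cases h'; rfl
  | @node t u r v L M h1 h2 hd ih1 ih2 =>
    generalize hL : v :: (L ++ r :: M) = L' at h'
    cases h' with
    | nil => simp at hL
    | @node t' u' _ v' L' M' h1' h2' hd' =>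
      simp only [List.cons.injEq] at hL
      obtain ⟨rfl, hL⟩ := hL
      have hr : r ∉ L := fun hr => hd (List.mem_cons_of_mem _ hr) List.mem_cons_self
      have hr' : r ∉ L' := fun hr => hd' (List.mem_cons_of_mem _ hr) List.mem_cons_self
      have : L = L' ∧ M = M' := by
        clear * - hL hr hr'
        induction L generalizing L' with
        | nil =>
          cases L' with
          | nil => simpa using hL
          | cons y L' => exact (hr' (by simp [(List.cons.inj hL).1])).elim
        | cons y L ih =>
          cases L' with
          | nil => exact (hr (by simp [(List.cons.inj hL).1])).elim
          | cons y' L' =>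
            simp only [List.cons_append, List.cons.injEq, List.mem_cons, not_or] at hL hr hr'
            have := ih hL.2 hr.2 hr'.2
            exact ⟨by rw [hL.1, this.1], this.2⟩
      obtain ⟨rfl, rfl⟩ := this
      rw [ih1 h1', ih2 h2']

theorem map {t : BinaryTree Unit} {r : V} {L : List V} (h : IsContour t r L) {f : V → V'}
    (hf : Function.Injective f) : IsContour t (f r) (L.map f) := by
  induction h with
  | nil r => exact .nil _
  | @node t u r v L M h1 h2 hd ih1 ih2 =>
    simp only [List.map_cons, List.map_append]
    refine .node ih1 ih2 ?_
    rw [← List.map_cons, ← List.map_cons]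
    exact List.disjoint_map hf hd

/-- Contours of the same forest differ by a relabelling. The relabellings of the first subtree and
of the rest live on disjoint vertex sets, and so do their images, hence they glue to an injective
map. -/
theorem exists_map_eq {t : BinaryTree Unit} {r : V} {L : List V} {r' : V'} {L' : List V'}
    (h : IsContour t r L) (h' : IsContour t r' L') :
    ∃ f : V → V', Set.InjOn f {x | x ∈ r :: L} ∧ (r :: L).map f = r' :: L' := by
  classical
  induction h generalizing r' L' with
  | nil r => cases h'; exact ⟨fun _ => r', by simp, by simp⟩
  | @node t u r v L M h1 h2 hd ih1 ih2 =>
    cases h' with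
    | @node _ _ _ v' L' M' h1' h2' hd' =>
      obtain ⟨f, hf, ef⟩ := ih1 h1'
      obtain ⟨g, hg, eg⟩ := ih2 h2'
      have mf : ∀ x ∈ v :: L, f x ∈ v' :: L' := fun x hx => ef ▸ List.mem_map_of_mem hx
      have mg : ∀ x ∈ r :: M, g x ∈ r' :: M' := fun x hx => eg ▸ List.mem_map_of_mem hx
      refine ⟨fun x => if x ∈ v :: L then f x else g x, ?_, ?_⟩
      · have key : ∀ x, x ∈ r :: v :: (L ++ r :: M) → x ∉ v :: L → x ∈ r :: M := by
          intro x; simp only [List.mem_cons, List.mem_append]; tauto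
        intro x hx y hy hxy
        simp only at hxy
        split_ifs at hxy with h3 h4 h4
        · exact hf h3 h4 hxy
        · exact (hd' (mf x h3) (hxy ▸ mg y (key y hy h4))).elim
        · exact (hd' (mf y h4) (hxy ▸ mg x (key x hx h3))).elim
        · exact hg (key x hx h3) (key y hy h4) hxy
      · have e1 : (v :: L).map (fun x => if x ∈ v :: L then f x else g x) = v' :: L' := by
          rw [← ef]
          exact List.map_congr_left fun x hx => by simp only [hx, if_true]
        have e2 : (r :: M).map (fun x => if x ∈ v :: L then f x else g x) = r' :: M' := by
          rw [← eg]
          exact List.map_congr_left fun x hx => if_neg fun h => hd h hx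
        have e3 : (if r ∈ v :: L then f r else g r) = r' := (List.cons.inj e2).1
        have : v' :: (L' ++ r' :: M') = (v' :: L') ++ (r' :: M') := rfl
        rw [this, ← e1, ← e2, ← List.map_append, List.map_cons, e3]
        rfl

/-- Every forest has a contour: one fresh label goes to the first root, and the remaining labels are
divided between its subtree and the other trees. -/
theorem exists_of_card [DecidableEq V] (t : BinaryTree Unit) (r : V) (S : Finset V) (hr : r ∉ S)
    (hS : S.card = t.numNodes) : ∃ L, IsContour t r L ∧ ∀ x ∈ L, x = r ∨ x ∈ S := by
  induction t generalizing r S with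
  | nil => exact ⟨[], .nil r, by simp⟩
  | node _ t u ih1 ih2 =>
    rw [BinaryTree.numNodes] at hS
    obtain ⟨v, hv⟩ := Finset.card_pos.1 (by omega : 0 < S.card)
    have hc : (S.erase v).card = t.numNodes + u.numNodes := by
      rw [Finset.card_erase_of_mem hv]; omega
    obtain ⟨S₁, hS₁, c₁⟩ := Finset.exists_subset_card_eq (s := S.erase v) (n := t.numNodes)
      (by omega)
    have c₂ : ((S.erase v) \ S₁).card = u.numNodes := by
      rw [Finset.card_sdiff_of_subset hS₁]; omega
    obtain ⟨L, hL, mL⟩ := ih1 v S₁ (fun h => by simpa using hS₁ h) c₁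
    obtain ⟨M, hM, mM⟩ := ih2 r ((S.erase v) \ S₁) (by simp [hr]) c₂
    have hS₁' : ∀ x ∈ S₁, x ≠ v ∧ x ∈ S := fun x hx => by simpa using hS₁ hx
    refine ⟨v :: (L ++ r :: M), .node hL hM ?_, ?_⟩
    · intro x h1 h2
      have h1' : x = v ∨ x ∈ S₁ := by
        rcases List.mem_cons.1 h1 with h | h
        · exact Or.inl h
        · exact mL x h
      have h2' : x = r ∨ x ∈ (S.erase v) \ S₁ := by
        rcases List.mem_cons.1 h2 with h | h
        · exact Or.inl h
        · exact mM x h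
      simp only [Finset.mem_sdiff, Finset.mem_erase] at h2'
      rcases h1' with rfl | h1' <;> rcases h2' with rfl | h2'
      · exact hr hv
      · tauto
      · exact hr (hS₁' _ h1').2
      · exact h2'.2 h1'
    · intro x hx
      simp only [List.mem_cons, List.mem_append] at hx
      rcases hx with rfl | hx | rfl | hx
      · exact Or.inr hv
      · rcases mL x hx with rfl | h
        · exact Or.inr hv
        · exact Or.inr (hS₁' x h).2
      · exact Or.inl rfl
      · rcases mM x hx with rfl | h
        · exact Or.inl rfl
        · simp only [Finset.mem_sdiff, Finset.mem_erase] at h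
          exact Or.inr h.1.2

theorem length_eq {t : BinaryTree Unit} {r : V} {L : List V} (h : IsContour t r L) :
    L.length = 2 * t.numNodes := by
  induction h with
  | nil r => rfl
  | node _ _ _ ih1 ih2 => simp [ih1, ih2]; ring

theorem card_toFinset [DecidableEq V] {t : BinaryTree Unit} {r : V} {L : List V}
    (h : IsContour t r L) : (r :: L).toFinset.card = t.numNodes + 1 := by
  induction h with
  | nil r => simp
  | @node t u r v L M h1 h2 hd ih1 ih2 =>
    have : (r :: v :: (L ++ r :: M)).toFinset = (v :: L).toFinset ∪ (r :: M).toFinset := by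
      ext x; simp only [List.mem_toFinset, List.mem_cons, List.mem_append, Finset.mem_union]; tauto
    rw [this, Finset.card_union_of_disjoint (List.disjoint_toFinset_iff_disjoint.2 hd), ih1, ih2,
      BinaryTree.numNodes]
    ring

theorem root_edge_notMem {r v : V} {L M : List V} (hd : List.Disjoint (v :: L) (r :: M)) :
    s(r, v) ∉ walkSteps v L ∧ s(r, v) ∉ walkSteps r M :=
  ⟨fun h => hd (mem_of_mem_walkSteps h (Sym2.mem_mk_left r v)) List.mem_cons_self,
    fun h => hd List.mem_cons_self (mem_of_mem_walkSteps h (Sym2.mem_mk_right r v))⟩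

theorem disjoint_walkSteps {r v : V} {L M : List V} (hd : List.Disjoint (v :: L) (r :: M)) :
    List.Disjoint (walkSteps v L) (walkSteps r M) := by
  intro e h1 h2
  induction e using Sym2.ind with
  | _ x y =>
    exact hd (mem_of_mem_walkSteps h1 (Sym2.mem_mk_left x y))
      (mem_of_mem_walkSteps h2 (Sym2.mem_mk_left x y))

theorem count_walkSteps [DecidableEq V] {t : BinaryTree Unit} {r : V} {L : List V}
    (h : IsContour t r L) {e : Sym2 V} (he : e ∈ walkSteps r L) : (walkSteps r L).count e = 2 := by
  induction h with
  | nil r => simp [walkSteps] at he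
  | @node t u r v L M h1 h2 hd ih1 ih2 =>
    rw [h1.walkSteps_node] at he ⊢
    obtain ⟨n1, n2⟩ := root_edge_notMem hd
    have hdis := disjoint_walkSteps hd
    by_cases h0 : e = s(r, v)
    · subst h0
      simp [List.count_append, List.count_eq_zero_of_not_mem n1,
        List.count_eq_zero_of_not_mem n2]
    · have h0' : ¬ s(r, v) = e := fun h => h0 h.symm
      simp only [List.mem_cons, h0, false_or, List.mem_append] at he
      rcases he with he | he
      · have := List.count_eq_zero_of_not_mem (fun h => hdis he h)
        simp [List.count_append, h0', ih1 he, this]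
      · have := List.count_eq_zero_of_not_mem (fun h => hdis h he)
        simp [List.count_append, h0', ih2 he, this]

theorem card_toFinset_walkSteps [DecidableEq V] {t : BinaryTree Unit} {r : V} {L : List V}
    (h : IsContour t r L) : (walkSteps r L).toFinset.card = t.numNodes := by
  induction h with
  | nil r => simp [walkSteps]
  | @node t u r v L M h1 h2 hd ih1 ih2 =>
    obtain ⟨n1, n2⟩ := root_edge_notMem hd
    have : (s(r, v) :: (walkSteps v L ++ s(r, v) :: walkSteps r M)).toFinset =
        insert s(r, v) ((walkSteps v L).toFinset ∪ (walkSteps r M).toFinset) := by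
      ext x
      simp only [List.mem_toFinset, List.mem_cons, List.mem_append, Finset.mem_union,
        Finset.mem_insert]; tauto
    rw [h1.walkSteps_node, this, Finset.card_insert_of_notMem (by simp [n1, n2]),
      Finset.card_union_of_disjoint
        (List.disjoint_toFinset_iff_disjoint.2 (disjoint_walkSteps hd)), ih1, ih2,
      BinaryTree.numNodes]

theorem not_isDiag {t : BinaryTree Unit} {r : V} {L : List V} (h : IsContour t r L) {e : Sym2 V}
    (he : e ∈ walkSteps r L) : ¬ e.IsDiag := by
  induction h with
  | nil r => simp [walkSteps] at he
  | @node t u r v L M h1 h2 hd ih1 ih2 =>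
    have h0 : r ≠ v := fun h => hd (List.mem_cons_self) (h ▸ List.mem_cons_self)
    rw [h1.walkSteps_node] at he
    simp only [List.mem_cons, List.mem_append] at he
    rcases he with rfl | he | rfl | he
    · simpa using h0
    · exact ih1 he
    · simpa using h0
    · exact ih2 he

/-- The graph browsed by a contour walk through all vertices is a tree. -/
theorem isTree [Fintype V] {t : BinaryTree Unit} {r : V} {L : List V}
    (h : IsContour t r L) (hV : Fintype.card V = t.numNodes + 1) :
    (SimpleGraph.fromEdgeSet {e | e ∈ walkSteps r L}).IsTree ∧
      (SimpleGraph.fromEdgeSet {e | e ∈ walkSteps r L}).edgeSet = {e | e ∈ walkSteps r L} := by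
  classical
  have hE : (SimpleGraph.fromEdgeSet {e | e ∈ walkSteps r L}).edgeSet
      = {e | e ∈ walkSteps r L} := by
    rw [SimpleGraph.edgeSet_fromEdgeSet]
    ext e
    simp only [Set.mem_sdiff, Set.mem_ofPred_eq, and_iff_left_iff_imp]
    exact fun he => h.not_isDiag he
  refine ⟨?_, hE⟩
  rw [SimpleGraph.isTree_iff_connected_and_card, hE]
  have huniv : (r :: L).toFinset = Finset.univ :=
    Finset.eq_univ_of_card _ (by rw [h.card_toFinset, hV])
  constructor
  · have hr : ∀ x, (SimpleGraph.fromEdgeSet {e | e ∈ walkSteps r L}).Reachable r x := fun x =>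
      reachable_of_walkSteps (L := L) (fun e he => by rw [hE]; exact he)
        (List.mem_toFinset.1 (huniv ▸ Finset.mem_univ x))
    exact { preconnected := fun x y => (hr x).symm.trans (hr y), nonempty := ⟨r⟩ }
  · rw [Nat.card_eq_fintype_card (α := V), hV, ← h.card_toFinset_walkSteps, ← Set.ncard_coe_finset,
      List.coe_toFinset]
    rfl

end IsContour

/-- A closed walk in a forest that browses each of its edges twice is a contour walk. -/
theorem exists_isContour [DecidableEq V] {G : SimpleGraph V} (hG : G.IsAcyclic) (r : V)
    (L : List V) (hE : ∀ e ∈ walkSteps r L, e ∈ G.edgeSet) (hlast : L.getLastD r = r)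
    (hcount : ∀ e ∈ walkSteps r L, (walkSteps r L).count e = 2) : ∃ t, IsContour t r L := by
  induction hn : L.length using Nat.strong_induction_on generalizing r L with
  | _ n ih =>
  cases L with
  | nil => exact ⟨.nil, .nil r⟩
  | cons v M =>
    have hadj : s(r, v) ∈ G.edgeSet := hE _ (by simp [walkSteps])
    -- In a forest the first edge is a bridge. Between its two crossings the walk therefore stays on
    -- the side of `v`, the second crossing leads back from `v` to `r`, and afterwards the walk
    -- stays on the side of `r`. This separates the two subwalks.
    have hbr := SimpleGraph.isBridge_iff.1 (SimpleGraph.isAcyclic_iff_forall_isBridge.1 hG hadj)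
    have hc0 := hcount s(r, v) (by simp [walkSteps])
    have hmem : s(r, v) ∈ walkSteps v M := by
      rw [← List.count_pos_iff]
      simp only [walkSteps, List.count_cons_self] at hc0
      omega
    obtain ⟨L₁, x, L₂, rfl, he, hn1⟩ := exists_split_of_mem_walkSteps hmem
    set H := G.deleteEdges {s(r, v)} with hH
    have hHe : ∀ e, e ∈ G.edgeSet → e ≠ s(r, v) → e ∈ H.edgeSet := fun e h1 h2 => by
      rw [hH, SimpleGraph.edgeSet_deleteEdges]; exact ⟨h1, h2⟩
    have hst : walkSteps r (v :: (L₁ ++ x :: L₂)) =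
        s(r, v) :: (walkSteps v L₁ ++ s(r, v) :: walkSteps x L₂) := by
      rw [walkSteps, walkSteps_append, ← he]
    have hn2 : s(r, v) ∉ walkSteps x L₂ := by
      rw [← List.count_pos_iff]
      rw [hst] at hc0
      simp only [List.count_cons_self, List.count_append] at hc0
      omega
    rw [hst] at hE hcount
    have r1 : ∀ y ∈ v :: L₁, H.Reachable v y := fun y hy => reachable_of_walkSteps
      (fun e h => hHe e (hE e (by simp [h])) (fun h' => hn1 (h' ▸ h))) hy
    have hl1 : L₁.getLastD v = v ∧ x = r := by
      rcases Sym2.eq_iff.1 he with ⟨h1, h2⟩ | ⟨h1, h2⟩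
      · exact (hbr (h1 ▸ (r1 _ (getLastD_mem_cons v L₁)).symm)).elim
      · exact ⟨h2.symm, h1.symm⟩
    obtain ⟨hl1, rfl⟩ := hl1
    have r2 : ∀ y ∈ x :: L₂, H.Reachable x y := fun y hy => reachable_of_walkSteps
      (fun e h => hHe e (hE e (by simp [h])) (fun h' => hn2 (h' ▸ h))) hy
    have hd : List.Disjoint (v :: L₁) (x :: L₂) := fun y h1 h2 =>
      hbr ((r2 y h2).trans (r1 y h1).symm)
    have hl2 : L₂.getLastD x = x := by
      rwa [List.getLastD_cons, getLastD_append_cons] at hlast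
    have hdis := IsContour.disjoint_walkSteps hd
    simp only [List.length_cons, List.length_append] at hn
    obtain ⟨t, ht⟩ := ih L₁.length (by omega) v L₁ (fun e h => hE e (by simp [h])) hl1
      (fun e h => by
        have h0 : ¬ s(x, v) = e := fun h' => hn1 (h' ▸ h)
        have h3 := List.count_eq_zero_of_not_mem (fun h' => hdis h h')
        have := hcount e (by simp [h])
        simpa [List.count_cons, List.count_append, h0, h3] using this) rfl
    obtain ⟨u, hu⟩ := ih L₂.length (by omega) x L₂ (fun e h => hE e (by simp [h])) hl2
      (fun e h => by
        have h0 : ¬ s(x, v) = e := fun h' => hn2 (h' ▸ h)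
        have h3 := List.count_eq_zero_of_not_mem (fun h' => hdis h' h)
        have := hcount e (by simp [h])
        simpa [List.count_cons, List.count_append, h0, h3] using this) rfl
    exact ⟨.node () t u, .node ht hu hd⟩

end Contour

/-! ### Odd edges along a contour walk -/

section OddEdges

variable {V : Type*} {G : SimpleGraph V}

/-- A vertex has one parent: geodesics through two parents would be two paths from the root. -/
theorem SimpleGraph.IsTree.eq_of_adj_of_dist_eq (hG : G.IsTree) {ρ u v x : V}
    (hu : G.Adj u v) (hx : G.Adj x v) (du : G.dist ρ v = G.dist ρ u + 1)
    (dx : G.dist ρ v = G.dist ρ x + 1) : x = u := by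
  obtain ⟨p, hp⟩ := hG.connected.exists_walk_length_eq_dist ρ u
  obtain ⟨q, hq⟩ := hG.connected.exists_walk_length_eq_dist ρ x
  have h1 : (p.concat hu).IsPath := SimpleGraph.Walk.isPath_of_length_eq_dist _ (by simp [hp, du])
  have h2 : (q.concat hx).IsPath := SimpleGraph.Walk.isPath_of_length_eq_dist _ (by simp [hq, dx])
  have h3 := (hG.existsUnique_path ρ v).unique h1 h2
  have := congrArg SimpleGraph.Walk.penultimate h3
  simpa using this.symm

theorem mem_oddEdges_iff {s : ℕ} {G : SimpleGraph (Fin s)} {ρ r v : Fin s} (h : G.Adj r v)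
    (hd : G.dist ρ v = G.dist ρ r + 1) : s(r, v) ∈ oddEdges G ρ ↔ Odd (G.dist ρ v) := by
  constructor
  · rintro ⟨-, u, w, he, h1, h2⟩
    rcases Sym2.eq_iff.1 he with ⟨rfl, rfl⟩ | ⟨rfl, rfl⟩
    · exact h2
    · omega
  · exact fun ho => ⟨h, r, v, rfl, hd, ho⟩

/-- The number of odd edges browsed by a contour walk below a vertex `r` of a rooted tree. -/
theorem IsContour.card_odd {s : ℕ} {G : SimpleGraph (Fin s)} (hG : G.IsTree) {ρ : Fin s}
    [DecidablePred (· ∈ oddEdges G ρ)]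
    {t : BinaryTree Unit} {r : Fin s} {L : List (Fin s)} (h : IsContour t r L)
    (hE : ∀ e ∈ walkSteps r L, e ∈ G.edgeSet)
    (hd : ∀ x, s(r, x) ∈ walkSteps r L → G.dist ρ x = G.dist ρ r + 1) :
    ((walkSteps r L).toFinset.filter (· ∈ oddEdges G ρ)).card =
      parityCount (decide (Even (G.dist ρ r))) t := by
  induction h with
  | nil r => simp [walkSteps, parityCount]
  | @node t u r v L M h1 h2 hdis ih1 ih2 =>
    obtain ⟨n1, n2⟩ := root_edge_notMem hdis
    have hset : (s(r, v) :: (walkSteps v L ++ s(r, v) :: walkSteps r M)).toFinset =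
        insert s(r, v) ((walkSteps v L).toFinset ∪ (walkSteps r M).toFinset) := by
      ext x
      simp only [List.mem_toFinset, List.mem_cons, List.mem_append, Finset.mem_union,
        Finset.mem_insert]; tauto
    rw [h1.walkSteps_node] at hE hd ⊢
    have hadj : G.Adj r v := hE s(r, v) (by simp)
    have hv : G.dist ρ v = G.dist ρ r + 1 := hd v (by simp)
    have hE1 : ∀ e ∈ walkSteps v L, e ∈ G.edgeSet := fun e h => hE e (by simp [h])
    have i1 := ih1 hE1 (fun x hx => by
      have hvx : G.Adj v x := hE1 _ hx
      -- A neighbour of `v` closer to the root could only be its parent `r`, which the subwalk below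
      -- `v` avoids.
      rcases hG.dist_eq_dist_add_one_of_adj ρ hvx with h | h
      · have := hG.eq_of_adj_of_dist_eq hadj hvx.symm hv h
        subst this
        exact (hdis (mem_of_mem_walkSteps hx (Sym2.mem_mk_right v x)) List.mem_cons_self).elim
      · exact h)
    have i2 := ih2 (fun e h => hE e (by simp [h])) (fun x hx => hd x (by simp [hx]))
    have hev : decide (Even (G.dist ρ v)) = !decide (Even (G.dist ρ r)) := by
      rw [hv]; by_cases h : Even (G.dist ρ r) <;> simp [Nat.even_add_one, h]
    rw [hset, Finset.filter_insert, Finset.filter_union]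
    have hcu : (((walkSteps v L).toFinset.filter (· ∈ oddEdges G ρ)) ∪
        ((walkSteps r M).toFinset.filter (· ∈ oddEdges G ρ))).card =
        parityCount (!decide (Even (G.dist ρ r))) t +
          parityCount (decide (Even (G.dist ρ r))) u := by
      rw [Finset.card_union_of_disjoint, i1, i2, hev]
      exact Finset.disjoint_filter_filter
        (List.disjoint_toFinset_iff_disjoint.2 (disjoint_walkSteps hdis))
    have hodd : s(r, v) ∈ oddEdges G ρ ↔ Even (G.dist ρ r) := by
      rw [mem_oddEdges_iff hadj hv, hv, Nat.odd_add_one, Nat.not_odd_iff_even]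
    by_cases hr : Even (G.dist ρ r)
    · rw [if_pos (hodd.2 hr), Finset.card_insert_of_notMem (by simp [n1, n2]), hcu]
      simp only [hr, decide_true, parityCount, if_true]
      ring
    · rw [if_neg (fun h => hr (hodd.1 h)), hcu]
      simp [hr, parityCount]

end OddEdges

/-! ### Words and contour walks -/

theorem browseCount_eq_count {N s : ℕ} (w : Fin (N + 1) → Fin s) (e : Sym2 (Fin s)) :
    browseCount w e = (walkSteps (w 0) (List.ofFn fun j : Fin N => w j.succ)).count e := by
  induction N with
  | zero => simp [browseCount, walkSteps]
  | succ N ih =>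
    have := ih (fun j => w j.succ)
    rw [List.ofFn_succ, walkSteps, List.count_cons]
    simp only [Fin.succ_zero_eq_one] at this ⊢
    rw [← this]
    unfold browseCount
    rw [Fin.card_filter_univ_succ]
    by_cases h : s(w 0, w 1) = e
    · simp [h]
    · simp [h]

theorem forall_mem_walkSteps_iff {N s : ℕ} (w : Fin (N + 1) → Fin s) (p : Sym2 (Fin s) → Prop) :
    (∀ e ∈ walkSteps (w 0) (List.ofFn fun j : Fin N => w j.succ), p e) ↔
      ∀ j : Fin N, p s(w j.castSucc, w j.succ) := by
  induction N with
  | zero => simp [walkSteps]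
  | succ N ih =>
    have := ih (fun j => w j.succ)
    rw [List.ofFn_succ, walkSteps, List.forall_mem_cons, Fin.forall_fin_succ]
    simp only [Fin.succ_zero_eq_one, Fin.castSucc_zero] at this ⊢
    rw [this]
    rfl

theorem getLastD_ofFn {N s : ℕ} (w : Fin (N + 1) → Fin s) :
    (List.ofFn fun j : Fin N => w j.succ).getLastD (w 0) = w (Fin.last N) := by
  induction N with
  | zero => simp
  | succ N ih =>
    have := ih (fun j => w j.succ)
    rw [List.ofFn_succ, List.getLastD_cons]
    exact this

/-- A closed word with `2k` steps on a tree with `k` edges, all browsed twice and `l` of them odd,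
is the contour walk of a plane forest with `k` vertices, `l` of which lie at an odd level. -/
theorem IsTreeWord.exists_isContour {k l : ℕ} {w : Fin (2 * k + 1) → Fin (k + 1)}
    (h : IsTreeWord k k l (fun _ => 2) w) :
    ∃ t, IsContour t (w 0) (List.ofFn fun j : Fin (2 * k) => w j.succ) ∧ t.numNodes = k ∧
      parityCount true t = l := by
  classical
  obtain ⟨hc, G, hG, hadj, hl, e, he⟩ := h
  have hE := (forall_mem_walkSteps_iff w (· ∈ G.edgeSet)).2 hadj
  have hcount : ∀ f ∈ G.edgeSet,
      (walkSteps (w 0) (List.ofFn fun j : Fin (2 * k) => w j.succ)).count f = 2 := by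
    intro f hf
    rw [← browseCount_eq_count]
    simpa using he (e.symm ⟨f, hf⟩)
  obtain ⟨t, ht⟩ := _root_.exists_isContour hG.isAcyclic (w 0) _ hE
    (by rw [getLastD_ofFn, hc]) (fun f hf => hcount f (hE f hf))
  refine ⟨t, ht, ?_, ?_⟩
  · have := ht.length_eq
    rw [List.length_ofFn] at this
    omega
  · have := ht.card_odd hG (ρ := w 0) hE (fun x hx => by
      rw [SimpleGraph.dist_self, zero_add, SimpleGraph.dist_eq_one_iff_adj]
      exact hE _ hx)
    simp only [SimpleGraph.dist_self, Even.zero, decide_true] at this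
    rw [← this, ← hl, ← Set.ncard_coe_finset]
    congr 1
    ext f
    simp only [Finset.coe_filter, List.mem_toFinset, Set.mem_ofPred_eq]
    -- An odd edge of the tree is browsed twice, so it does occur in the walk.
    exact ⟨fun h => h.2, fun h =>
      ⟨List.count_pos_iff.1 (by rw [hcount f h.1]; norm_num), h⟩⟩

/-- Contour walks are tree words. -/
theorem IsContour.isTreeWord {t : BinaryTree Unit} {k : ℕ} {w : Fin (2 * k + 1) → Fin (k + 1)}
    (h : IsContour t (w 0) (List.ofFn fun j : Fin (2 * k) => w j.succ)) (hk : t.numNodes = k) :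
    IsTreeWord k k (parityCount true t) (fun _ => 2) w := by
  classical
  obtain ⟨hG, hE⟩ := h.isTree (by simp [hk])
  set G := SimpleGraph.fromEdgeSet
    {e | e ∈ walkSteps (w 0) (List.ofFn fun j : Fin (2 * k) => w j.succ)} with hGdef
  have hcard : Nat.card G.edgeSet = k := by
    have := h.card_toFinset_walkSteps
    rw [hk, ← Set.ncard_coe_finset, List.coe_toFinset] at this
    rw [hE]
    exact this
  have hw : IsTreeWord k k ((oddEdges G (w 0)).ncard) (fun _ => 2) w := by
    refine ⟨by rw [← getLastD_ofFn w, h.getLastD], G, hG,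
      (forall_mem_walkSteps_iff w (· ∈ G.edgeSet)).1 (fun e he => by rw [hE]; exact he), rfl,
      ((Finite.equivFinOfCardEq hcard).symm), fun i => ?_⟩
    rw [browseCount_eq_count]
    apply h.count_walkSteps
    have := hE.le ((Finite.equivFinOfCardEq hcard).symm i).2
    exact this
  -- The number of odd edges was left unevaluated; reading a forest back from the word evaluates it,
  -- and uniqueness says that this forest is `t`.
  obtain ⟨t', ht', -, hp⟩ := hw.exists_isContour
  rwa [← hp, ht'.unique h] at hw

/-- The number of classes of words browsing each edge twice. -/
theorem treeWordCount_two (k l : ℕ) :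
    treeWordCount k k l (fun _ => 2) =
      ((BinaryTree.treesOfNumNodesEq k).filter fun t => parityCount true t = l).card := by
  classical
  have hword : ∀ t : BinaryTree Unit, t.numNodes = k → ∃ w : Fin (2 * k + 1) → Fin (k + 1),
      IsContour t (w 0) (List.ofFn fun j : Fin (2 * k) => w j.succ) := by
    intro t ht
    obtain ⟨L, hL, -⟩ := IsContour.exists_of_card t (0 : Fin (k + 1)) (Finset.univ.erase 0)
      (by simp) (by simp [ht])
    have hlen : L.length = 2 * k := by rw [hL.length_eq, ht]
    refine ⟨Fin.cons 0 fun j => L.get (j.cast hlen.symm), ?_⟩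
    simp only [Fin.cons_zero, Fin.cons_succ]
    convert hL using 1
    apply List.ext_get (by simp [hlen])
    intro n h1 h2
    simp
  choose! word hword using hword
  have hspec : ∀ t : {t // t ∈ (BinaryTree.treesOfNumNodesEq k).filter
      fun t => parityCount true t = l}, t.1.numNodes = k ∧ parityCount true t.1 = l := by
    rintro ⟨t, ht⟩
    simpa [BinaryTree.mem_treesOfNumNodesEq] using ht
  have hwd : ∀ t : {t // t ∈ (BinaryTree.treesOfNumNodesEq k).filter
      fun t => parityCount true t = l}, IsTreeWord k k l (fun _ => 2) (word t.1) := by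
    intro t
    have := (hword t.1 (hspec t).1).isTreeWord (hspec t).1
    rwa [(hspec t).2] at this
  have hmap : ∀ {w w' : Fin (2 * k + 1) → Fin (k + 1)} (σ : Fin (k + 1) → Fin (k + 1)),
      (∀ j, σ (w j) = w' j) → (List.ofFn fun j : Fin (2 * k) => w j.succ).map σ =
        List.ofFn fun j : Fin (2 * k) => w' j.succ := by
    intro w w' σ h
    simp [List.map_ofFn, Function.comp_def, h]
  rw [treeWordCount, ← Fintype.card_coe, ← Nat.card_eq_fintype_card]
  symm
  apply Nat.card_congr
  -- A forest is sent to the class of a chosen contour. Injectivity: relabelling preserves the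
  -- forest, which the walk determines. Surjectivity: every word is a contour, and contours of one
  -- forest are relabellings of each other.
  refine Equiv.ofBijective (fun t => Quotient.mk (treeWordSetoid k k l fun _ => 2)
    ⟨word t.1, hwd t⟩) ⟨?_, ?_⟩
  · intro t t' htt
    obtain ⟨σ, hσ⟩ := Quotient.exact htt
    simp only at hσ
    have h1 := (hword t.1 (hspec t).1).map σ.injective
    rw [hmap σ hσ, hσ] at h1
    exact Subtype.ext (h1.unique (hword t'.1 (hspec t').1))
  · intro q
    obtain ⟨⟨w, hw⟩, rfl⟩ := Quotient.exists_rep q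
    obtain ⟨t, ht, hk, hl⟩ := hw.exists_isContour
    refine ⟨⟨t, by simp [BinaryTree.mem_treesOfNumNodesEq, hk, hl]⟩, Quotient.sound ?_⟩
    obtain ⟨f, hf, ef⟩ := (hword t hk).exists_map_eq ht
    -- The chosen contour visits all `k + 1` vertices, so `f` is injective everywhere and is a
    -- permutation.
    have huniv : ∀ x, x ∈ word t 0 :: List.ofFn fun j : Fin (2 * k) => word t j.succ := by
      intro x
      have hu := Finset.eq_univ_of_card
        (word t 0 :: List.ofFn fun j : Fin (2 * k) => word t j.succ).toFinset
        (by rw [(hword t hk).card_toFinset, hk, Fintype.card_fin])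
      exact List.mem_toFinset.1 (hu ▸ Finset.mem_univ x)
    have hinj : Function.Injective f := fun x y hxy => hf (huniv x) (huniv y) hxy
    refine ⟨Equiv.ofBijective f hinj.bijective_of_finite, fun j => ?_⟩
    rw [← List.ofFn_succ (f := word t), ← List.ofFn_succ (f := w), List.map_ofFn,
      List.ofFn_inj] at ef
    exact congrFun ef j

/-! ### Narayana polynomials -/

/-- The generating polynomial of plane forests with `k` vertices by the number of vertices at odd
level (`b = true`) or even level (`b = false`). -/
def parityPoly (α : ℝ) (b : Bool) (k : ℕ) : ℝ :=
  ∑ t ∈ BinaryTree.treesOfNumNodesEq k, α ^ parityCount b t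

theorem parityPoly_zero (α : ℝ) (b : Bool) : parityPoly α b 0 = 1 := by
  simp [parityPoly, parityCount]

/-- Removes the first root. The vertices below it form a forest whose levels are shifted by one,
which exchanges the parities; the remaining trees keep theirs. -/
theorem parityPoly_succ (α : ℝ) (b : Bool) (k : ℕ) :
    parityPoly α b (k + 1) = (if b then α else 1) *
      ∑ p ∈ Finset.HasAntidiagonal.antidiagonal k, parityPoly α (!b) p.1 * parityPoly α b p.2 := by
  classical
  rw [parityPoly, BinaryTree.treesOfNumNodesEq_succ, Finset.sum_biUnion, Finset.mul_sum]
  · refine Finset.sum_congr rfl fun p _ => ?_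
    rw [BinaryTree.pairwiseNode, Finset.sum_map, Finset.sum_product, parityPoly, parityPoly,
      Finset.sum_mul_sum, Finset.mul_sum]
    refine Finset.sum_congr rfl fun t _ => ?_
    rw [Finset.mul_sum]
    refine Finset.sum_congr rfl fun u _ => ?_
    change α ^ parityCount b (.node () t u) = _
    rw [parityCount, pow_add, pow_add]
    cases b <;> simp [mul_assoc]
  · intro p _ q _ hpq
    rw [Function.onFun, Finset.disjoint_left]
    intro t h1 h2
    simp only [BinaryTree.pairwiseNode, Finset.mem_map, Finset.mem_product,
      BinaryTree.mem_treesOfNumNodesEq] at h1 h2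
    obtain ⟨x, hx, rfl⟩ := h1
    obtain ⟨y, hy, h⟩ := h2
    obtain ⟨-, h⟩ := BinaryTree.node.inj (h : BinaryTree.node () y.1 y.2 = .node () x.1 x.2)
    exact hpq (Prod.ext (by rw [← hx.1, ← hy.1, h.1]) (by rw [← hx.2, ← hy.2, h.2]))

/-- Exchanging the roles of first child and next sibling at the first root swaps the two factors in
the recursion, so both parities share the same sum and differ only by the weight `α` of that root.
-/
theorem parityPoly_true_succ (α : ℝ) (k : ℕ) :
    parityPoly α true (k + 1) = α * parityPoly α false (k + 1) := by
  rw [parityPoly_succ, parityPoly_succ, ← Finset.Nat.sum_antidiagonal_swap]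
  simp [mul_comm]

/-- The quadratic recursion of the Narayana polynomials. -/
theorem parityPoly_true_rec (α : ℝ) (k : ℕ) :
    parityPoly α true (k + 1) =
      (∑ p ∈ Finset.HasAntidiagonal.antidiagonal k, parityPoly α true p.1 * parityPoly α true p.2) +
        (α - 1) * parityPoly α true k := by
  rw [parityPoly_succ]
  cases k with
  | zero => simp [parityPoly_zero]
  | succ k =>
    -- Parities can be exchanged at the cost of `α` except in degree `0`, where both polynomials are
    -- `1`. The term `p.1 = 0` is split off and produces the correction `α - 1`.
    rw [Finset.Nat.sum_antidiagonal_succ, Finset.Nat.sum_antidiagonal_succ, mul_add,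
      Finset.mul_sum]
    have : ∀ p ∈ Finset.HasAntidiagonal.antidiagonal k,
        α * (parityPoly α (!true) (p.1 + 1) * parityPoly α true p.2) =
          parityPoly α true (p.1 + 1) * parityPoly α true p.2 := by
      intro p _
      rw [parityPoly_true_succ α p.1, ← mul_assoc]
      rfl
    simp only [if_true]
    rw [Finset.sum_congr rfl this]
    simp only [parityPoly_zero]
    ring

theorem parityCount_le (b : Bool) (t : BinaryTree Unit) : parityCount b t ≤ t.numNodes := by
  induction t generalizing b with
  | nil => simp [parityCount]
  | node _ l r ihl ihr =>
    have h1 := ihl (!b)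
    have h2 := ihr b
    rw [parityCount, BinaryTree.numNodes]
    split_ifs <;> omega

theorem one_le_parityCount {t : BinaryTree Unit} (h : t.numNodes ≠ 0) :
    1 ≤ parityCount true t := by
  cases t with
  | nil => simp at h
  | node _ l r => rw [parityCount, if_pos rfl]; omega

/-- A nonzero product forces all `b i = 2`, and `∑ b i = 2k` then forces `a = k`. What remains
counts forests by their number of odd-level vertices. -/
theorem limitMoment_eq_parityPoly {A : ℕ → ℝ} (h2 : A 2 = 1) (hA : ∀ k, 2 < k → A k = 0) (α : ℝ)
    {k : ℕ} (hk : 1 ≤ k) : limitMoment A α k = parityPoly α true k := by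
  classical
  have hsum : ∀ a ∈ Finset.Icc 1 k, ∀ b ∈ multiplicityTuples k a,
      (∏ i, A (b i)) ≠ 0 → b = fun _ => 2 := by
    intro a _ b hb hprod
    simp only [multiplicityTuples, Finset.mem_filter, Fintype.mem_piFinset, Finset.mem_Icc] at hb
    funext i
    have := Finset.prod_ne_zero_iff.1 hprod i (Finset.mem_univ i)
    by_contra h
    exact this (hA _ (lt_of_le_of_ne (hb.1 i).1 (Ne.symm h)))
  have hmem : (fun _ => 2) ∈ multiplicityTuples k k := by
    simp only [multiplicityTuples, Finset.mem_filter, Fintype.mem_piFinset, Finset.mem_Icc]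
    exact ⟨fun _ => ⟨le_rfl, by omega⟩, fun _ _ _ => le_rfl, by simp [mul_comm]⟩
  rw [limitMoment, Finset.sum_eq_single k]
  · have : ∀ l ∈ Finset.Icc 1 k, (α ^ l * ∑ b ∈ multiplicityTuples k k,
        (treeWordCount k k l b : ℝ) * ∏ i, A (b i)) =
        ∑ t ∈ (BinaryTree.treesOfNumNodesEq k).filter (fun t => parityCount true t = l),
          α ^ parityCount true t := by
      intro l _
      rw [Finset.sum_eq_single_of_mem _ hmem (fun b hb hne => by
        by_contra h
        exact hne (hsum k (by simp [hk]) b hb (right_ne_zero_of_mul h)))]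
      simp only [h2, Finset.prod_const_one, mul_one]
      rw [treeWordCount_two,
        Finset.sum_congr rfl (fun t ht => by rw [(Finset.mem_filter.1 ht).2] :
          ∀ t ∈ _, α ^ parityCount true t = α ^ l), Finset.sum_const, nsmul_eq_mul, mul_comm]
    rw [Finset.sum_congr rfl this, parityPoly]
    refine Finset.sum_fiberwise_of_maps_to (fun t ht => ?_) _
    rw [BinaryTree.mem_treesOfNumNodesEq] at ht
    exact Finset.mem_Icc.2 ⟨one_le_parityCount (by omega), ht ▸ parityCount_le true t⟩
  · intro a ha hne
    refine Finset.sum_eq_zero fun l _ => mul_eq_zero_of_right _ (Finset.sum_eq_zero fun b hb => ?_)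
    by_contra h
    have hb2 := hsum a ha b hb (right_ne_zero_of_mul h)
    simp only [multiplicityTuples, Finset.mem_filter] at hb
    have := hb.2.2
    rw [hb2] at this
    simp at this
    omega
  · intro h
    simp [hk] at h

/-! ### The Marchenko–Pastur law -/

/-- The difference of the two sides is `(q + cos θ) ^ 2`. -/
theorem sin_sq_le_quadratic (q θ : ℝ) : Real.sin θ ^ 2 ≤ 1 + 2 * q * Real.cos θ + q ^ 2 := by
  nlinarith [Real.sin_sq_add_cos_sq θ, sq_nonneg (q + Real.cos θ)]

theorem sin_sq_div_quadratic_mem (q θ : ℝ) :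
    Real.sin θ ^ 2 / (1 + 2 * q * Real.cos θ + q ^ 2) ∈ Set.Icc (0 : ℝ) 1 :=
  ⟨div_nonneg (sq_nonneg _) ((sq_nonneg _).trans (sin_sq_le_quadratic q θ)),
    div_le_one_of_le₀ (sin_sq_le_quadratic q θ) ((sq_nonneg _).trans (sin_sq_le_quadratic q θ))⟩

theorem integrable_sin_sq_div (q : ℝ) :
    IntegrableOn (fun θ => Real.sin θ ^ 2 / (1 + 2 * q * Real.cos θ + q ^ 2))
      (Set.Icc 0 Real.pi) := by
  refine Measure.integrableOn_of_bounded (M := 1) (by simp) (Measurable.aestronglyMeasurable (by fun_prop))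
    (Eventually.of_forall fun θ => ?_)
  have := sin_sq_div_quadratic_mem q θ
  rw [Real.norm_of_nonneg this.1]
  exact this.2

/-- For `q < 1` there is an explicit antiderivative; its arctangent is the argument of `1 + q
e^{iθ}` and vanishes at both endpoints. At `q = 1` the denominator vanishes at `π`, but elsewhere on
the interval the integrand is `(1 - cos θ) / 2`. -/
theorem integral_sin_sq_div {q : ℝ} (h0 : 0 < q) (h1 : q ≤ 1) :
    ∫ θ in (0 : ℝ)..Real.pi, Real.sin θ ^ 2 / (1 + 2 * q * Real.cos θ + q ^ 2) = Real.pi / 2 := by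
  rcases h1.lt_or_eq with h1 | rfl
  · have hc : ∀ θ, 0 < 1 + q * Real.cos θ := fun θ => by
      nlinarith [Real.neg_one_le_cos θ]
    have hD : ∀ θ, 0 < 1 + 2 * q * Real.cos θ + q ^ 2 := fun θ => by
      nlinarith [Real.neg_one_le_cos θ]
    have key : ∀ θ, HasDerivAt (fun θ : ℝ =>
        -((1 + q ^ 2) * θ + 2 * q * Real.sin θ) / (4 * q ^ 2) + (1 + q ^ 2) * θ / (2 * q ^ 2)
          - (1 - q ^ 2) / (4 * q ^ 2) *
            (θ - 2 * Real.arctan (q * Real.sin θ / (1 + q * Real.cos θ))))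
        (Real.sin θ ^ 2 / (1 + 2 * q * Real.cos θ + q ^ 2)) θ := by
      intro θ
      have ha := (((Real.hasDerivAt_sin θ).const_mul q).div
        (((Real.hasDerivAt_cos θ).const_mul q).const_add 1) (hc θ).ne').arctan
      have h1 := (((hasDerivAt_id θ).const_mul (1 + q ^ 2)).add
        ((Real.hasDerivAt_sin θ).const_mul (2 * q))).neg.div_const (4 * q ^ 2)
      have h2 := ((hasDerivAt_id θ).const_mul (1 + q ^ 2)).div_const (2 * q ^ 2)
      have h3 := ((hasDerivAt_id θ).sub (ha.const_mul 2)).const_mul ((1 - q ^ 2) / (4 * q ^ 2))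
      refine ((h1.add h2).sub h3).congr_deriv ?_
      have e1 : 1 + (q * Real.sin θ / (1 + q * Real.cos θ)) ^ 2 =
          (1 + 2 * q * Real.cos θ + q ^ 2) / (1 + q * Real.cos θ) ^ 2 := by
        have := hc θ
        field_simp
        linear_combination q ^ 2 * Real.sin_sq_add_cos_sq θ
      have e2 : Real.sin θ ^ 2 = 1 - Real.cos θ ^ 2 := by
        linear_combination Real.sin_sq_add_cos_sq θ
      have e3 : 1 / (1 + (q * Real.sin θ / (1 + q * Real.cos θ)) ^ 2) *
          ((q * Real.cos θ * (1 + q * Real.cos θ) - q * Real.sin θ * (q * -Real.sin θ)) /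
            (1 + q * Real.cos θ) ^ 2) =
          q * (Real.cos θ + q) / (1 + 2 * q * Real.cos θ + q ^ 2) := by
        rw [e1]
        have := hc θ
        have := hD θ
        field_simp
        linear_combination q * Real.sin_sq_add_cos_sq θ
      simp only [Pi.div_apply]
      rw [e3, e2]
      have hne := (hD θ).ne'
      generalize hDdef : 1 + 2 * q * Real.cos θ + q ^ 2 = D at hne ⊢
      have hcos : Real.cos θ = (D - 1 - q ^ 2) / (2 * q) := by
        rw [← hDdef]; field_simp; ring
      rw [hcos]
      field_simp
      ring
    rw [intervalIntegral.integral_eq_sub_of_hasDerivAt (fun θ _ => key θ)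
      ((intervalIntegrable_iff_integrableOn_Icc_of_le Real.pi_pos.le).2 (integrable_sin_sq_div q))]
    simp
    field_simp
    ring
  · have : ∫ θ in (0 : ℝ)..Real.pi, Real.sin θ ^ 2 / (1 + 2 * 1 * Real.cos θ + 1 ^ 2) =
        ∫ θ in (0 : ℝ)..Real.pi, (1 - Real.cos θ) / 2 := by
      apply intervalIntegral.integral_congr_ae
      have h : ∀ᵐ θ : ℝ, θ ≠ Real.pi := by simp [ae_iff]
      filter_upwards [h] with θ hθ hmem
      rw [Set.uIoc_of_le Real.pi_pos.le] at hmem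
      have hlt : -1 < Real.cos θ := by
        rw [← Real.cos_pi]
        exact Real.cos_lt_cos_of_nonneg_of_le_pi hmem.1.le le_rfl (lt_of_le_of_ne hmem.2 hθ)
      have : 1 + 2 * 1 * Real.cos θ + 1 ^ 2 ≠ 0 := by linarith
      rw [div_eq_div_iff this two_ne_zero]
      linear_combination 2 * Real.sin_sq_add_cos_sq θ
    rw [this]
    simp

/-- Replacing `q` by `q⁻¹` multiplies the denominator by `q⁻²`. -/
theorem integral_sin_sq_div_of_one_le {q : ℝ} (h1 : 1 ≤ q) :
    ∫ θ in (0 : ℝ)..Real.pi, Real.sin θ ^ 2 / (1 + 2 * q * Real.cos θ + q ^ 2) =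
      Real.pi / 2 / q ^ 2 := by
  have hq : 0 < q := by linarith
  rw [← integral_sin_sq_div (inv_pos.2 hq) (inv_le_one_of_one_le₀ h1), ← intervalIntegral.integral_div]
  congr 1
  ext θ
  rw [div_div]
  congr 1
  field_simp
  ring

/-- The parametrization of the support of the Marchenko–Pastur law by an angle. -/
noncomputable def mpParam (α θ : ℝ) : ℝ := 1 + 2 * √α * Real.cos θ + √α ^ 2

/-- The density of the angle. -/
noncomputable def mpWeight (α θ : ℝ) : ℝ :=
  2 * α / Real.pi * (Real.sin θ ^ 2 / (1 + 2 * √α * Real.cos θ + √α ^ 2))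

theorem measurable_mpParam (α : ℝ) : Measurable (mpParam α) := by unfold mpParam; fun_prop

theorem measurable_mpWeight (α : ℝ) : Measurable (mpWeight α) := by unfold mpWeight; fun_prop

theorem mpWeight_nonneg {α : ℝ} (hα : 0 < α) (θ : ℝ) : 0 ≤ mpWeight α θ :=
  mul_nonneg (by positivity) (sin_sq_div_quadratic_mem _ θ).1

theorem mpParam_nonneg (α θ : ℝ) : 0 ≤ mpParam α θ :=
  (sq_nonneg _).trans (sin_sq_le_quadratic _ θ)

theorem mpParam_le (α θ : ℝ) : mpParam α θ ≤ (1 + √α) ^ 2 := by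
  unfold mpParam
  nlinarith [Real.cos_le_one θ, Real.sqrt_nonneg α]

theorem integrable_mpWeight (α : ℝ) : IntegrableOn (mpWeight α) (Set.Icc 0 Real.pi) :=
  (integrable_sin_sq_div _).const_mul _

theorem mpParam_image {α : ℝ} (hα : 0 < α) :
    mpParam α '' Set.Icc 0 Real.pi = Set.Icc ((1 - √α) ^ 2) ((1 + √α) ^ 2) := by
  have hs := Real.sqrt_pos.2 hα
  have : mpParam α = (fun y => 2 * √α * y + (1 + √α ^ 2)) ∘ Real.cos := by
    ext θ; simp [mpParam]; ring
  rw [this, Set.image_comp, Real.bijOn_cos.image_eq, Set.image_affine_Icc' (by positivity)]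
  congr 1 <;> ring

/-- Change of variables `x = 1 + 2√α cos θ + α`: the square root in the density and the absolute
derivative are both `2√α sin θ`. -/
theorem marchenkoPastur_eq_map {α : ℝ} (hα : 0 < α) :
    marchenkoPastur α = Measure.map (mpParam α) ((volume.restrict (Set.Icc 0 Real.pi)).withDensity
      fun θ => ENNReal.ofReal (mpWeight α θ)) +
      if α < 1 then ENNReal.ofReal (1 - α) • Measure.dirac 0 else 0 := by
  rw [marchenkoPastur]
  congr 1
  have hs := Real.sqrt_pos.2 hα
  ext A hA
  rw [Measure.map_apply (measurable_mpParam α) hA,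
    withDensity_apply _ (measurable_mpParam α hA), withDensity_apply _ hA,
    ← lintegral_indicator hA, ← lintegral_indicator (measurable_mpParam α hA), ← mpParam_image hα]
  have hd : ∀ θ ∈ Set.Icc 0 Real.pi,
      HasDerivWithinAt (mpParam α) (-(2 * √α * Real.sin θ)) (Set.Icc 0 Real.pi) θ := fun θ _ => by
    have := (((Real.hasDerivAt_cos θ).const_mul (2 * √α)).const_add 1).add_const (√α ^ 2)
    exact (this.congr_deriv (by ring)).hasDerivWithinAt
  have hinj : Set.InjOn (mpParam α) (Set.Icc 0 Real.pi) := by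
    intro x hx y hy hxy
    refine Real.injOn_cos hx hy ?_
    simp only [mpParam] at hxy
    have : 2 * √α * (Real.cos x - Real.cos y) = 0 := by linarith
    rcases mul_eq_zero.1 this with h | h
    · linarith
    · linarith
  rw [lintegral_image_eq_lintegral_abs_deriv_mul measurableSet_Icc hd hinj]
  refine setLIntegral_congr_fun measurableSet_Icc fun θ hθ => ?_
  by_cases hmem : mpParam α θ ∈ A
  · rw [Set.indicator_of_mem hmem, Set.indicator_of_mem (by exact hmem),
      ← ENNReal.ofReal_mul (abs_nonneg _)]
    congr 1
    have hsin : 0 ≤ Real.sin θ := Real.sin_nonneg_of_mem_Icc hθ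
    have e : ((1 + √α) ^ 2 - mpParam α θ) * (mpParam α θ - (1 - √α) ^ 2) =
        (2 * √α * Real.sin θ) ^ 2 := by
      unfold mpParam
      linear_combination (4 * √α ^ 2) * (-Real.sin_sq_add_cos_sq θ)
    rw [e, Real.sqrt_sq (by positivity), abs_neg, abs_of_nonneg (by positivity)]
    have h2 : √α ^ 2 = α := Real.sq_sqrt hα.le
    unfold mpWeight mpParam
    rw [← mul_div_assoc, div_mul_div_comm]
    have : 2 * √α * Real.sin θ * (2 * √α * Real.sin θ) = 2 * (2 * α * Real.sin θ ^ 2) := by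
      rw [← h2, Real.sqrt_sq hs.le]; ring
    rw [this, mul_assoc 2 Real.pi, mul_div_mul_left _ _ (two_ne_zero' ℝ)]
  · rw [Set.indicator_of_notMem hmem, Set.indicator_of_notMem (by exact hmem), mul_zero]

/-- This is the mass of the absolutely continuous part; the atom at `0` supplies the missing `1 - α`
when `α < 1`. -/
theorem sqrt_quadratic_integral {α : ℝ} (hα : 0 < α) :
    ∫ θ in Set.Icc 0 Real.pi, mpWeight α θ = min α 1 := by
  rw [integral_Icc_eq_integral_Ioc, ← intervalIntegral.integral_of_le Real.pi_pos.le]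
  unfold mpWeight
  rw [intervalIntegral.integral_const_mul]
  have hs := Real.sqrt_pos.2 hα
  have hpi := Real.pi_ne_zero
  rcases le_total α 1 with h | h
  · rw [integral_sin_sq_div hs (Real.sqrt_le_one.2 h), min_eq_left h]
    field_simp
  · rw [integral_sin_sq_div_of_one_le (Real.one_le_sqrt.2 h), min_eq_right h, Real.sq_sqrt hα.le]
    field_simp

theorem isProbabilityMeasure_marchenkoPastur {α : ℝ} (hα : 0 < α) :
    IsProbabilityMeasure (marchenkoPastur α) := by
  constructor
  rw [marchenkoPastur_eq_map hα, Measure.add_apply,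
    Measure.map_apply (measurable_mpParam α) MeasurableSet.univ, Set.preimage_univ,
    withDensity_apply _ MeasurableSet.univ, Measure.restrict_univ,
    ← ofReal_integral_eq_lintegral_ofReal (integrable_mpWeight α)
      (Eventually.of_forall (mpWeight_nonneg hα)), sqrt_quadratic_integral hα]
  split_ifs with h
  · rw [min_eq_left h.le]
    simp only [Measure.smul_apply, smul_eq_mul, measure_univ, mul_one]
    rw [← ENNReal.ofReal_add hα.le (by linarith)]
    simp
  · rw [min_eq_right (by linarith)]
    simp

theorem ae_mem_marchenkoPastur {α : ℝ} (hα : 0 < α) :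
    ∀ᵐ x ∂(marchenkoPastur α), x ∈ Set.Icc 0 ((1 + √α) ^ 2) := by
  rw [marchenkoPastur_eq_map hα, ae_add_measure_iff]
  constructor
  · refine (ae_map_iff (p := fun x => x ∈ Set.Icc 0 ((1 + √α) ^ 2))
      (measurable_mpParam α).aemeasurable measurableSet_Icc).2 ?_
    exact Eventually.of_forall fun θ => ⟨mpParam_nonneg α θ, mpParam_le α θ⟩
  · split_ifs
    · refine Measure.ae_smul_measure ?_ _
      exact (ae_dirac_iff (p := fun x => x ∈ Set.Icc 0 ((1 + √α) ^ 2)) measurableSet_Icc).2 ⟨le_rfl, sq_nonneg _⟩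
    · simp

theorem integrable_marchenkoPastur {α : ℝ} (hα : 0 < α) {f : ℝ → ℝ} (hf : Measurable f) {C : ℝ}
    (hC : ∀ x ∈ Set.Icc 0 ((1 + √α) ^ 2), |f x| ≤ C) : Integrable f (marchenkoPastur α) := by
  have := isProbabilityMeasure_marchenkoPastur hα
  refine Integrable.of_bound hf.aestronglyMeasurable C ?_
  filter_upwards [ae_mem_marchenkoPastur hα] with x hx using hC x hx

theorem integral_marchenkoPastur {α : ℝ} (hα : 0 < α) {f : ℝ → ℝ} (hf : Measurable f) {C : ℝ}
    (hC : ∀ x ∈ Set.Icc 0 ((1 + √α) ^ 2), |f x| ≤ C) :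
    ∫ x, f x ∂(marchenkoPastur α) =
      (∫ θ in Set.Icc 0 Real.pi, mpWeight α θ * f (mpParam α θ)) + (1 - min α 1) * f 0 := by
  have hi := integrable_marchenkoPastur hα hf hC
  rw [marchenkoPastur_eq_map hα] at hi ⊢
  rw [integrable_add_measure] at hi
  rw [integral_add_measure hi.1 hi.2, integral_map (measurable_mpParam α).aemeasurable
    hf.aestronglyMeasurable, integral_withDensity_eq_integral_toReal_smul
      (measurable_mpWeight α).ennreal_ofReal (by simp)]
  congr 1
  · simp [ENNReal.toReal_ofReal (mpWeight_nonneg hα _)]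
  · split_ifs with h
    · rw [integral_smul_measure, integral_dirac, ENNReal.toReal_ofReal (by linarith),
        min_eq_left h.le, smul_eq_mul]
    · rw [min_eq_right (by linarith)]; simp

/-- The quadratic equation of the Stieltjes transform of the Marchenko–Pastur law. -/
theorem stieltjes_marchenkoPastur {α t : ℝ} (hα : 0 < α) (ht : 0 < t) :
    0 < (∫ x, 1 / (x + t) ∂(marchenkoPastur α)) ∧
      t * (∫ x, 1 / (x + t) ∂(marchenkoPastur α)) ^ 2 +
        (t + α - 1) * (∫ x, 1 / (x + t) ∂(marchenkoPastur α)) = 1 := by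
  have hs := Real.sqrt_pos.2 hα
  have hsq : √α ^ 2 = α := Real.sq_sqrt hα.le
  have hdisc : 0 ≤ (1 + α + t) ^ 2 - 4 * α := by nlinarith [sq_nonneg (1 - α)]
  -- The larger root of `λ² - (1 + α + t) λ + α`. It factors `x + t` as `λ (1 + 2q cos θ + q²)` with
  -- `q = √α / λ`, and `λ ≥ √α` gives `q ≤ 1`, so the trigonometric integral above applies again.
  obtain ⟨lam, hl, hlq⟩ : ∃ lam : ℝ, √α ≤ lam ∧ lam ^ 2 + α = (1 + α + t) * lam := by
    refine ⟨((1 + α + t) + √((1 + α + t) ^ 2 - 4 * α)) / 2, ?_, ?_⟩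
    · nlinarith [Real.sqrt_nonneg ((1 + α + t) ^ 2 - 4 * α), sq_nonneg (1 - √α)]
    · have := Real.sq_sqrt hdisc
      nlinarith
  have hl0 : 0 < lam := hs.trans_le hl
  have hlα : α ≤ lam ^ 2 := by rw [← hsq]; gcongr
  have hl1 : 1 < lam := by
    by_contra h
    have h1 : lam ≤ 1 := not_lt.1 h
    have h2 : α ≤ lam := by nlinarith
    nlinarith [mul_nonneg (sub_nonneg.2 h1) (sub_nonneg.2 h2), mul_pos hl0 ht]
  have hval : ∫ x, 1 / (x + t) ∂(marchenkoPastur α) = (1 - α / lam) / t := by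
    rw [integral_marchenkoPastur (C := 1 / t) hα (by fun_prop) (fun x hx => by
      rw [abs_of_nonneg (by have := hx.1; positivity)]
      exact one_div_le_one_div_of_le ht (by linarith [hx.1]))]
    -- Partial fractions: `1 / (x (x + t)) = (1 / t) (1 / x - 1 / (x + t))`. Where `x = 0`, the sine
    -- vanishes as well and both sides are `0`.
    have h1 : ∀ θ, mpWeight α θ * (1 / (mpParam α θ + t)) = (1 / t) * (mpWeight α θ -
        2 * α / Real.pi / lam *
          (Real.sin θ ^ 2 / (1 + 2 * (√α / lam) * Real.cos θ + (√α / lam) ^ 2))) := by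
      intro θ
      have e : lam * (1 + 2 * (√α / lam) * Real.cos θ + (√α / lam) ^ 2) = mpParam α θ + t := by
        unfold mpParam
        field_simp
        rw [hsq]
        linear_combination hlq
      have hp := mpParam_nonneg α θ
      have e' : 2 * α / Real.pi / lam *
          (Real.sin θ ^ 2 / (1 + 2 * (√α / lam) * Real.cos θ + (√α / lam) ^ 2)) =
          2 * α / Real.pi * Real.sin θ ^ 2 / (mpParam α θ + t) := by
        rw [← e, div_mul_div_comm]
      rw [e']
      have hw : mpWeight α θ = 2 * α / Real.pi * Real.sin θ ^ 2 / mpParam α θ := by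
        exact (mul_div_assoc _ _ _).symm
      rw [hw]
      rcases hp.eq_or_lt with h0 | h0
      · have hsin : Real.sin θ ^ 2 = 0 :=
          le_antisymm ((sin_sq_le_quadratic (√α) θ).trans h0.ge) (sq_nonneg _)
        simp [hsin]
      · field_simp
        ring
    simp_rw [h1]
    rw [integral_const_mul, integral_sub (integrable_mpWeight α)
      ((integrable_sin_sq_div _).const_mul _), sqrt_quadratic_integral hα, integral_const_mul]
    rw [integral_Icc_eq_integral_Ioc, ← intervalIntegral.integral_of_le Real.pi_pos.le,
      integral_sin_sq_div (div_pos hs hl0) ((div_le_one hl0).2 hl)]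
    have := Real.pi_pos
    field_simp
    ring
  have hval2 : (1 - α / lam) / t = 1 / (lam - 1) := by
    have : lam - 1 ≠ 0 := by linarith
    field_simp
    linear_combination hlq
  rw [hval, hval2]
  have : 0 < lam - 1 := by linarith
  refine ⟨by positivity, ?_⟩
  field_simp
  linear_combination -hlq

/-! ### Moments -/

/-- Identity theorem for power series. Vanishing on the negative side suffices, and only that side
is available: the Stieltjes transform is used at `t = -1/u > 0`. -/
theorem eq_zero_of_hasSum_pow_eq_zero {c : ℕ → ℝ} {δ : ℝ} (hδ : 0 < δ)
    (h : ∀ u ∈ Set.Ioo (-δ) 0, HasSum (fun k => c k * u ^ k) 0) (k : ℕ) : c k = 0 := by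
  set p := FormalMultilinearSeries.ofScalars ℝ c with hp
  have hrad : 0 < p.radius := by
    have ht := (h (-(δ / 2)) ⟨by linarith, by linarith⟩).summable.tendsto_atTop_zero.norm
    have : ((δ / 2).toNNReal : ℝ≥0∞) ≤ p.radius := by
      apply p.le_radius_of_tendsto (l := 0)
      convert ht using 2 with n
      · rw [hp, FormalMultilinearSeries.ofScalars_norm, norm_mul, norm_pow, norm_neg,
          Real.coe_toNNReal _ (by positivity), Real.norm_of_nonneg (by positivity : 0 ≤ δ / 2)]
      · simp
    refine lt_of_lt_of_le ?_ this
    simpa using hδ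
  have hs := p.hasFPowerSeriesOnBall hrad
  have hsum : ∀ u ∈ Set.Ioo (-δ) 0, p.sum u = 0 := by
    intro u hu
    have : p.sum u = ∑' n, c n • u ^ n := FormalMultilinearSeries.ofScalars_sum_eq c u
    rw [this]
    exact (h u hu).tsum_eq
  have hfreq : ∃ᶠ z in 𝓝[≠] (0 : ℝ), p.sum z = (0 : ℝ → ℝ) z := by
    have hle : 𝓝[<] (0 : ℝ) ≤ 𝓝[≠] 0 := nhdsWithin_mono _ fun x hx => ne_of_lt hx
    refine Frequently.filter_mono ?_ hle
    apply Eventually.frequently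
    filter_upwards [Ioo_mem_nhdsLT (show -δ < 0 by linarith)] with u hu using hsum u hu
  have hev := (AnalyticAt.frequently_eq_iff_eventually_eq hs.analyticAt analyticAt_const).1 hfreq
  have h0 : p = 0 := (hs.hasFPowerSeriesAt.congr hev).eq_zero
  have := FormalMultilinearSeries.coeff_ofScalars (p := c) (n := k)
  rw [← hp, h0] at this
  rw [← this]
  simp [FormalMultilinearSeries.coeff]

theorem integrable_pow_marchenkoPastur {α : ℝ} (hα : 0 < α) (k : ℕ) :
    Integrable (fun x => x ^ k) (marchenkoPastur α) :=
  integrable_marchenkoPastur hα (by fun_prop) (C := ((1 + √α) ^ 2) ^ k) fun x hx => by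
    rw [abs_pow, abs_of_nonneg hx.1]
    exact pow_le_pow_left₀ hx.1 hx.2 k

theorem hasSum_moment_marchenkoPastur {α u : ℝ} (hα : 0 < α) (hu : |u| * (1 + √α) ^ 2 < 1) :
    (Summable fun k => ‖(∫ x, x ^ k ∂(marchenkoPastur α)) * u ^ k‖) ∧
    HasSum (fun k => (∫ x, x ^ k ∂(marchenkoPastur α)) * u ^ k)
      (∫ x, (1 - u * x)⁻¹ ∂(marchenkoPastur α)) := by
  have := isProbabilityMeasure_marchenkoPastur hα
  have hb : ∀ᵐ x ∂(marchenkoPastur α), |u * x| ≤ |u| * (1 + √α) ^ 2 := by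
    filter_upwards [ae_mem_marchenkoPastur hα] with x hx
    rw [abs_mul, abs_of_nonneg hx.1]
    exact mul_le_mul_of_nonneg_left hx.2 (abs_nonneg u)
  have hF : ∀ k : ℕ, Integrable (fun x => x ^ k * u ^ k) (marchenkoPastur α) := fun k =>
    (integrable_pow_marchenkoPastur hα k).mul_const _
  have hbound : ∀ k : ℕ, ∫ x, ‖x ^ k * u ^ k‖ ∂(marchenkoPastur α) ≤
      (|u| * (1 + √α) ^ 2) ^ k := by
    intro k
    calc ∫ x, ‖x ^ k * u ^ k‖ ∂(marchenkoPastur α)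
        ≤ ∫ _, (|u| * (1 + √α) ^ 2) ^ k ∂(marchenkoPastur α) := by
          refine integral_mono_ae (hF k).norm (integrable_const _) ?_
          filter_upwards [hb] with x hx
          rw [← mul_pow, norm_pow, Real.norm_eq_abs, mul_comm x u]
          exact pow_le_pow_left₀ (abs_nonneg _) hx k
      _ = _ := by simp
  have hgeom := summable_geometric_of_lt_one (by positivity) hu
  have hsn := Summable.of_nonneg_of_le
    (fun k => integral_nonneg fun x => norm_nonneg (x ^ k * u ^ k)) hbound hgeom
  constructor
  · refine Summable.of_nonneg_of_le (fun k => norm_nonneg _) (fun k => ?_) hsn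
    rw [← integral_mul_const]
    exact norm_integral_le_integral_norm _
  · have h := hasSum_integral_of_summable_integral_norm hF hsn
    have e : ∫ x, ∑' k, x ^ k * u ^ k ∂(marchenkoPastur α) =
        ∫ x, (1 - u * x)⁻¹ ∂(marchenkoPastur α) := by
      apply integral_congr_ae
      filter_upwards [hb] with x hx
      rw [← tsum_geometric_of_abs_lt_one (hx.trans_lt hu)]
      simp_rw [mul_pow, mul_comm]
    rw [e] at h
    simpa only [integral_mul_const] using h

/-- The quadratic recursion of the moments of the Marchenko–Pastur law. -/
theorem moment_marchenkoPastur_rec {α : ℝ} (hα : 0 < α) (k : ℕ) :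
    ∫ x, x ^ (k + 1) ∂(marchenkoPastur α) =
      (∑ p ∈ Finset.HasAntidiagonal.antidiagonal k,
        (∫ x, x ^ p.1 ∂(marchenkoPastur α)) * ∫ x, x ^ p.2 ∂(marchenkoPastur α)) +
        (α - 1) * ∫ x, x ^ k ∂(marchenkoPastur α) := by
  have := isProbabilityMeasure_marchenkoPastur hα
  set m : ℕ → ℝ := fun k => ∫ x, x ^ k ∂(marchenkoPastur α) with hm
  have hb : 0 < (1 + √α) ^ 2 := by positivity
  have key := eq_zero_of_hasSum_pow_eq_zero (c := fun k => m (k + 1) -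
    ((∑ p ∈ Finset.HasAntidiagonal.antidiagonal k, m p.1 * m p.2) + (α - 1) * m k))
    (inv_pos.2 hb) (fun u hu => ?_) k
  · linarith
  · have hu0 : u < 0 := hu.2
    have hune : u ≠ 0 := hu0.ne
    have hulb : |u| * (1 + √α) ^ 2 < 1 := by
      rw [abs_of_neg hu0, ← lt_div_iff₀ hb, one_div]
      linarith [hu.1]
    obtain ⟨hsn, hs⟩ := hasSum_moment_marchenkoPastur hα hulb
    -- With `t = -1/u`, the transform is `-u` times the moment generating function `S`, and its
    -- quadratic equation becomes `(S - 1) / u = S² + (α - 1) S`. The coefficients of this identity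
    -- are the recursion.
    obtain ⟨-, hst⟩ := stieltjes_marchenkoPastur hα (t := -u⁻¹) (by simpa using hu0)
    have hS : ∫ x, (1 - u * x)⁻¹ ∂(marchenkoPastur α) =
        -u⁻¹ * ∫ x, 1 / (x + -u⁻¹) ∂(marchenkoPastur α) := by
      rw [← integral_const_mul]
      congr 1
      ext x
      have e : x + -u⁻¹ = -u⁻¹ * (1 - u * x) := by field_simp; ring
      rw [e, one_div, mul_inv, ← mul_assoc, mul_inv_cancel₀ (by simpa using hune), one_mul]
    set s := ∫ x, 1 / (x + -u⁻¹) ∂(marchenkoPastur α)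
    set S := ∫ x, (1 - u * x)⁻¹ ∂(marchenkoPastur α)
    have hS' : s = -u * S := by rw [hS]; field_simp
    have h2 : HasSum (fun k => ∑ p ∈ Finset.HasAntidiagonal.antidiagonal k,
        (m p.1 * u ^ p.1) * (m p.2 * u ^ p.2)) (S * S) := by
      have hsum := (summable_norm_sum_mul_antidiagonal_of_summable_norm hsn hsn).of_norm.hasSum
      rw [← tsum_mul_tsum_eq_tsum_sum_antidiagonal_of_summable_norm hsn hsn, hs.tsum_eq] at hsum
      exact hsum
    have h1 : HasSum (fun k => m (k + 1) * u ^ (k + 1)) (S - 1) := by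
      have := (hasSum_nat_add_iff' 1).2 hs
      simpa using this
    have h3 := (h1.mul_left u⁻¹).sub (h2.add (hs.mul_left (α - 1)))
    have hz : u⁻¹ * (S - 1) - (S * S + (α - 1) * S) = 0 := by
      rw [hS'] at hst
      field_simp
      field_simp at hst
      linear_combination hst
    rw [hz] at h3
    have hfun : (fun k => (m (k + 1) - ((∑ p ∈ Finset.HasAntidiagonal.antidiagonal k,
        m p.1 * m p.2) + (α - 1) * m k)) * u ^ k) = fun k => u⁻¹ * (m (k + 1) * u ^ (k + 1)) -
        (∑ p ∈ Finset.HasAntidiagonal.antidiagonal k, m p.1 * u ^ p.1 * (m p.2 * u ^ p.2) +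
          (α - 1) * (m k * u ^ k)) := by
      funext k
      have : ∑ p ∈ Finset.HasAntidiagonal.antidiagonal k, m p.1 * u ^ p.1 * (m p.2 * u ^ p.2) =
          (∑ p ∈ Finset.HasAntidiagonal.antidiagonal k, m p.1 * m p.2) * u ^ k := by
        rw [Finset.sum_mul]
        refine Finset.sum_congr rfl fun p hp => ?_
        rw [← Finset.HasAntidiagonal.mem_antidiagonal.1 hp, pow_add]
        ring
      rw [this]
      field_simp
      ring
    rw [hfun]
    exact h3

theorem moment_marchenkoPastur {α : ℝ} (hα : 0 < α) (k : ℕ) :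
    ∫ x, x ^ k ∂(marchenkoPastur α) = parityPoly α true k := by
  have := isProbabilityMeasure_marchenkoPastur hα
  induction k using Nat.strong_induction_on with
  | _ k ih =>
  cases k with
  | zero => simp [parityPoly_zero]
  | succ k =>
    rw [moment_marchenkoPastur_rec hα, parityPoly_true_rec, ih k (by omega)]
    congr 1
    refine Finset.sum_congr rfl fun p hp => ?_
    have := Finset.HasAntidiagonal.mem_antidiagonal.1 hp
    rw [ih p.1 (by omega), ih p.2 (by omega)]

/-- A probability law with the moments of a compactly supported law is that law. -/
theorem eq_of_forall_moment_eq {μ ν : Measure ℝ} [IsProbabilityMeasure μ] [IsProbabilityMeasure ν]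
    {b : ℝ} (hν : ∀ᵐ x ∂ν, |x| ≤ b) (hi : ∀ k : ℕ, Integrable (fun x => x ^ k) μ)
    (hm : ∀ k : ℕ, ∫ x, x ^ k ∂μ = ∫ x, x ^ k ∂ν) : μ = ν := by
  have hb : 0 ≤ b := by
    obtain ⟨x, hx⟩ := hν.exists
    exact (abs_nonneg x).trans hx
  have hiν : ∀ {f : ℝ → ℝ}, Continuous f → Integrable f ν := by
    intro f hf
    obtain ⟨C, hC⟩ := isCompact_Icc.exists_bound_of_continuousOn (s := Set.Icc (-b) b) hf.continuousOn
    refine Integrable.of_bound hf.measurable.aestronglyMeasurable C ?_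
    filter_upwards [hν] with x hx using hC x (abs_le.1 hx)
  have hμ : ∀ᵐ x ∂μ, |x| ≤ b := by
    -- Markov's inequality for `x ^ (2k)` bounds the mass of `|x| ≥ R` by `(b / R) ^ (2k)`, which
    -- tends to `0` as `k` grows. So `μ` lives on `[-b, b]` too, and polynomial approximation there
    -- finishes the proof.
    have h1 : ∀ R : ℝ, b < R → μ {x | R ≤ |x|} = 0 := by
      intro R hR
      have hR0 : 0 < R := hb.trans_lt hR
      have hle : ∀ k : ℕ, μ.real {x | R ≤ |x|} ≤ ((b / R) ^ 2) ^ k := by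
        intro k
        have hmk := mul_meas_ge_le_integral_of_nonneg (μ := μ) (f := fun x => x ^ (2 * k))
          (Eventually.of_forall fun x => by
            simp only [Pi.zero_apply]; rw [pow_mul]; positivity) (hi _) (R ^ (2 * k))
        have hsub : μ.real {x | R ≤ |x|} ≤ μ.real {x | R ^ (2 * k) ≤ x ^ (2 * k)} := by
          refine measureReal_mono fun x hx => ?_
          have : R ^ (2 * k) ≤ |x| ^ (2 * k) := pow_le_pow_left₀ hR0.le hx _
          rwa [pow_mul |x|, sq_abs, ← pow_mul] at this
        have hmom : ∫ x, x ^ (2 * k) ∂μ ≤ b ^ (2 * k) := by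
          rw [hm]
          calc ∫ x, x ^ (2 * k) ∂ν ≤ ∫ _, b ^ (2 * k) ∂ν := by
                refine integral_mono_ae (hiν (by fun_prop)) (integrable_const _) ?_
                filter_upwards [hν] with x hx
                have : |x| ^ (2 * k) ≤ b ^ (2 * k) := pow_le_pow_left₀ (abs_nonneg _) hx _
                rwa [pow_mul |x|, sq_abs, ← pow_mul] at this
            _ = _ := by simp
        rw [← pow_mul, div_pow, le_div_iff₀ (by positivity), mul_comm]
        exact ((mul_le_mul_of_nonneg_left hsub (by positivity)).trans hmk).trans hmom
      have hlim := tendsto_pow_atTop_nhds_zero_of_lt_one (r := (b / R) ^ 2) (by positivity) (by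
        have h1 : b / R < 1 := (div_lt_one hR0).2 hR
        have h0 : 0 ≤ b / R := by positivity
        nlinarith)
      have := ge_of_tendsto' hlim hle
      exact (measureReal_eq_zero_iff).1 (le_antisymm this measureReal_nonneg)
    have h2 : ∀ n : ℕ, ∀ᵐ x ∂μ, |x| < b + 1 / ((n : ℝ) + 1) := fun n => by
      rw [ae_iff]
      simpa using h1 (b + 1 / ((n : ℝ) + 1)) (by linarith [Nat.one_div_pos_of_nat (α := ℝ) (n := n)])
    filter_upwards [ae_all_iff.2 h2] with x hx
    refine ge_of_tendsto' (x := atTop) (f := fun n : ℕ => b + 1 / ((n : ℝ) + 1)) ?_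
      fun n => (hx n).le
    simpa using tendsto_one_div_add_atTop_nhds_zero_nat.const_add b
  have hpoly : ∀ p : Polynomial ℝ, Integrable (fun x => p.eval x) μ ∧
      ∫ x, p.eval x ∂μ = ∫ x, p.eval x ∂ν := by
    intro p
    simp only [Polynomial.eval_eq_sum_range]
    constructor
    · exact integrable_finsetSum _ fun k _ => (hi k).const_mul _
    · rw [integral_finsetSum _ fun k _ => (hi k).const_mul _,
        integral_finsetSum _ fun k _ => hiν (by fun_prop)]
      simp [integral_const_mul, hm]
  refine ext_of_forall_integral_eq_of_IsFiniteMeasure fun f => ?_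
  refine eq_of_forall_dist_le fun ε hε => ?_
  obtain ⟨p, hp⟩ := exists_polynomial_near_of_continuousOn (-b) b f f.continuous.continuousOn
    (ε / 2) (by positivity)
  have hest : ∀ (P : Measure ℝ) [IsProbabilityMeasure P], (∀ᵐ x ∂P, |x| ≤ b) →
      Integrable (fun x => p.eval x) P → |∫ x, p.eval x ∂P - ∫ x, f x ∂P| ≤ ε / 2 := by
    intro P _ hP hpi
    rw [← integral_sub hpi (f.integrable P), ← Real.norm_eq_abs]
    refine (norm_integral_le_of_norm_le_const (C := ε / 2) ?_).trans (by simp)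
    filter_upwards [hP] with x hx using (hp x (abs_le.1 hx)).le
  have e1 := hest μ hμ (hpoly p).1
  have e2 := hest ν hν (hiν p.continuous)
  rw [(hpoly p).2] at e1
  rw [Real.dist_eq]
  rw [abs_le] at *
  constructor <;> linarith

/-! ### Resolvents of Gram matrices -/

section Resolvent

variable {n m : ℕ}

/-- The matrix `c X Xᵀ + t`. -/
def shiftedGram (c t : ℝ) (X : Matrix (Fin n) (Fin m) ℝ) : Matrix (Fin n) (Fin n) ℝ :=
  c • (X * Xᵀ) + t • 1

/-- The matrix `(c X Xᵀ + t)⁻¹`. -/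
noncomputable def gramResolvent (c t : ℝ) (X : Matrix (Fin n) (Fin m) ℝ) :
    Matrix (Fin n) (Fin n) ℝ := (shiftedGram c t X)⁻¹

theorem shiftedGram_posDef {c t : ℝ} (hc : 0 ≤ c) (ht : 0 < t) (X : Matrix (Fin n) (Fin m) ℝ) :
    (shiftedGram c t X).PosDef := by
  have h1 : (c • (X * Xᵀ)).PosSemidef := by
    have := Matrix.posSemidef_self_mul_conjTranspose X
    rw [Matrix.conjTranspose_eq_transpose_of_trivial] at this
    exact this.smul hc
  exact Matrix.PosDef.posSemidef_add h1 (Matrix.PosDef.one.smul ht)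

theorem shiftedGram_transpose (c t : ℝ) (X : Matrix (Fin n) (Fin m) ℝ) :
    (shiftedGram c t X)ᵀ = shiftedGram c t X := by
  simp [shiftedGram, Matrix.transpose_mul]

theorem gramResolvent_transpose (c t : ℝ) (X : Matrix (Fin n) (Fin m) ℝ) :
    (gramResolvent c t X)ᵀ = gramResolvent c t X := by
  rw [gramResolvent, Matrix.transpose_nonsing_inv, shiftedGram_transpose]

theorem gramResolvent_symm (c t : ℝ) (X : Matrix (Fin n) (Fin m) ℝ) (a b : Fin n) :
    gramResolvent c t X a b = gramResolvent c t X b a := by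
  conv_lhs => rw [← gramResolvent_transpose]
  rfl

theorem shiftedGram_mul_gramResolvent {c t : ℝ} (hc : 0 ≤ c) (ht : 0 < t)
    (X : Matrix (Fin n) (Fin m) ℝ) : shiftedGram c t X * gramResolvent c t X = 1 :=
  Matrix.mul_nonsing_inv _ (Matrix.isUnit_iff_isUnit_det _ |>.1 (shiftedGram_posDef hc ht X).isUnit)

theorem gramResolvent_mul_shiftedGram {c t : ℝ} (hc : 0 ≤ c) (ht : 0 < t)
    (X : Matrix (Fin n) (Fin m) ℝ) : gramResolvent c t X * shiftedGram c t X = 1 :=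
  Matrix.nonsing_inv_mul _ (Matrix.isUnit_iff_isUnit_det _ |>.1 (shiftedGram_posDef hc ht X).isUnit)

theorem mul_dotProduct_le_shiftedGram {c : ℝ} (hc : 0 ≤ c) (t : ℝ)
    (X : Matrix (Fin n) (Fin m) ℝ) (y : Fin n → ℝ) :
    t * (y ⬝ᵥ y) ≤ y ⬝ᵥ (shiftedGram c t X *ᵥ y) := by
  have h : y ⬝ᵥ (shiftedGram c t X *ᵥ y) = c * ((Xᵀ *ᵥ y) ⬝ᵥ (Xᵀ *ᵥ y)) + t * (y ⬝ᵥ y) := by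
    rw [shiftedGram, Matrix.add_mulVec, Matrix.smul_mulVec, Matrix.smul_mulVec, Matrix.one_mulVec,
      dotProduct_add, dotProduct_smul, dotProduct_smul, ← Matrix.mulVec_mulVec,
      Matrix.dotProduct_mulVec y X, ← Matrix.mulVec_transpose, smul_eq_mul, smul_eq_mul]
  rw [h]
  have : 0 ≤ (Xᵀ *ᵥ y) ⬝ᵥ (Xᵀ *ᵥ y) := Finset.sum_nonneg fun i _ => mul_self_nonneg _
  nlinarith [mul_nonneg hc this]

/-- The inequality `A ≥ t` for the shifted Gram matrix, tested on the vector `R x`. -/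
theorem mul_dotProduct_gramResolvent_le {c t : ℝ} (hc : 0 ≤ c) (ht : 0 < t)
    (X : Matrix (Fin n) (Fin m) ℝ) (x : Fin n → ℝ) :
    t * ((gramResolvent c t X *ᵥ x) ⬝ᵥ (gramResolvent c t X *ᵥ x)) ≤
      x ⬝ᵥ (gramResolvent c t X *ᵥ x) := by
  have h := mul_dotProduct_le_shiftedGram hc t X (gramResolvent c t X *ᵥ x)
  rw [Matrix.mulVec_mulVec, shiftedGram_mul_gramResolvent hc ht, Matrix.one_mulVec,
    dotProduct_comm _ x] at h
  exact h

theorem dotProduct_gramResolvent_nonneg {c t : ℝ} (hc : 0 ≤ c) (ht : 0 < t)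
    (X : Matrix (Fin n) (Fin m) ℝ) (x : Fin n → ℝ) :
    0 ≤ x ⬝ᵥ (gramResolvent c t X *ᵥ x) := by
  refine le_trans ?_ (mul_dotProduct_gramResolvent_le hc ht X x)
  exact mul_nonneg ht.le (Finset.sum_nonneg fun i _ => mul_self_nonneg _)

/-- With `S` the sum of squares of row `a`, the previous bound on the basis vector gives `t S ≤ R a
a`, while `(R a a)² ≤ S`; hence `(t S)² ≤ S`. -/
theorem sum_sq_gramResolvent_le {c t : ℝ} (hc : 0 ≤ c) (ht : 0 < t)
    (X : Matrix (Fin n) (Fin m) ℝ) (a : Fin n) :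
    ∑ b, gramResolvent c t X a b ^ 2 ≤ 1 / t ^ 2 := by
  have h := mul_dotProduct_gramResolvent_le hc ht X (Pi.single a 1)
  rw [single_one_dotProduct, Matrix.mulVec_single_one] at h
  have e : (gramResolvent c t X).col a ⬝ᵥ (gramResolvent c t X).col a =
      ∑ b, gramResolvent c t X a b ^ 2 := by
    refine Finset.sum_congr rfl fun b _ => ?_
    rw [Matrix.col_apply, gramResolvent_symm, sq]
  rw [e, Matrix.col_apply] at h
  set S := ∑ b, gramResolvent c t X a b ^ 2
  have h1 : gramResolvent c t X a a ^ 2 ≤ S :=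
    Finset.single_le_sum (f := fun b => gramResolvent c t X a b ^ 2) (fun b _ => sq_nonneg _)
      (Finset.mem_univ a)
  have hS : 0 ≤ S := (sq_nonneg _).trans h1
  rw [le_div_iff₀ (by positivity)]
  have h2 : (t * S) ^ 2 ≤ S := (pow_le_pow_left₀ (by positivity) h 2).trans h1
  rcases hS.eq_or_lt with h0 | h0
  · rw [← h0]; simp
  · have : S * (S * t ^ 2) ≤ S * 1 := by linarith [h2, mul_pow t S 2]
    exact le_of_mul_le_mul_left this h0

theorem abs_gramResolvent_le {c t : ℝ} (hc : 0 ≤ c) (ht : 0 < t)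
    (X : Matrix (Fin n) (Fin m) ℝ) (a b : Fin n) : |gramResolvent c t X a b| ≤ 1 / t := by
  have h1 := Finset.single_le_sum (f := fun b => gramResolvent c t X a b ^ 2)
    (fun b _ => sq_nonneg _) (Finset.mem_univ b)
  have h2 := h1.trans (sum_sq_gramResolvent_le hc ht X a)
  rw [← one_div_pow] at h2
  exact abs_le_of_sq_le_sq h2 (by positivity)

theorem shiftedGram_eq_add (c t : ℝ) (X : Matrix (Fin n) (Fin m) ℝ) (j : Fin m) :
    shiftedGram c t X = shiftedGram c t (X.updateCol j 0) +
      c • Matrix.vecMulVec (X.col j) (X.col j) := by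
  ext a b
  simp only [shiftedGram, Matrix.add_apply, Matrix.smul_apply, Matrix.mul_apply,
    Matrix.transpose_apply, Matrix.vecMulVec_apply, Matrix.col_apply, smul_eq_mul]
  have : ∑ i, X a i * X b i = ∑ i, X.updateCol j 0 a i * X.updateCol j 0 b i + X a j * X b j := by
    rw [← Finset.sum_erase_add _ _ (Finset.mem_univ j),
      ← Finset.sum_erase_add _ (fun i => X.updateCol j 0 a i * X.updateCol j 0 b i)
        (Finset.mem_univ j)]
    simp only [Matrix.updateCol_self, Pi.zero_apply, mul_zero, add_zero]
    congr 1
    refine Finset.sum_congr rfl fun i hi => ?_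
    rw [Matrix.updateCol_ne (Finset.ne_of_mem_erase hi),
      Matrix.updateCol_ne (Finset.ne_of_mem_erase hi)]
  rw [this]
  ring

/-- The quadratic form of a column in the resolvent of the Gram matrix without this column. -/
noncomputable def columnForm (c t : ℝ) (X : Matrix (Fin n) (Fin m) ℝ) (j : Fin m) : ℝ :=
  c * (X.col j ⬝ᵥ (gramResolvent c t (X.updateCol j 0) *ᵥ X.col j))

theorem columnForm_nonneg {c t : ℝ} (hc : 0 ≤ c) (ht : 0 < t) (X : Matrix (Fin n) (Fin m) ℝ)
    (j : Fin m) : 0 ≤ columnForm c t X j :=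
  mul_nonneg hc (dotProduct_gramResolvent_nonneg hc ht _ _)

/-- Sherman–Morrison: the full matrix is the reduced one plus `c x xᵀ`, so it maps `R' x` to `(1 +
q) x`, where `R'` is the reduced resolvent and `q` the column form. -/
theorem gramResolvent_updateCol_mulVec {c t : ℝ} (hc : 0 ≤ c) (ht : 0 < t)
    (X : Matrix (Fin n) (Fin m) ℝ) (j : Fin m) :
    gramResolvent c t (X.updateCol j 0) *ᵥ X.col j =
      (1 + columnForm c t X j) • (gramResolvent c t X *ᵥ X.col j) := by
  set x := X.col j with hx
  have h : shiftedGram c t X *ᵥ (gramResolvent c t (X.updateCol j 0) *ᵥ x) =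
      (1 + columnForm c t X j) • x := by
    rw [shiftedGram_eq_add c t X j, Matrix.add_mulVec, Matrix.mulVec_mulVec,
      shiftedGram_mul_gramResolvent hc ht, Matrix.one_mulVec, Matrix.smul_mulVec,
      Matrix.vecMulVec_mulVec, add_smul, one_smul, columnForm, mul_smul, ← hx]
    simp
  have h2 := congrArg (fun y => gramResolvent c t X *ᵥ y) h
  simp only [Matrix.mulVec_mulVec x, Matrix.mulVec_smul] at h2
  rwa [← Matrix.mul_assoc, gramResolvent_mul_shiftedGram hc ht, Matrix.one_mul] at h2

theorem mul_dotProduct_gramResolvent_col {c t : ℝ} (hc : 0 ≤ c) (ht : 0 < t)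
    (X : Matrix (Fin n) (Fin m) ℝ) (j : Fin m) :
    c * (X.col j ⬝ᵥ (gramResolvent c t X *ᵥ X.col j)) =
      columnForm c t X j / (1 + columnForm c t X j) := by
  have hq := columnForm_nonneg hc ht X j
  rw [eq_div_iff (by linarith)]
  conv_rhs => rw [columnForm, gramResolvent_updateCol_mulVec hc ht, dotProduct_smul, smul_eq_mul]
  ring

/-- The trace of `R (c X Xᵀ + t) = 1`, with `tr (R X Xᵀ)` written as a sum over columns. -/
theorem card_sub_mul_trace_gramResolvent {c t : ℝ} (hc : 0 ≤ c) (ht : 0 < t)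
    (X : Matrix (Fin n) (Fin m) ℝ) :
    (n : ℝ) - t * (gramResolvent c t X).trace =
      ∑ j, columnForm c t X j / (1 + columnForm c t X j) := by
  have h := congrArg Matrix.trace (gramResolvent_mul_shiftedGram hc ht X)
  rw [shiftedGram, Matrix.mul_add, Matrix.trace_add, Matrix.mul_smul, Matrix.mul_smul,
    Matrix.mul_one, Matrix.trace_smul, Matrix.trace_smul, Matrix.trace_one, ← Matrix.mul_assoc,
    Matrix.trace_mul_comm, Fintype.card_fin] at h
  have h2 : (Xᵀ * (gramResolvent c t X * X)).trace =
      ∑ j, X.col j ⬝ᵥ (gramResolvent c t X *ᵥ X.col j) := by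
    refine Finset.sum_congr rfl fun j _ => ?_
    rfl
  rw [h2] at h
  simp only [← mul_dotProduct_gramResolvent_col hc ht, ← Finset.mul_sum]
  simp only [smul_eq_mul] at h
  linarith

/-- With `R' x = (1 + q) R x`, the resolvent identity gives `(1 + q) (tr R' - tr R) = c |R' x|²`,
which lies between `0` and `q / t`. -/
theorem trace_gramResolvent_updateCol {c t : ℝ} (hc : 0 ≤ c) (ht : 0 < t)
    (X : Matrix (Fin n) (Fin m) ℝ) (j : Fin m) :
    |(gramResolvent c t (X.updateCol j 0)).trace - (gramResolvent c t X).trace| ≤ 1 / t := by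
  set x := X.col j with hx
  set R := gramResolvent c t X
  set R' := gramResolvent c t (X.updateCol j 0) with hR'
  set q := columnForm c t X j with hqdef
  have hq : 0 ≤ q := columnForm_nonneg hc ht X j
  have h1 : R' - R = c • Matrix.vecMulVec (R' *ᵥ x) (R *ᵥ x) := by
    have e : R' * (shiftedGram c t X) * R - R' * (shiftedGram c t (X.updateCol j 0)) * R =
        R' * (c • Matrix.vecMulVec x x) * R := by
      rw [shiftedGram_eq_add c t X j, ← hx]
      noncomm_ring
    rw [Matrix.mul_assoc, shiftedGram_mul_gramResolvent hc ht, Matrix.mul_one,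
      gramResolvent_mul_shiftedGram hc ht, Matrix.one_mul] at e
    rw [e, Matrix.mul_smul, Matrix.smul_mul, Matrix.mul_vecMulVec, Matrix.vecMulVec_mul,
      ← Matrix.mulVec_transpose, gramResolvent_transpose]
  have h2 : R' *ᵥ x = (1 + q) • (R *ᵥ x) := gramResolvent_updateCol_mulVec hc ht X j
  have h3 : R'.trace - R.trace = c * ((R' *ᵥ x) ⬝ᵥ (R *ᵥ x)) := by
    rw [← Matrix.trace_sub, h1, Matrix.trace_smul, Matrix.trace_vecMulVec, smul_eq_mul]
  have h4 : (1 + q) * (R'.trace - R.trace) = c * ((R' *ᵥ x) ⬝ᵥ (R' *ᵥ x)) := by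
    rw [h3]
    conv_rhs => rw [h2, dotProduct_smul, ← h2, smul_eq_mul]
    ring
  have h5 : t * (c * ((R' *ᵥ x) ⬝ᵥ (R' *ᵥ x))) ≤ q := by
    have := mul_le_mul_of_nonneg_left (mul_dotProduct_gramResolvent_le hc ht
      (X.updateCol j 0) x) hc
    rw [hqdef, columnForm]
    linarith
  have h6 : 0 ≤ c * ((R' *ᵥ x) ⬝ᵥ (R' *ᵥ x)) :=
    mul_nonneg hc (Finset.sum_nonneg fun i _ => mul_self_nonneg _)
  rw [← h4] at h5 h6
  set d := R'.trace - R.trace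
  have hd : 0 ≤ d := by
    by_contra h
    nlinarith
  rw [abs_of_nonneg hd, le_div_iff₀ ht]
  by_contra h
  nlinarith

theorem trace_gramResolvent_nonneg {c t : ℝ} (hc : 0 ≤ c) (ht : 0 < t)
    (X : Matrix (Fin n) (Fin m) ℝ) : 0 ≤ (gramResolvent c t X).trace :=
  Finset.sum_nonneg fun a _ => by
    have := dotProduct_gramResolvent_nonneg hc ht X (Pi.single a 1)
    rwa [single_one_dotProduct, Matrix.mulVec_single_one] at this

theorem wishart_eigenvalues_nonneg {v : ℝ} (hv : 0 < v) (X : Matrix (Fin n) (Fin m) ℝ)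
    (i : Fin n) : 0 ≤ (wishart_isHermitian v X).eigenvalues i := by
  have h1 : (wishart v X).PosSemidef := by
    have := Matrix.posSemidef_self_mul_conjTranspose X
    rw [Matrix.conjTranspose_eq_transpose_of_trivial] at this
    exact this.smul (by positivity)
  exact h1.eigenvalues_nonneg i

theorem trace_gramResolvent_eq {v t : ℝ} (hv : 0 < v) (ht : 0 < t)
    (X : Matrix (Fin n) (Fin m) ℝ) :
    (gramResolvent (1 / ((n : ℝ) * v)) t X).trace =
      ∑ i, 1 / ((wishart_isHermitian v X).eigenvalues i + t) := by
  set hW := wishart_isHermitian v X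
  set U : Matrix (Fin n) (Fin n) ℝ := hW.eigenvectorUnitary.1 with hU
  have hUU : U * star U = 1 := by simp [hU]
  have hUU' : star U * U = 1 := by simp [hU]
  have hsp : wishart v X = U * Matrix.diagonal hW.eigenvalues * star U := by
    have := hW.spectral_theorem
    simpa [Unitary.conjStarAlgAut_apply] using this
  have hA : shiftedGram (1 / ((n : ℝ) * v)) t X =
      U * Matrix.diagonal (fun i => hW.eigenvalues i + t) * star U := by
    have h1 : Matrix.diagonal (fun i => hW.eigenvalues i + t) =
        Matrix.diagonal hW.eigenvalues + t • 1 := by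
      rw [Matrix.smul_one_eq_diagonal, Matrix.diagonal_add]
    rw [h1, Matrix.mul_add, Matrix.add_mul, ← hsp, Matrix.mul_smul, Matrix.smul_mul,
      Matrix.mul_one, hUU]
    rfl
  have hinv : gramResolvent (1 / ((n : ℝ) * v)) t X =
      U * Matrix.diagonal (fun i => 1 / (hW.eigenvalues i + t)) * star U := by
    rw [gramResolvent, hA]
    apply Matrix.inv_eq_right_inv
    have : Matrix.diagonal (fun i => hW.eigenvalues i + t) *
        Matrix.diagonal (fun i => 1 / (hW.eigenvalues i + t)) = 1 := by
      rw [Matrix.diagonal_mul_diagonal, ← Matrix.diagonal_one]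
      congr 1
      ext i
      have := wishart_eigenvalues_nonneg hv X i
      exact mul_one_div_cancel (by positivity)
    calc _ = U * Matrix.diagonal (fun i => hW.eigenvalues i + t) * (star U * U) *
        Matrix.diagonal (fun i => 1 / (hW.eigenvalues i + t)) * star U := by
          simp only [Matrix.mul_assoc]
      _ = 1 := by rw [hUU', Matrix.mul_one, Matrix.mul_assoc U, this, Matrix.mul_one, hUU]
  rw [hinv, Matrix.trace_mul_comm, ← Matrix.mul_assoc, hUU', Matrix.one_mul,
    Matrix.trace_diagonal]

end Resolvent

/-! ### Concentration of quadratic forms -/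

/-- An independent family of centred random variables with variance `v` and fourth moment `κ`. -/
structure IsCentredFamily {Ω ι : Type*} [MeasurableSpace Ω] (x : ι → Ω → ℝ) (v κ : ℝ)
    (μ : Measure Ω) : Prop where
  meas : ∀ a, Measurable (x a)
  indep : iIndepFun x μ
  mean : ∀ a, ∫ ω, x a ω ∂μ = 0
  second : ∀ a, ∫ ω, x a ω ^ 2 ∂μ = v
  integrable_fourth : ∀ a, Integrable (fun ω => x a ω ^ 4) μ
  fourth : ∀ a, ∫ ω, x a ω ^ 4 ∂μ = κ

/-- The centred product of two variables. -/
def centredProd {Ω ι : Type*} [DecidableEq ι] (x : ι → Ω → ℝ) (v : ℝ) (a b : ι) (ω : Ω) : ℝ :=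
  x a ω * x b ω - if a = b then v else 0

theorem centredProd_comm {Ω ι : Type*} [DecidableEq ι] (x : ι → Ω → ℝ) (v : ℝ) (a b : ι) :
    centredProd x v a b = centredProd x v b a := by
  ext ω
  simp only [centredProd, mul_comm, eq_comm]

namespace IsCentredFamily

variable {Ω ι : Type*} [MeasurableSpace Ω] [DecidableEq ι] {x : ι → Ω → ℝ} {v κ : ℝ}
  {μ : Measure Ω}

theorem measurable_centredProd (h : IsCentredFamily x v κ μ) (a b : ι) :
    Measurable (centredProd x v a b) := by
  have := h.meas a
  have := h.meas b
  unfold centredProd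
  fun_prop

/-- A centred variable whose index occurs only once factors out by independence. Three further
arguments suffice, since products of two centred products involve four indices. -/
theorem integral_mul_eq_zero (h : IsCentredFamily x v κ μ) {i j k l : ι} (hj : i ≠ j) (hk : i ≠ k)
    (hl : i ≠ l) {G : ℝ → ℝ → ℝ → ℝ} (hG : Measurable fun p : ℝ × ℝ × ℝ => G p.1 p.2.1 p.2.2) :
    ∫ ω, x i ω * G (x j ω) (x k ω) (x l ω) ∂μ = 0 := by
  have hd : Disjoint ({i} : Finset ι) {j, k, l} := by simp [hj, hk, hl]
  have hind := h.indep.indepFun_finset {i} {j, k, l} hd h.meas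
  have hφ : Measurable fun f : (({i} : Finset ι) → ℝ) => f ⟨i, by simp⟩ := measurable_pi_apply _
  have hψ : Measurable fun f : (({j, k, l} : Finset ι) → ℝ) =>
      G (f ⟨j, by simp⟩) (f ⟨k, by simp⟩) (f ⟨l, by simp⟩) :=
    hG.comp (by fun_prop : Measurable fun f : (({j, k, l} : Finset ι) → ℝ) =>
      ((f ⟨j, by simp⟩, f ⟨k, by simp⟩, f ⟨l, by simp⟩) : ℝ × ℝ × ℝ))
  have h2 : IndepFun (x i) (fun ω => G (x j ω) (x k ω) (x l ω)) μ := hind.comp hφ hψ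
  have hm := h.meas
  rw [h2.integral_fun_mul_eq_mul_integral (h.meas i).aestronglyMeasurable
    (hG.comp (by fun_prop : Measurable fun ω => ((x j ω, x k ω, x l ω) : ℝ × ℝ × ℝ))
      ).aestronglyMeasurable, h.mean, zero_mul]

variable [IsProbabilityMeasure μ]

theorem integrable_second (h : IsCentredFamily x v κ μ) (a : ι) :
    Integrable (fun ω => x a ω ^ 2) μ := by
  refine Integrable.mono' ((integrable_const (1 : ℝ)).add (h.integrable_fourth a))
    ((h.meas a).pow_const 2).aestronglyMeasurable (Eventually.of_forall fun ω => ?_)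
  rw [Real.norm_of_nonneg (sq_nonneg _)]
  simp only [Pi.add_apply]
  nlinarith [sq_nonneg (x a ω ^ 2 - 1), sq_nonneg (x a ω ^ 2)]

theorem integrable_centredProd_sq (h : IsCentredFamily x v κ μ) (a b : ι) :
    Integrable (fun ω => centredProd x v a b ω ^ 2) μ := by
  refine Integrable.mono' (((h.integrable_fourth a).add (h.integrable_fourth b)).add
    (integrable_const (2 * v ^ 2))) ((h.measurable_centredProd a b).pow_const 2).aestronglyMeasurable
    (Eventually.of_forall fun ω => ?_)
  rw [Real.norm_of_nonneg (sq_nonneg _)]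
  simp only [Pi.add_apply, centredProd]
  split_ifs
  · nlinarith [sq_nonneg (x a ω * x b ω + v), sq_nonneg (x a ω ^ 2 - x b ω ^ 2)]
  · nlinarith [sq_nonneg v, sq_nonneg (x a ω ^ 2 - x b ω ^ 2), sq_nonneg (x a ω ^ 2),
      sq_nonneg (x b ω ^ 2)]

theorem integrable_centredProd_mul (h : IsCentredFamily x v κ μ) (a b c d : ι) :
    Integrable (fun ω => centredProd x v a b ω * centredProd x v c d ω) μ := by
  refine Integrable.mono' ((h.integrable_centredProd_sq a b).add (h.integrable_centredProd_sq c d))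
    ((h.measurable_centredProd a b).mul (h.measurable_centredProd c d)).aestronglyMeasurable
    (Eventually.of_forall fun ω => ?_)
  simp only [Pi.add_apply, Real.norm_eq_abs]
  rw [abs_le]
  constructor <;> nlinarith [sq_nonneg (centredProd x v a b ω - centredProd x v c d ω),
    sq_nonneg (centredProd x v a b ω + centredProd x v c d ω), sq_nonneg (centredProd x v a b ω),
    sq_nonneg (centredProd x v c d ω)]

theorem integral_centredProd_mul_of_ne (h : IsCentredFamily x v κ μ) {a b c d : ι} (hab : a ≠ b)
    (h1 : ¬ (c = a ∧ d = b)) (h2 : ¬ (c = b ∧ d = a)) :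
    ∫ ω, centredProd x v a b ω * centredProd x v c d ω ∂μ = 0 := by
  have lone : ∀ a b : ι, a ≠ b → a ≠ c → a ≠ d →
      ∫ ω, centredProd x v a b ω * centredProd x v c d ω ∂μ = 0 := by
    intro a b hab hac had
    rw [← h.integral_mul_eq_zero hab hac had
      (G := fun y z w => y * (z * w - if c = d then v else 0)) (by fun_prop)]
    congr 1
    ext ω
    simp only [centredProd, if_neg hab]
    ring
  by_cases hac : a = c
  · subst hac
    have hbd : b ≠ d := fun h => h1 ⟨rfl, h.symm⟩
    rw [centredProd_comm x v a b]
    exact lone b a hab.symm hab.symm hbd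
  · by_cases had : a = d
    · subst had
      have hbc : b ≠ c := fun h => h2 ⟨h.symm, rfl⟩
      rw [centredProd_comm x v a b]
      exact lone b a hab.symm hbc hab.symm
    · exact lone a b hab hac had

/-- Unless the two unordered pairs agree, either some index occurs only once, or both pairs are
diagonal and distinct, in which case independent centred squares are multiplied. -/
theorem integral_centredProd_mul_eq_zero (h : IsCentredFamily x v κ μ) {a b c d : ι}
    (h1 : ¬ (c = a ∧ d = b)) (h2 : ¬ (c = b ∧ d = a)) :
    ∫ ω, centredProd x v a b ω * centredProd x v c d ω ∂μ = 0 := by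
  by_cases hab : a = b
  · by_cases hcd : c = d
    · subst hab hcd
      have hne : a ≠ c := fun h => h1 ⟨h.symm, h.symm⟩
      have hi := (h.indep.indepFun hne).comp (φ := fun y => y * y - v) (ψ := fun y => y * y - v)
        (by fun_prop) (by fun_prop)
      have hz : ∫ ω, (x a ω * x a ω - v) ∂μ = 0 := by
        have := h.second a
        have hint := h.integrable_second a
        simp only [sq] at this hint
        rw [integral_sub hint (integrable_const _), this]
        simp
      have hma := h.meas a
      have hmc := h.meas c
      have := hi.integral_fun_mul_eq_mul_integral
        (Measurable.aestronglyMeasurable (by fun_prop))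
        (Measurable.aestronglyMeasurable (by fun_prop))
      simp only [Function.comp_apply] at this
      simp only [centredProd, if_true]
      rw [this, hz, zero_mul]
    · simp_rw [mul_comm (centredProd x v a b _)]
      exact h.integral_centredProd_mul_of_ne hcd (fun h' => h1 ⟨h'.1.symm, h'.2.symm⟩)
        (fun h' => h2 ⟨h'.2.symm, h'.1.symm⟩)
  · exact h.integral_centredProd_mul_of_ne hab h1 h2

theorem integral_centredProd_sq_le (h : IsCentredFamily x v κ μ) (a b : ι) :
    ∫ ω, centredProd x v a b ω ^ 2 ∂μ ≤ κ + v ^ 2 := by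
  have hκ : 0 ≤ κ := by
    rw [← h.fourth a]
    exact integral_nonneg fun ω => by simp only [Pi.zero_apply]; positivity
  by_cases hab : a = b
  · subst hab
    have e : ∀ ω, centredProd x v a a ω ^ 2 = x a ω ^ 4 - 2 * v * x a ω ^ 2 + v ^ 2 := fun ω => by
      simp only [centredProd, if_true]; ring
    simp_rw [e]
    rw [integral_add (f := fun ω => x a ω ^ 4 - 2 * v * x a ω ^ 2)
      ((h.integrable_fourth a).sub ((h.integrable_second a).const_mul _))
      (integrable_const _), integral_sub (h.integrable_fourth a)
      ((h.integrable_second a).const_mul _), integral_const_mul, h.fourth, h.second]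
    simp
    nlinarith [sq_nonneg v]
  · have hi := (h.indep.indepFun hab).comp (φ := fun y => y ^ 2) (ψ := fun y => y ^ 2)
        (by fun_prop) (by fun_prop)
    have hma := h.meas a
    have hmb := h.meas b
    have := hi.integral_fun_mul_eq_mul_integral
        (Measurable.aestronglyMeasurable (by fun_prop))
        (Measurable.aestronglyMeasurable (by fun_prop))
    simp only [Function.comp_apply, h.second] at this
    simp only [centredProd, if_neg hab, sub_zero, mul_pow]
    rw [this]
    nlinarith

/-- The variance of a quadratic form with random coefficients that are independent of the
variables. -/
theorem integral_sq_quadraticForm_le [Fintype ι] [Nonempty ι] (h : IsCentredFamily x v κ μ)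
    {R : ι → ι → Ω → ℝ} {K B : ℝ} (hR : ∀ a b, Measurable (R a b)) (hK : ∀ a b ω, |R a b ω| ≤ K)
    (hsymm : ∀ a b, R a b = R b a) (hB : ∀ ω, ∑ a, ∑ b, R a b ω ^ 2 ≤ B)
    (hind : ∀ a b c d, IndepFun (fun ω => R a b ω * R c d ω)
      (fun ω => centredProd x v a b ω * centredProd x v c d ω) μ) :
    Integrable (fun ω => (∑ a, ∑ b, R a b ω * centredProd x v a b ω) ^ 2) μ ∧
    ∫ ω, (∑ a, ∑ b, R a b ω * centredProd x v a b ω) ^ 2 ∂μ ≤ 2 * (κ + v ^ 2) * B := by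
  have hRR : ∀ a b c d, Integrable (fun ω => R a b ω * R c d ω) μ := fun a b c d =>
    Integrable.of_bound ((hR a b).mul (hR c d)).aestronglyMeasurable (K * K)
      (Eventually.of_forall fun ω => by
        rw [norm_mul]
        exact mul_le_mul (hK a b ω) (hK c d ω) (abs_nonneg _) ((abs_nonneg _).trans (hK a b ω)))
  have hint : ∀ p q : ι × ι, Integrable (fun ω => (R p.1 p.2 ω * R q.1 q.2 ω) *
      (centredProd x v p.1 p.2 ω * centredProd x v q.1 q.2 ω)) μ := fun p q =>
    (hind p.1 p.2 q.1 q.2).integrable_mul (hRR _ _ _ _) (h.integrable_centredProd_mul _ _ _ _)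
  have hexp : ∀ ω, (∑ a, ∑ b, R a b ω * centredProd x v a b ω) ^ 2 =
      ∑ p : ι × ι, ∑ q : ι × ι, (R p.1 p.2 ω * R q.1 q.2 ω) *
        (centredProd x v p.1 p.2 ω * centredProd x v q.1 q.2 ω) := by
    intro ω
    rw [← Fintype.sum_prod_type', sq, Finset.sum_mul_sum]
    refine Finset.sum_congr rfl fun p _ => Finset.sum_congr rfl fun q _ => by ring
  simp_rw [hexp]
  refine ⟨integrable_finsetSum _ fun p _ => integrable_finsetSum _ fun q _ => hint p q, ?_⟩
  rw [integral_finsetSum _ fun p _ => integrable_finsetSum _ fun q _ => hint p q]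
  have hC : ∀ p : ι × ι, 0 ≤ κ + v ^ 2 := fun p =>
    (integral_nonneg fun ω => sq_nonneg _).trans (h.integral_centredProd_sq_le p.1 p.2)
  have hterm : ∀ p : ι × ι, ∫ ω, ∑ q : ι × ι, (R p.1 p.2 ω * R q.1 q.2 ω) *
        (centredProd x v p.1 p.2 ω * centredProd x v q.1 q.2 ω) ∂μ ≤
      2 * (κ + v ^ 2) * ∫ ω, R p.1 p.2 ω ^ 2 ∂μ := by
    intro p
    rw [integral_finsetSum _ fun q _ => hint p q]
    have hr : 0 ≤ ∫ ω, R p.1 p.2 ω ^ 2 ∂μ := integral_nonneg fun ω => sq_nonneg _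
    have hCr := mul_nonneg (hC p) hr
    -- After factoring the expectation only `q = p` and `q = p.swap` survive, whence the factor `2`.
    -- For a diagonal `p` both indicators hold; this only enlarges the bound.
    have hq : ∀ q : ι × ι, ∫ ω, (R p.1 p.2 ω * R q.1 q.2 ω) *
        (centredProd x v p.1 p.2 ω * centredProd x v q.1 q.2 ω) ∂μ ≤
        (if q = p then (κ + v ^ 2) * ∫ ω, R p.1 p.2 ω ^ 2 ∂μ else 0) +
          if q = p.swap then (κ + v ^ 2) * ∫ ω, R p.1 p.2 ω ^ 2 ∂μ else 0 := by
      rintro ⟨c, d⟩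
      rw [(hind p.1 p.2 c d).integral_fun_mul_eq_mul_integral (hRR _ _ _ _).aestronglyMeasurable
        (h.integrable_centredProd_mul _ _ _ _).aestronglyMeasurable]
      have hmain : (∫ ω, R p.1 p.2 ω * R p.1 p.2 ω ∂μ) *
          ∫ ω, centredProd x v p.1 p.2 ω * centredProd x v p.1 p.2 ω ∂μ ≤
          (κ + v ^ 2) * ∫ ω, R p.1 p.2 ω ^ 2 ∂μ := by
        simp_rw [← sq]
        rw [mul_comm]
        exact mul_le_mul_of_nonneg_right (h.integral_centredProd_sq_le _ _) hr
      by_cases h1 : (c, d) = p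
      · subst h1
        rw [if_pos rfl]
        refine hmain.trans (le_add_of_nonneg_right ?_)
        split_ifs
        exacts [hCr, le_rfl]
      · by_cases h2 : (c, d) = p.swap
        · have hc : c = p.2 := congrArg Prod.fst h2
          have hd : d = p.1 := congrArg Prod.snd h2
          subst hc hd
          rw [if_neg h1, if_pos h2, zero_add]
          rw [hsymm p.2 p.1, centredProd_comm x v p.2 p.1]
          exact hmain
        · rw [h.integral_centredProd_mul_eq_zero, mul_zero, if_neg h1, if_neg h2, add_zero]
          · exact fun h' => h1 (Prod.ext h'.1 h'.2)
          · exact fun h' => h2 (Prod.ext h'.1 h'.2)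
    refine (Finset.sum_le_sum fun q _ => hq q).trans (le_of_eq ?_)
    rw [Finset.sum_add_distrib, Finset.sum_ite_eq' _ p, Finset.sum_ite_eq' _ p.swap]
    simp only [Finset.mem_univ, if_true]
    ring
  refine (Finset.sum_le_sum fun p _ => hterm p).trans ?_
  rw [← Finset.mul_sum]
  obtain ⟨a⟩ := ‹Nonempty ι›
  refine mul_le_mul_of_nonneg_left ?_ (mul_nonneg zero_le_two (hC (a, a)))
  have hR2 : ∀ p : ι × ι, Integrable (fun ω => R p.1 p.2 ω ^ 2) μ := fun p => by
    simp_rw [sq]; exact hRR _ _ _ _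
  rw [← integral_finsetSum _ fun p _ => hR2 p]
  calc ∫ ω, ∑ p : ι × ι, R p.1 p.2 ω ^ 2 ∂μ ≤ ∫ _, B ∂μ := by
        refine integral_mono (integrable_finsetSum _ fun p _ => hR2 p) (integrable_const _)
          fun ω => ?_
        have := hB ω
        rwa [← Fintype.sum_prod_type'] at this
    _ = B := by simp

end IsCentredFamily

/-! ### The self-consistent equation in mean square -/

section SelfConsistent

variable {n m : ℕ}

/-- By Cramer's rule an entry of the inverse is a polynomial expression divided by the determinant.
-/
theorem measurable_gramResolvent {E : Type*} [TopologicalSpace E] [MeasurableSpace E]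
    [OpensMeasurableSpace E] (c t : ℝ) {F : E → Matrix (Fin n) (Fin m) ℝ} (hF : Continuous F)
    (a b : Fin n) : Measurable fun ω => gramResolvent c t (F ω) a b := by
  have hA : Continuous fun ω => shiftedGram c t (F ω) := by
    unfold shiftedGram
    fun_prop
  have h1 : Continuous fun ω => (shiftedGram c t (F ω)).adjugate a b :=
    hA.matrix_adjugate.matrix_elem a b
  have h2 : Continuous fun ω => (shiftedGram c t (F ω)).det := hA.matrix_det
  have e : (fun ω => gramResolvent c t (F ω) a b) = fun ω =>
      ((shiftedGram c t (F ω)).det)⁻¹ * (shiftedGram c t (F ω)).adjugate a b := by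
    ext ω
    rw [gramResolvent, Matrix.inv_def, Matrix.smul_apply, Ring.inverse_eq_inv', smul_eq_mul]
  rw [e]
  exact h2.measurable.inv.mul h1.measurable

/-- The matrix with the given family of entries. -/
def entryMatrix (ω : Fin n × Fin m → ℝ) : Matrix (Fin n) (Fin m) ℝ := Matrix.of fun i j => ω (i, j)

theorem continuous_entryMatrix : Continuous (entryMatrix : (Fin n × Fin m → ℝ) → _) :=
  continuous_matrix fun i j => continuous_apply (i, j)

theorem continuous_entryMatrix_updateCol (j : Fin m) :
    Continuous fun ω : Fin n × Fin m → ℝ => (entryMatrix ω).updateCol j 0 :=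
  continuous_entryMatrix.matrix_updateCol j continuous_const

/-- Truncation of the family of entries away from the column `j`. -/
noncomputable def matrixAway (j : Fin m)
    (g : (Finset.univ.filter fun p : Fin n × Fin m => p.2 ≠ j) → ℝ) : Matrix (Fin n) (Fin m) ℝ :=
  Matrix.of fun i k => if h : k ≠ j then g ⟨(i, k), by simpa using h⟩ else 0

theorem continuous_matrixAway (j : Fin m) : Continuous (matrixAway (n := n) j) := by
  refine continuous_matrix fun i k => ?_
  by_cases h : k ≠ j
  · have : (fun g => matrixAway (n := n) j g i k) = fun g => g ⟨(i, k), by simpa using h⟩ := by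
      ext g
      simp [matrixAway, h]
    rw [this]
    exact continuous_apply _
  · have : (fun g => matrixAway (n := n) j g i k) = fun g => 0 := by
      ext g
      simp only [matrixAway, Matrix.of_apply, dif_neg h]
    rw [this]
    exact continuous_const

theorem matrixAway_restrict (j : Fin m) (ω : Fin n × Fin m → ℝ) :
    matrixAway j (fun p => ω p.1) = (entryMatrix ω).updateCol j 0 := by
  ext i k
  by_cases h : k = j
  · subst h; simp [matrixAway]
  · simp [matrixAway, entryMatrix, h]

variable {P : Measure ℝ}

theorem isCentredFamily_column (hP : IsEntryLaw P) (j : Fin m) :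
    IsCentredFamily (fun (a : Fin n) (ω : Fin n × Fin m → ℝ) => ω (a, j)) (∫ x, x ^ 2 ∂P)
      (∫ x, x ^ 4 ∂P) (Measure.pi fun _ => P) := by
  have := hP.isProb
  have hev : ∀ p : Fin n × Fin m, MeasurePreserving (Function.eval p)
      (Measure.pi fun _ : Fin n × Fin m => P) P := fun p => measurePreserving_eval _ p
  refine ⟨fun a => measurable_pi_apply _, ?_, fun a => ?_, fun a => ?_, fun a => ?_, fun a => ?_⟩
  · have h := iIndepFun_pi (μ := fun _ : Fin n × Fin m => P) (X := fun _ x => x)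
      (fun _ => aemeasurable_id)
    exact h.precomp (g := fun a : Fin n => (a, j)) fun a b h => (Prod.ext_iff.1 h).1
  · rw [integral_comp_eval (μ := fun _ : Fin n × Fin m => P) (i := (a, j)) (f := fun x => x)
      aestronglyMeasurable_id]
    exact hP.mean_zero
  · exact integral_comp_eval (μ := fun _ : Fin n × Fin m => P) (i := (a, j)) (f := fun x => x ^ 2)
      (by fun_prop)
  · exact (hev (a, j)).integrable_comp_of_integrable (hP.integrable_pow 4)
  · exact integral_comp_eval (μ := fun _ : Fin n × Fin m => P) (i := (a, j)) (f := fun x => x ^ 4)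
      (by fun_prop)

/-- The reduced resolvent depends only on the entries outside column `j`. Products of two factors
appear because the square of the quadratic form is expanded. -/
theorem indepFun_resolvent_column (hP : IsEntryLaw P) (c t v : ℝ) (j : Fin m)
    (a b a' b' : Fin n) :
    IndepFun (fun ω : Fin n × Fin m → ℝ =>
        gramResolvent c t ((entryMatrix ω).updateCol j 0) a b *
          gramResolvent c t ((entryMatrix ω).updateCol j 0) a' b')
      (fun ω => centredProd (fun (a : Fin n) (ω : Fin n × Fin m → ℝ) => ω (a, j)) v a b ω *
        centredProd (fun (a : Fin n) (ω : Fin n × Fin m → ℝ) => ω (a, j)) v a' b' ω)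
      (Measure.pi fun _ => P) := by
  have := hP.isProb
  have h := iIndepFun_pi (μ := fun _ : Fin n × Fin m => P) (X := fun _ x => x)
    (fun _ => aemeasurable_id)
  have hd : Disjoint (Finset.univ.filter fun p : Fin n × Fin m => p.2 ≠ j)
      (Finset.univ.filter fun p : Fin n × Fin m => p.2 = j) := by
    rw [Finset.disjoint_filter]
    exact fun p _ h1 h2 => h1 h2
  have hi := h.indepFun_finset _ _ hd (fun p => measurable_pi_apply p)
  have hφ := (measurable_gramResolvent c t (continuous_matrixAway (n := n) j) a b).mul
    (measurable_gramResolvent c t (continuous_matrixAway (n := n) j) a' b')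
  have hcol : ∀ a : Fin n, (a, j) ∈ Finset.univ.filter fun p : Fin n × Fin m => p.2 = j := by simp
  have hψ : Measurable fun g : ((Finset.univ.filter fun p : Fin n × Fin m => p.2 = j) → ℝ) =>
      (g ⟨(a, j), hcol a⟩ * g ⟨(b, j), hcol b⟩ - if a = b then v else 0) *
        (g ⟨(a', j), hcol a'⟩ * g ⟨(b', j), hcol b'⟩ - if a' = b' then v else 0) := by
    fun_prop
  have := hi.comp hφ hψ
  convert this using 1
  · ext ω
    simp only [Function.comp_apply, Pi.mul_apply]
    rw [matrixAway_restrict]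
  · rfl

theorem columnForm_sub_trace {c t v : ℝ} (X : Matrix (Fin n) (Fin m) ℝ) (j : Fin m) :
    columnForm c t X j - c * v * (gramResolvent c t (X.updateCol j 0)).trace =
      c * ∑ a, ∑ b, gramResolvent c t (X.updateCol j 0) a b *
        (X a j * X b j - if a = b then v else 0) := by
  simp only [columnForm, dotProduct, Matrix.mulVec, Matrix.trace, Matrix.diag_apply,
    Matrix.col_apply]
  rw [mul_assoc, ← mul_sub, Finset.mul_sum, ← Finset.sum_sub_distrib]
  congr 1
  refine Finset.sum_congr rfl fun a _ => ?_
  simp only [mul_sub, Finset.sum_sub_distrib, mul_ite, mul_zero, Finset.sum_ite_eq,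
    Finset.mem_univ, if_true, Finset.mul_sum]
  rw [mul_comm v]
  congr 1
  exact Finset.sum_congr rfl fun b _ => by ring

/-- The factor `n / t ^ 2` is the bound for the squared entries of the resolvent: `n` rows, each
with sum of squares at most `1 / t ^ 2`. -/
theorem integral_sq_columnForm_sub_trace_le (hP : IsEntryLaw P) (hn : 1 ≤ n) {c t : ℝ}
    (hc : 0 ≤ c) (ht : 0 < t) (j : Fin m) :
    Integrable (fun ω : Fin n × Fin m → ℝ => (columnForm c t (entryMatrix ω) j -
        c * (∫ x, x ^ 2 ∂P) * (gramResolvent c t ((entryMatrix ω).updateCol j 0)).trace) ^ 2)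
      (Measure.pi fun _ => P) ∧
    ∫ ω : Fin n × Fin m → ℝ, (columnForm c t (entryMatrix ω) j -
        c * (∫ x, x ^ 2 ∂P) * (gramResolvent c t ((entryMatrix ω).updateCol j 0)).trace) ^ 2
          ∂(Measure.pi fun _ => P) ≤
      c ^ 2 * (2 * ((∫ x, x ^ 4 ∂P) + (∫ x, x ^ 2 ∂P) ^ 2) * (n / t ^ 2)) := by
  have := hP.isProb
  have : Nonempty (Fin n) := ⟨⟨0, hn⟩⟩
  obtain ⟨h1, h2⟩ := (isCentredFamily_column (n := n) hP j).integral_sq_quadraticForm_le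
    (R := fun a b ω => gramResolvent c t ((entryMatrix ω).updateCol j 0) a b) (K := 1 / t)
    (B := n / t ^ 2)
    (fun a b => measurable_gramResolvent c t (continuous_entryMatrix_updateCol j) a b)
    (fun a b ω => abs_gramResolvent_le hc ht _ a b)
    (fun a b => funext fun ω => gramResolvent_symm c t _ a b)
    (fun ω => (Finset.sum_le_sum fun a _ => sum_sq_gramResolvent_le hc ht _ a).trans
      (by simp [div_eq_mul_inv]))
    (indepFun_resolvent_column hP c t _ j)
  have e : ∀ ω : Fin n × Fin m → ℝ, (columnForm c t (entryMatrix ω) j -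
        c * (∫ x, x ^ 2 ∂P) * (gramResolvent c t ((entryMatrix ω).updateCol j 0)).trace) ^ 2 =
      c ^ 2 * (∑ a, ∑ b, gramResolvent c t ((entryMatrix ω).updateCol j 0) a b *
        centredProd (fun (a : Fin n) (ω : Fin n × Fin m → ℝ) => ω (a, j)) (∫ x, x ^ 2 ∂P) a b ω)
          ^ 2 := by
    intro ω
    rw [columnForm_sub_trace, mul_pow]
    rfl
  simp_rw [e]
  refine ⟨h1.const_mul _, ?_⟩
  rw [integral_const_mul]
  exact mul_le_mul_of_nonneg_left h2 (sq_nonneg c)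

/-- The error in the self-consistent equation of the Stieltjes transform. -/
noncomputable def selfConsistentError (r t s : ℝ) : ℝ := 1 - t * s - r * (s / (1 + s))

theorem abs_div_one_add_sub_le {x y : ℝ} (hx : 0 ≤ x) (hy : 0 ≤ y) :
    |x / (1 + x) - y / (1 + y)| ≤ |x - y| := by
  have h : x / (1 + x) - y / (1 + y) = (x - y) / ((1 + x) * (1 + y)) := by
    field_simp
    ring
  rw [h, abs_div, abs_of_pos (show 0 < (1 + x) * (1 + y) by positivity)]
  refine div_le_self (abs_nonneg _) ?_
  nlinarith [mul_nonneg hx hy]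

/-- By the trace identity the error is `1/n` times the sum over columns of `q_j / (1 + q_j) - s / (1
+ s)`. Cauchy–Schwarz, the Lipschitz bound for `x / (1 + x)`, and the rank-one comparison of traces
then reduce it to the fluctuations of the column forms. -/
theorem selfConsistentError_sq_le (hn : 1 ≤ n) {c t v : ℝ} (hc : 0 ≤ c) (ht : 0 < t)
    (hcv : c * v = 1 / n) (X : Matrix (Fin n) (Fin m) ℝ) :
    selfConsistentError (m / n) t ((gramResolvent c t X).trace / n) ^ 2 ≤
      m / (n : ℝ) ^ 2 * ∑ j, (2 * (columnForm c t X j -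
        c * v * (gramResolvent c t (X.updateCol j 0)).trace) ^ 2 + 2 * (1 / (n * t)) ^ 2) := by
  have hn0 : (0 : ℝ) < n := by exact_mod_cast hn
  set s := (gramResolvent c t X).trace / n with hs
  have hs0 : 0 ≤ s := div_nonneg (trace_gramResolvent_nonneg hc ht X) hn0.le
  have e : selfConsistentError (m / n) t s = 1 / (n : ℝ) *
      ∑ j, (columnForm c t X j / (1 + columnForm c t X j) - s / (1 + s)) := by
    rw [Finset.sum_sub_distrib, ← card_sub_mul_trace_gramResolvent hc ht, Finset.sum_const,
      Finset.card_univ, Fintype.card_fin, nsmul_eq_mul, selfConsistentError]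
    have : (gramResolvent c t X).trace = n * s := by rw [hs]; field_simp
    rw [this]
    field_simp
  rw [e, mul_pow]
  have h1 := sq_sum_le_card_mul_sum_sq (s := (Finset.univ : Finset (Fin m)))
    (f := fun j => columnForm c t X j / (1 + columnForm c t X j) - s / (1 + s))
  rw [Finset.card_univ, Fintype.card_fin] at h1
  refine (mul_le_mul_of_nonneg_left h1 (sq_nonneg _)).trans ?_
  rw [← mul_assoc, one_div_pow, one_div_mul_eq_div]
  refine mul_le_mul_of_nonneg_left (Finset.sum_le_sum fun j _ => ?_) (by positivity)
  have h2 := abs_div_one_add_sub_le (columnForm_nonneg hc ht X j) hs0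
  have h3 : |c * v * (gramResolvent c t (X.updateCol j 0)).trace - s| ≤ 1 / (n * t) := by
    have := trace_gramResolvent_updateCol hc ht X j
    rw [hcv, hs, one_div_mul_eq_div, ← sub_div, abs_div, abs_of_pos hn0, div_le_iff₀ hn0]
    refine this.trans (le_of_eq ?_)
    field_simp
  have h4 : (columnForm c t X j / (1 + columnForm c t X j) - s / (1 + s)) ^ 2 ≤
      (columnForm c t X j - s) ^ 2 := sq_le_sq.2 h2
  have h5 : (c * v * (gramResolvent c t (X.updateCol j 0)).trace - s) ^ 2 ≤ (1 / (n * t)) ^ 2 :=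
    sq_le_sq.2 (h3.trans (le_abs_self _))
  nlinarith [sq_nonneg ((columnForm c t X j -
    c * v * (gramResolvent c t (X.updateCol j 0)).trace) -
    (c * v * (gramResolvent c t (X.updateCol j 0)).trace - s))]

theorem measurable_trace_gramResolvent (c t : ℝ) :
    Measurable fun ω : Fin n × Fin m → ℝ => (gramResolvent c t (entryMatrix ω)).trace :=
  Finset.measurable_sum _ fun a _ => measurable_gramResolvent c t continuous_entryMatrix a a

theorem measurable_selfConsistentError (r t : ℝ) : Measurable (selfConsistentError r t) := by
  unfold selfConsistentError
  fun_prop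

/-- The law enters the bound only through `M_4 / (n M_2 ^ 2)`, the quantity whose limit is `A 4`. -/
theorem integral_selfConsistentError_sq_le (hP : IsEntryLaw P) (hn : 1 ≤ n) {t : ℝ} (ht : 0 < t) :
    Integrable (fun ω : Fin n × Fin m → ℝ => selfConsistentError (m / n) t
      ((gramResolvent (1 / (n * ∫ x, x ^ 2 ∂P)) t (entryMatrix ω)).trace / n) ^ 2)
      (Measure.pi fun _ => P) ∧
    ∫ ω : Fin n × Fin m → ℝ, selfConsistentError (m / n) t
      ((gramResolvent (1 / (n * ∫ x, x ^ 2 ∂P)) t (entryMatrix ω)).trace / n) ^ 2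
        ∂(Measure.pi fun _ => P) ≤
      (m / n : ℝ) ^ 2 * (4 / t ^ 2 * ((∫ x, x ^ 4 ∂P) / (n * (∫ x, x ^ 2 ∂P) ^ 2) + 1 / n) +
        2 / t ^ 2 * (1 / n) ^ 2) := by
  have := hP.isProb
  have hn0 : (0 : ℝ) < n := by exact_mod_cast hn
  have hv := hP.second_moment_pos
  set v := ∫ x, x ^ 2 ∂P
  set κ := ∫ x, x ^ 4 ∂P
  set c : ℝ := 1 / (n * v) with hcdef
  have hc : 0 ≤ c := by positivity
  have hcv : c * v = 1 / n := by rw [hcdef]; field_simp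
  have hcol := fun j : Fin m => integral_sq_columnForm_sub_trace_le (n := n) hP hn hc ht j
  have hub := fun ω : Fin n × Fin m → ℝ => selfConsistentError_sq_le hn hc ht hcv (entryMatrix ω)
  have hintj : ∀ j : Fin m, Integrable (fun ω : Fin n × Fin m → ℝ =>
      (2 * (columnForm c t (entryMatrix ω) j -
        c * v * (gramResolvent c t ((entryMatrix ω).updateCol j 0)).trace) ^ 2 +
          2 * (1 / (n * t)) ^ 2)) (Measure.pi fun _ => P) := fun j =>
    ((hcol j).1.const_mul 2).add (integrable_const _)
  have hint := (integrable_finsetSum Finset.univ fun j _ => hintj j).const_mul (m / (n : ℝ) ^ 2)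
  have hmeas : Measurable fun ω : Fin n × Fin m → ℝ => selfConsistentError (m / n) t
      ((gramResolvent c t (entryMatrix ω)).trace / n) ^ 2 :=
    ((measurable_selfConsistentError _ t).comp
      ((measurable_trace_gramResolvent c t).div_const _)).pow_const 2
  have hI : Integrable (fun ω : Fin n × Fin m → ℝ => selfConsistentError (m / n) t
      ((gramResolvent c t (entryMatrix ω)).trace / n) ^ 2) (Measure.pi fun _ => P) :=
    Integrable.mono' hint hmeas.aestronglyMeasurable (Eventually.of_forall fun ω => by
      rw [Real.norm_of_nonneg (sq_nonneg _)]
      exact hub ω)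
  refine ⟨hI, (integral_mono hI hint hub).trans ?_⟩
  rw [integral_const_mul, integral_finsetSum _ fun j _ => hintj j]
  have hj : ∀ j : Fin m, ∫ ω : Fin n × Fin m → ℝ, (2 * (columnForm c t (entryMatrix ω) j -
        c * v * (gramResolvent c t ((entryMatrix ω).updateCol j 0)).trace) ^ 2 +
          2 * (1 / (n * t)) ^ 2) ∂(Measure.pi fun _ => P) ≤
      2 * (c ^ 2 * (2 * (κ + v ^ 2) * (n / t ^ 2))) + 2 * (1 / (n * t)) ^ 2 := by
    intro j
    rw [integral_add ((hcol j).1.const_mul 2) (integrable_const _), integral_const_mul]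
    simp only [integral_const, probReal_univ, one_smul]
    linarith [(hcol j).2]
  refine (mul_le_mul_of_nonneg_left (Finset.sum_le_sum fun j _ => hj j) (by positivity)).trans
    (le_of_eq ?_)
  rw [Finset.sum_const, Finset.card_univ, Fintype.card_fin, nsmul_eq_mul, hcdef]
  field_simp
  ring

end SelfConsistent

/-! ### Weak convergence in probability from Stieltjes transforms -/

section InProbability

variable {Ω : ℕ → Type*} [∀ n, MeasurableSpace (Ω n)]

/-- Convergence to zero in probability, on varying probability spaces. -/
def TendstoZeroInProb (Pr : ∀ n, Measure (Ω n)) (F : ∀ n, Ω n → ℝ) : Prop :=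
  ∀ ε : ℝ, 0 < ε → Tendsto (fun n => Pr n {ω | ε < |F n ω|}) atTop (𝓝 0)

namespace TendstoZeroInProb

variable {Pr : ∀ n, Measure (Ω n)} {F G : ∀ n, Ω n → ℝ}

theorem of_abs_le_add (hG : TendstoZeroInProb Pr G)
    (h : ∀ δ : ℝ, 0 < δ → ∀ᶠ n in atTop, ∀ ω, |F n ω| ≤ |G n ω| + δ) : TendstoZeroInProb Pr F := by
  intro ε hε
  refine tendsto_of_tendsto_of_tendsto_of_le_of_le' tendsto_const_nhds (hG (ε / 2) (by positivity))
    (Eventually.of_forall fun _ => zero_le) ?_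
  filter_upwards [h (ε / 2) (by positivity)] with n hn
  refine measure_mono fun ω hω => ?_
  have h1 := hn ω
  have h2 : ε < |F n ω| := hω
  change ε / 2 < |G n ω|
  linarith

theorem of_abs_le (hG : TendstoZeroInProb Pr G) (h : ∀ᶠ n in atTop, ∀ ω, |F n ω| ≤ |G n ω|) :
    TendstoZeroInProb Pr F :=
  hG.of_abs_le_add fun δ hδ => by
    filter_upwards [h] with n hn ω using (hn ω).trans (by linarith)

theorem of_approx (h : ∀ δ : ℝ, 0 < δ → ∃ G : ∀ n, Ω n → ℝ, TendstoZeroInProb Pr G ∧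
    ∀ᶠ n in atTop, ∀ ω, |F n ω| ≤ |G n ω| + δ) : TendstoZeroInProb Pr F := by
  intro ε hε
  obtain ⟨G, hG, hFG⟩ := h (ε / 2) (by positivity)
  refine tendsto_of_tendsto_of_tendsto_of_le_of_le' tendsto_const_nhds (hG (ε / 2) (by positivity))
    (Eventually.of_forall fun _ => zero_le) ?_
  filter_upwards [hFG] with n hn
  refine measure_mono fun ω hω => ?_
  have h1 := hn ω
  have h2 : ε < |F n ω| := hω
  change ε / 2 < |G n ω|
  linarith

theorem add (hF : TendstoZeroInProb Pr F) (hG : TendstoZeroInProb Pr G) :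
    TendstoZeroInProb Pr fun n ω => F n ω + G n ω := by
  intro ε hε
  have h := (hF (ε / 2) (by positivity)).add (hG (ε / 2) (by positivity))
  rw [add_zero] at h
  refine tendsto_of_tendsto_of_tendsto_of_le_of_le tendsto_const_nhds h (fun _ => zero_le)
    fun n => ?_
  refine (measure_mono fun ω hω => ?_).trans (measure_union_le _ _)
  have h2 : ε < |F n ω + G n ω| := hω
  by_contra h
  simp only [Set.mem_union, Set.mem_ofPred_eq, not_or, not_lt] at h
  linarith [abs_add_le (F n ω) (G n ω)]

theorem const_mul (hF : TendstoZeroInProb Pr F) (c : ℝ) :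
    TendstoZeroInProb Pr fun n ω => c * F n ω := by
  intro ε hε
  have hc : 0 < |c| + 1 := by positivity
  refine tendsto_of_tendsto_of_tendsto_of_le_of_le tendsto_const_nhds
    (hF (ε / (|c| + 1)) (by positivity)) (fun _ => zero_le) fun n => ?_
  refine measure_mono fun ω hω => ?_
  have h2 : ε < |c * F n ω| := hω
  change ε / (|c| + 1) < |F n ω|
  rw [abs_mul] at h2
  rw [div_lt_iff₀ hc]
  linarith [abs_nonneg (F n ω)]

theorem eq_zero_of_const [∀ n, IsProbabilityMeasure (Pr n)] {a : ℝ}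
    (h : TendstoZeroInProb Pr fun _ _ => a) : a = 0 := by
  by_contra ha
  have h1 := h (|a| / 2) (by positivity)
  have h2 : ∀ n, Pr n {_ω | |a| / 2 < |a|} = 1 := fun n => by
    have : {_ω : Ω n | |a| / 2 < |a|} = Set.univ :=
      Set.eq_univ_of_forall fun ω => half_lt_self (abs_pos.2 ha)
    rw [this, measure_univ]
  simp_rw [h2] at h1
  exact one_ne_zero (tendsto_nhds_unique tendsto_const_nhds h1)

end TendstoZeroInProb

end InProbability

/-! ### Density of the functions `1 / (x + t)` on the compactified half-line -/

/-- The compactification `x ↦ 1 / (1 + x)` of the half-line. -/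
noncomputable def compactify (x : ℝ) : Set.Icc (0 : ℝ) 1 :=
  Set.projIcc 0 1 zero_le_one (1 / (1 + x))

theorem measurable_compactify : Measurable compactify :=
  continuous_projIcc.measurable.comp (by fun_prop)

theorem coe_compactify {x : ℝ} (hx : 0 ≤ x) : (compactify x : ℝ) = 1 / (1 + x) := by
  rw [compactify, Set.projIcc_of_mem]
  exact ⟨by positivity, (div_le_one (by positivity)).2 (by linarith)⟩

/-- The denominator is the convex combination `(1 - u) + u t`. -/
theorem stieltjesFun_denom_pos {t : ℝ} (ht : 0 < t) (u : Set.Icc (0 : ℝ) 1) :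
    0 < 1 + (t - 1) * (u : ℝ) := by
  have h0 := u.2.1
  have h1 := u.2.2
  rcases h0.eq_or_lt with h | h
  · rw [← h]; simp
  · nlinarith [mul_pos ht h]

/-- The function `1 / (x + t)` in the coordinate `u = 1 / (1 + x)`. -/
noncomputable def stieltjesFun (t : Set.Ioi (0 : ℝ)) : C(Set.Icc (0 : ℝ) 1, ℝ) where
  toFun u := (u : ℝ) / (1 + ((t : ℝ) - 1) * u)
  continuous_toFun := by
    refine Continuous.div (by fun_prop) (by fun_prop) fun u => ?_
    exact (stieltjesFun_denom_pos t.2 u).ne'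

theorem stieltjesFun_compactify (t : Set.Ioi (0 : ℝ)) {x : ℝ} (hx : 0 ≤ x) :
    stieltjesFun t (compactify x) = 1 / (x + t) := by
  have ht : (0 : ℝ) < t := t.2
  change (compactify x : ℝ) / (1 + ((t : ℝ) - 1) * compactify x) = _
  rw [coe_compactify hx]
  have h1 : 1 + x ≠ 0 := by positivity
  have h3 : x + (t : ℝ) ≠ 0 := by positivity
  have h2 : 1 + ((t : ℝ) - 1) * (1 / (1 + x)) = (x + t) / (1 + x) := by
    field_simp
    ring
  rw [h2]
  field_simp

/-- The identity coordinate, which is `1 / (1 + x)`. -/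
def coordFun : C(Set.Icc (0 : ℝ) 1, ℝ) := ⟨fun u => u, continuous_subtype_val⟩

/-- The closed span of the functions `1 / (x + t)`. -/
noncomputable def stieltjesSpan : Submodule ℝ C(Set.Icc (0 : ℝ) 1, ℝ) :=
  (Submodule.span ℝ (Set.range stieltjesFun)).topologicalClosure

theorem stieltjesFun_mem (t : Set.Ioi (0 : ℝ)) : stieltjesFun t ∈ stieltjesSpan :=
  Submodule.le_topologicalClosure _ (Submodule.subset_span ⟨t, rfl⟩)

/-- Partial fractions for `1 / ((x + 1) (x + t))`. The case `t = 1` is a double pole and is reached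
as a uniform limit. -/
theorem coordFun_mul_stieltjesFun_of_ne {t : Set.Ioi (0 : ℝ)} (ht : (t : ℝ) ≠ 1) :
    coordFun * stieltjesFun t ∈ stieltjesSpan := by
  have e : coordFun * stieltjesFun t =
      ((t : ℝ) - 1)⁻¹ • (stieltjesFun ⟨1, Set.mem_Ioi.2 one_pos⟩ - stieltjesFun t) := by
    ext u
    have h1 : (t : ℝ) - 1 ≠ 0 := sub_ne_zero.2 ht
    have h2 := (stieltjesFun_denom_pos t.2 u).ne'
    change (u : ℝ) * (u / (1 + ((t : ℝ) - 1) * u)) =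
      ((t : ℝ) - 1)⁻¹ * (u / (1 + ((1 : ℝ) - 1) * u) - u / (1 + ((t : ℝ) - 1) * u))
    rw [sub_self, zero_mul, add_zero, div_one, eq_inv_mul_iff_mul_eq₀ h1]
    generalize hD : 1 + ((t : ℝ) - 1) * (u : ℝ) = D at h2
    field_simp
    rw [← hD]
    ring
  rw [e]
  exact Submodule.smul_mem _ _ (Submodule.sub_mem _ (stieltjesFun_mem _) (stieltjesFun_mem _))

theorem coordFun_mul_stieltjesFun (t : Set.Ioi (0 : ℝ)) :
    coordFun * stieltjesFun t ∈ stieltjesSpan := by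
  by_cases ht : (t : ℝ) = 1
  · have hcl : IsClosed (stieltjesSpan : Set C(Set.Icc (0 : ℝ) 1, ℝ)) :=
      Submodule.isClosed_topologicalClosure _
    change _ ∈ (stieltjesSpan : Set C(Set.Icc (0 : ℝ) 1, ℝ))
    rw [← hcl.closure_eq, Metric.mem_closure_iff]
    intro ε hε
    have hs : (0 : ℝ) < 1 + ε / 2 := by positivity
    refine ⟨coordFun * stieltjesFun ⟨1 + ε / 2, hs⟩,
      coordFun_mul_stieltjesFun_of_ne (by simpa using hε.ne'), ?_⟩
    refine lt_of_le_of_lt ((ContinuousMap.dist_le (by positivity : 0 ≤ ε / 2)).2 fun u => ?_)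
      (half_lt_self hε)
    have h0 := u.2.1
    have h1 := u.2.2
    change dist ((u : ℝ) * (u / (1 + ((t : ℝ) - 1) * u)))
      ((u : ℝ) * (u / (1 + (1 + ε / 2 - 1) * u))) ≤ ε / 2
    have e : (u : ℝ) * (u / (1 + ((t : ℝ) - 1) * u)) - (u : ℝ) * (u / (1 + (1 + ε / 2 - 1) * u)) =
        (ε / 2) * ((u : ℝ) ^ 3 / (1 + ε / 2 * u)) := by
      rw [ht]
      have : 1 + ε / 2 * (u : ℝ) ≠ 0 := by positivity
      rw [sub_self, zero_mul, add_zero, div_one, add_sub_cancel_left]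
      field_simp
      ring
    rw [Real.dist_eq, e, abs_of_nonneg (by positivity)]
    refine mul_le_of_le_one_right (by positivity) (div_le_one_of_le₀ ?_ (by positivity))
    have : (u : ℝ) ^ 3 ≤ 1 := pow_le_one₀ h0 h1
    nlinarith [mul_nonneg hε.le h0]
  · exact coordFun_mul_stieltjesFun_of_ne ht

/-- The closed span is stable under multiplication by `u`, so it contains all positive powers of
`u`; Weierstrass approximation then applies once the constants are added. -/
theorem coordFun_mul_mem {h : C(Set.Icc (0 : ℝ) 1, ℝ)} (hh : h ∈ stieltjesSpan) :
    coordFun * h ∈ stieltjesSpan := by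
  have hcont : Continuous fun h : C(Set.Icc (0 : ℝ) 1, ℝ) => coordFun * h := by fun_prop
  have hspan : ∀ g ∈ Submodule.span ℝ (Set.range stieltjesFun), coordFun * g ∈ stieltjesSpan := by
    intro g hg
    induction hg using Submodule.span_induction with
    | mem x hx => obtain ⟨t, rfl⟩ := hx; exact coordFun_mul_stieltjesFun t
    | zero => rw [mul_zero]; exact Submodule.zero_mem _
    | add x y _ _ hx hy => rw [mul_add]; exact Submodule.add_mem _ hx hy
    | smul a x _ hx => rw [mul_smul_comm]; exact Submodule.smul_mem _ a hx
  have hcl : IsClosed (stieltjesSpan : Set C(Set.Icc (0 : ℝ) 1, ℝ)) :=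
    Submodule.isClosed_topologicalClosure _
  exact closure_minimal (fun g hg => hspan g hg) (hcl.preimage hcont) hh

theorem coordFun_pow_mem (k : ℕ) : coordFun ^ (k + 1) ∈ stieltjesSpan := by
  induction k with
  | zero =>
    have : coordFun ^ (0 + 1) = stieltjesFun ⟨1, Set.mem_Ioi.2 one_pos⟩ := by
      ext u
      change (u : ℝ) ^ (0 + 1) = u / (1 + ((1 : ℝ) - 1) * u)
      simp
    rw [this]
    exact stieltjesFun_mem _
  | succ k ih => rw [pow_succ']; exact coordFun_mul_mem ih

/-- A closed subspace containing the constants and the functions `1 / (x + t)` is everything. -/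
theorem eq_top_of_stieltjesFun_mem {C : Submodule ℝ C(Set.Icc (0 : ℝ) 1, ℝ)}
    (hC : IsClosed (C : Set C(Set.Icc (0 : ℝ) 1, ℝ))) (h1 : 1 ∈ C)
    (hst : ∀ t, stieltjesFun t ∈ C) (h : C(Set.Icc (0 : ℝ) 1, ℝ)) : h ∈ C := by
  have hle : stieltjesSpan ≤ C := Submodule.topologicalClosure_minimal _
    (Submodule.span_le.2 (by rintro _ ⟨t, rfl⟩; exact hst t)) hC
  have hpow : ∀ k : ℕ, coordFun ^ k ∈ C := fun k => by
    cases k with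
    | zero => rwa [pow_zero]
    | succ k => exact hle (coordFun_pow_mem k)
  change h ∈ (C : Set C(Set.Icc (0 : ℝ) 1, ℝ))
  rw [← hC.closure_eq, Metric.mem_closure_iff]
  intro ε hε
  obtain ⟨p, hp⟩ := exists_polynomial_near_continuousMap 0 1 h ε hε
  refine ⟨p.toContinuousMapOn _, ?_, by rwa [dist_comm, dist_eq_norm]⟩
  have : p.toContinuousMapOn (Set.Icc (0 : ℝ) 1) =
      ∑ k ∈ Finset.range (p.natDegree + 1), p.coeff k • coordFun ^ k := by
    ext u
    simp [Polynomial.eval_eq_sum_range, coordFun]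
  rw [this]
  exact Submodule.sum_mem _ fun k _ => Submodule.smul_mem _ _ (hpow k)

/-! ### From Stieltjes transforms to bounded continuous functions -/

section Weak

variable {Ω : ℕ → Type*} [∀ n, MeasurableSpace (Ω n)] {Pr : ∀ n, Measure (Ω n)}
  {μ : ∀ n, Ω n → Measure ℝ} {ν : Measure ℝ} [IsProbabilityMeasure ν]

theorem integrable_comp_compactify (h : C(Set.Icc (0 : ℝ) 1, ℝ)) (P : Measure ℝ)
    [IsProbabilityMeasure P] : Integrable (fun x => h (compactify x)) P :=
  Integrable.of_bound (h.continuous.measurable.comp measurable_compactify).aestronglyMeasurable ‖h‖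
    (Eventually.of_forall fun _ => h.norm_coe_le_norm _)

theorem abs_integral_comp_compactify_le (h : C(Set.Icc (0 : ℝ) 1, ℝ)) (P : Measure ℝ)
    [IsProbabilityMeasure P] : |∫ x, h (compactify x) ∂P| ≤ ‖h‖ := by
  rw [← Real.norm_eq_abs]
  exact (norm_integral_le_of_norm_le_const (Eventually.of_forall fun x =>
    h.norm_coe_le_norm _)).trans (by simp)

/-- The test functions for which convergence holds form a closed subspace; it contains the constants
and the `stieltjesFun t`, so it is everything. The index `n = 0` is excluded in `hμ` because the
spectral measure of an empty matrix is zero. -/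
theorem tendstoZeroInProb_compactify (hμ : ∀ n, 1 ≤ n → ∀ ω, IsProbabilityMeasure (μ n ω))
    (hpos : ∀ n ω, ∀ᵐ x ∂(μ n ω), 0 ≤ x) (hν : ∀ᵐ x ∂ν, 0 ≤ x)
    (hst : ∀ t : ℝ, 0 < t → TendstoZeroInProb Pr fun n ω =>
      ∫ x, 1 / (x + t) ∂(μ n ω) - ∫ x, 1 / (x + t) ∂ν) (h : C(Set.Icc (0 : ℝ) 1, ℝ)) :
    TendstoZeroInProb Pr fun n ω =>
      ∫ x, h (compactify x) ∂(μ n ω) - ∫ x, h (compactify x) ∂ν := by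
  let C : Submodule ℝ C(Set.Icc (0 : ℝ) 1, ℝ) :=
    { carrier := {h | TendstoZeroInProb Pr fun n ω =>
        ∫ x, h (compactify x) ∂(μ n ω) - ∫ x, h (compactify x) ∂ν}
      add_mem' := by
        intro g h hg hh
        refine (hg.add hh).of_abs_le ?_
        filter_upwards [eventually_ge_atTop 1] with n hn ω
        have := hμ n hn ω
        simp only [ContinuousMap.add_apply]
        rw [integral_add (integrable_comp_compactify g _) (integrable_comp_compactify h _),
          integral_add (integrable_comp_compactify g _) (integrable_comp_compactify h _)]
        apply le_of_eq
        congr 1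
        ring
      zero_mem' := fun ε hε => by simp [not_lt.2 hε.le]
      smul_mem' := by
        intro c h hh
        refine (hh.const_mul c).of_abs_le (Eventually.of_forall fun n ω => ?_)
        simp only [ContinuousMap.smul_apply, smul_eq_mul, integral_const_mul, mul_sub]
        exact le_rfl }
  refine eq_top_of_stieltjesFun_mem (C := C) ?_ ?_ ?_ h
  · refine isClosed_of_closure_subset fun h hh => ?_
    refine TendstoZeroInProb.of_approx fun δ hδ => ?_
    obtain ⟨g, hg, hgh⟩ := Metric.mem_closure_iff.1 hh (δ / 2) (by positivity)
    refine ⟨_, hg, ?_⟩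
    filter_upwards [eventually_ge_atTop 1] with n hn ω
    have := hμ n hn ω
    have hb : ∀ (Q : Measure ℝ) [IsProbabilityMeasure Q],
        |∫ x, h (compactify x) ∂Q - ∫ x, g (compactify x) ∂Q| ≤ δ / 2 := by
      intro Q _
      rw [← integral_sub (integrable_comp_compactify h _) (integrable_comp_compactify g _)]
      refine (abs_integral_comp_compactify_le (h - g) Q).trans ?_
      rw [← dist_eq_norm]
      exact hgh.le
    have h1 := hb (μ n ω)
    have h2 := hb ν
    rw [abs_le] at h1 h2
    set a := ∫ x, h (compactify x) ∂(μ n ω)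
    set b := ∫ x, h (compactify x) ∂ν
    set a' := ∫ x, g (compactify x) ∂(μ n ω)
    set b' := ∫ x, g (compactify x) ∂ν
    have h3 := neg_abs_le (a' - b')
    have h4 := le_abs_self (a' - b')
    rw [abs_le]
    constructor <;> linarith
  · intro ε hε
    refine tendsto_const_nhds.congr' ?_
    filter_upwards [eventually_ge_atTop 1] with n hn
    have : {ω | ε < |∫ x, (1 : C(Set.Icc (0 : ℝ) 1, ℝ)) (compactify x) ∂(μ n ω) -
        ∫ x, (1 : C(Set.Icc (0 : ℝ) 1, ℝ)) (compactify x) ∂ν|} = ∅ := by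
      refine Set.eq_empty_of_forall_notMem fun ω hω => ?_
      have := hμ n hn ω
      have h2 : ε < |_| := hω
      simp at h2
      linarith
    rw [this, measure_empty]
  · intro t
    refine (hst t t.2).of_abs_le (Eventually.of_forall fun n ω => ?_)
    have e1 : ∫ x, stieltjesFun t (compactify x) ∂(μ n ω) = ∫ x, 1 / (x + t) ∂(μ n ω) :=
      integral_congr_ae ((hpos n ω).mono fun x hx => stieltjesFun_compactify t hx)
    have e2 : ∫ x, stieltjesFun t (compactify x) ∂ν = ∫ x, 1 / (x + t) ∂ν :=
      integral_congr_ae (hν.mono fun x hx => stieltjesFun_compactify t hx)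
    rw [e1, e2]

/-- A cutoff function in the coordinate `u = 1 / (1 + x)`. -/
noncomputable def cutoff (u₁ : ℝ) : C(Set.Icc (0 : ℝ) 1, ℝ) where
  toFun u := max 0 (min 1 (((u : ℝ) - u₁) / u₁))
  continuous_toFun := by fun_prop

/-- The cut-off of a function on the half-line in the coordinate `u = 1 / (1 + x)`. -/
noncomputable def cutoffComp {u₁ : ℝ} (hu : 0 < u₁) (f : ℝ →ᵇ ℝ) : C(Set.Icc (0 : ℝ) 1, ℝ) where
  toFun u := f (1 / max (u : ℝ) u₁ - 1) * cutoff u₁ u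
  continuous_toFun := by
    have h : Continuous fun u : Set.Icc (0 : ℝ) 1 => 1 / max (u : ℝ) u₁ - 1 :=
      (Continuous.div continuous_const (by fun_prop)
        fun u => (hu.trans_le (le_max_right _ _)).ne').sub continuous_const
    exact (f.continuous.comp h).mul (cutoff u₁).continuous

theorem cutoffComp_compactify {u₁ : ℝ} (hu : 0 < u₁) (f : ℝ →ᵇ ℝ) {x : ℝ} (hx : 0 ≤ x) :
    cutoffComp hu f (compactify x) = f x * cutoff u₁ (compactify x) := by
  change f (1 / max (compactify x : ℝ) u₁ - 1) * _ = _
  by_cases h : u₁ ≤ (compactify x : ℝ)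
  · rw [max_eq_left h, coe_compactify hx, one_div_one_div, add_sub_cancel_left]
  · have : cutoff u₁ (compactify x) = 0 := by
      change max 0 (min 1 (((compactify x : ℝ) - u₁) / u₁)) = 0
      refine max_eq_left ((min_le_right _ _).trans ?_)
      exact div_nonpos_of_nonpos_of_nonneg (by linarith) hu.le
    rw [this, mul_zero, mul_zero]

theorem cutoff_mem (u₁ : ℝ) (u : Set.Icc (0 : ℝ) 1) : cutoff u₁ u ∈ Set.Icc (0 : ℝ) 1 :=
  ⟨le_max_left _ _, max_le zero_le_one (min_le_left _ _)⟩

theorem cutoff_compactify_eq_one {b x : ℝ} (hx : 0 ≤ x) (hxb : x ≤ b) :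
    cutoff (1 / (1 + b) / 2) (compactify x) = 1 := by
  change max 0 (min 1 (((compactify x : ℝ) - 1 / (1 + b) / 2) / (1 / (1 + b) / 2))) = 1
  have hb : 0 < 1 / (1 + b) := one_div_pos.2 (by linarith)
  rw [coe_compactify hx, min_eq_left, max_eq_right zero_le_one]
  rw [le_div_iff₀ (by positivity)]
  have := one_div_le_one_div_of_le (by linarith : 0 < 1 + x) (by linarith : 1 + x ≤ 1 + b)
  linarith

/-- Convergence in probability of Stieltjes transforms on the negative half-line to that of a
compactly supported law implies weak convergence in probability. -/
theorem tendstoZeroInProb_integral (hμ : ∀ n, 1 ≤ n → ∀ ω, IsProbabilityMeasure (μ n ω))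
    (hpos : ∀ n ω, ∀ᵐ x ∂(μ n ω), 0 ≤ x) {b : ℝ} (hν : ∀ᵐ x ∂ν, x ∈ Set.Icc 0 b)
    (hst : ∀ t : ℝ, 0 < t → TendstoZeroInProb Pr fun n ω =>
      ∫ x, 1 / (x + t) ∂(μ n ω) - ∫ x, 1 / (x + t) ∂ν) (f : ℝ →ᵇ ℝ) :
    TendstoZeroInProb Pr fun n ω => ∫ x, f x ∂(μ n ω) - ∫ x, f x ∂ν := by
  have hb : 0 ≤ b := by
    obtain ⟨x, hx⟩ := hν.exists
    exact hx.1.trans hx.2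
  -- The cutoff vanishes for `u ≤ u₁` and is `1` for `u ≥ 2 u₁ = 1 / (1 + b)`, that is, on `[0, b]`,
  -- which carries `ν`.
  set u₁ : ℝ := 1 / (1 + b) / 2 with hu₁
  have hu : 0 < u₁ := by positivity
  have hconv := tendstoZeroInProb_compactify hμ hpos (hν.mono fun x hx => hx.1) hst
  -- This replaces a tightness argument: the part removed by the cutoff is at most `‖f‖` times the
  -- integral of `1 - cutoff u₁`, which converges to its `ν`-integral, namely `0`.
  have hD : TendstoZeroInProb Pr fun n ω => ∫ x, f x ∂(μ n ω) -
      ∫ x, cutoffComp hu f (compactify x) ∂(μ n ω) := by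
    refine ((hconv (1 - cutoff u₁)).const_mul ‖f‖).of_abs_le ?_
    filter_upwards [eventually_ge_atTop 1] with n hn ω
    have := hμ n hn ω
    have e0 : ∫ x, (1 - cutoff u₁) (compactify x) ∂ν = 0 := by
      rw [integral_congr_ae (g := fun _ => (0 : ℝ)) (hν.mono fun x hx => ?_), integral_zero]
      simp only [ContinuousMap.sub_apply, ContinuousMap.one_apply]
      rw [cutoff_compactify_eq_one hx.1 hx.2, sub_self]
    rw [e0, sub_zero, ← integral_sub (f.integrable _) (integrable_comp_compactify _ _),
      ← integral_const_mul]
    refine (abs_integral_le_integral_abs).trans (le_trans ?_ (le_abs_self _))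
    refine integral_mono_ae ((f.integrable _).sub (integrable_comp_compactify _ _)).abs
      ((integrable_comp_compactify (1 - cutoff u₁) _).const_mul _) ((hpos n ω).mono fun x hx => ?_)
    simp only [ContinuousMap.sub_apply, ContinuousMap.one_apply]
    rw [cutoffComp_compactify hu f hx]
    have hm := cutoff_mem u₁ (compactify x)
    have e : f x - f x * cutoff u₁ (compactify x) = f x * (1 - cutoff u₁ (compactify x)) := by ring
    rw [e, abs_mul, abs_of_nonneg (by linarith [hm.2] : 0 ≤ 1 - cutoff u₁ (compactify x))]
    exact mul_le_mul_of_nonneg_right (f.norm_coe_le_norm x) (by linarith [hm.2])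
  refine ((hconv (cutoffComp hu f)).add hD).of_abs_le (Eventually.of_forall fun n ω => ?_)
  have e1 : ∫ x, cutoffComp hu f (compactify x) ∂ν = ∫ x, f x ∂ν :=
    integral_congr_ae (hν.mono fun x hx => by
      simp only
      rw [cutoffComp_compactify hu f hx.1, cutoff_compactify_eq_one hx.1 hx.2, mul_one])
  rw [e1]
  apply le_of_eq
  congr 1
  ring

end Weak

/-! ### The spectral measure of a Wishart matrix -/

section Spectral

variable {n m : ℕ}

theorem isProbabilityMeasure_spectralMeasure (hn : 1 ≤ n) {W : Matrix (Fin n) (Fin n) ℝ}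
    (hW : W.IsHermitian) : IsProbabilityMeasure (spectralMeasure hW) := by
  constructor
  have h0 : (n : ℝ≥0∞) ≠ 0 := by exact_mod_cast (by omega : n ≠ 0)
  simp [spectralMeasure, ENNReal.inv_mul_cancel h0 (ENNReal.natCast_ne_top n)]

theorem integral_spectralMeasure {W : Matrix (Fin n) (Fin n) ℝ} (hW : W.IsHermitian) (g : ℝ → ℝ) :
    ∫ x, g x ∂(spectralMeasure hW) = (∑ i, g (hW.eigenvalues i)) / n := by
  rw [spectralMeasure, integral_smul_measure,
    integral_finsetSum_measure fun i _ => integrable_dirac (by simp)]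
  simp [div_eq_inv_mul]

theorem ae_spectralMeasure {W : Matrix (Fin n) (Fin n) ℝ} (hW : W.IsHermitian) {p : ℝ → Prop}
    (h : ∀ i, p (hW.eigenvalues i)) : ∀ᵐ x ∂(spectralMeasure hW), p x := by
  refine Measure.ae_smul_measure ?_ _
  rw [ae_iff, Measure.finsetSum_apply]
  refine Finset.sum_eq_zero fun i _ => ?_
  rw [← ae_iff, ae_dirac_eq]
  exact h i

theorem integral_spectralMeasure_wishart {v t : ℝ} (hv : 0 < v) (ht : 0 < t)
    (X : Matrix (Fin n) (Fin m) ℝ) :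
    ∫ x, 1 / (x + t) ∂(spectralMeasure (wishart_isHermitian v X)) =
      (gramResolvent (1 / ((n : ℝ) * v)) t X).trace / n := by
  rw [integral_spectralMeasure, trace_gramResolvent_eq hv ht]

end Spectral

/-! ### Convergence of the Stieltjes transforms -/

section Convergence

/-- Stability: for `s ≥ 0` the error decreases in `s` at rate at least `t`, and replacing `α` by `r`
costs at most `|α - r|`. -/
theorem mul_abs_sub_le_selfConsistentError {r α t s s' : ℝ} (hr : 0 ≤ r) (ht : 0 < t) (hs : 0 ≤ s)
    (hs' : 0 ≤ s') (h : selfConsistentError α t s' = 0) :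
    t * |s - s'| ≤ |selfConsistentError r t s| + |α - r| := by
  have h1 : 1 + s ≠ 0 := by positivity
  have h2 : 1 + s' ≠ 0 := by positivity
  have e : selfConsistentError r t s =
      -((s - s') * (t + r / ((1 + s) * (1 + s')))) + (α - r) * (s' / (1 + s')) := by
    rw [← add_zero (_ + _), ← h]
    unfold selfConsistentError
    field_simp
    ring
  have h3 : |(α - r) * (s' / (1 + s'))| ≤ |α - r| := by
    rw [abs_mul]
    refine mul_le_of_le_one_right (abs_nonneg _) ?_
    rw [abs_of_nonneg (by positivity)]
    exact div_le_one_of_le₀ (by linarith) (by positivity)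
  have h4 : t * |s - s'| ≤ |(s - s') * (t + r / ((1 + s) * (1 + s')))| := by
    have : 0 ≤ r / ((1 + s) * (1 + s')) := by positivity
    rw [abs_mul, mul_comm, abs_of_nonneg (by linarith : 0 ≤ t + r / ((1 + s) * (1 + s')))]
    exact mul_le_mul_of_nonneg_left (by linarith) (abs_nonneg _)
  have h5 : (s - s') * (t + r / ((1 + s) * (1 + s'))) =
      (α - r) * (s' / (1 + s')) - selfConsistentError r t s := by rw [e]; ring
  rw [h5] at h4
  linarith [abs_sub ((α - r) * (s' / (1 + s'))) (selfConsistentError r t s)]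

theorem selfConsistentError_marchenkoPastur {α t : ℝ} (hα : 0 < α) (ht : 0 < t) :
    selfConsistentError α t (∫ x, 1 / (x + t) ∂(marchenkoPastur α)) = 0 := by
  obtain ⟨hs, h⟩ := stieltjes_marchenkoPastur hα ht
  unfold selfConsistentError
  set s := ∫ x, 1 / (x + t) ∂(marchenkoPastur α)
  have : 1 + s ≠ 0 := by positivity
  field_simp
  linarith

variable {Ω : Type*} [MeasurableSpace Ω] {Pr : Measure Ω} [IsProbabilityMeasure Pr] {n m : ℕ}
  {X : Ω → Matrix (Fin n) (Fin m) ℝ} {P : Measure ℝ}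

/-- The joint law of the entries is the product measure, so probabilities can be computed on the
canonical space, where the second-moment bounds were obtained. -/
theorem HasIIDEntries.measure_preimage (h : HasIIDEntries Pr X P)
    {S : Set (Fin n × Fin m → ℝ)} (hS : MeasurableSet S) :
    Pr {ω | (fun p : Fin n × Fin m => X ω p.1 p.2) ∈ S} = Measure.pi (fun _ => P) S := by
  have hm : ∀ p : Fin n × Fin m, AEMeasurable (fun ω => X ω p.1 p.2) Pr :=
    fun p => (h.hasLaw p.1 p.2).aemeasurable
  have hmap := (iIndepFun_iff_map_fun_eq_pi_map hm).1 h.indep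
  have e : (fun p : Fin n × Fin m => Pr.map fun ω => X ω p.1 p.2) = fun _ => P :=
    funext fun p => (h.hasLaw p.1 p.2).map_eq
  rw [e] at hmap
  rw [← hmap, Measure.map_apply_of_aemeasurable (aemeasurable_pi_lambda _ hm) hS]
  rfl

/-- A deviation `ε` of the transform costs `t ε` by stability. Half of it is absorbed by `|α - m /
n|`, and Markov's inequality for the squared error handles the other half. -/
theorem HasIIDEntries.measure_stieltjes_le (h : HasIIDEntries Pr X P) (hP : IsEntryLaw P)
    (hn : 1 ≤ n) {α t ε : ℝ} (hα : 0 < α) (ht : 0 < t) (hε : 0 < ε)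
    (hr : |α - m / n| ≤ t * ε / 2) :
    Pr {ω | ε < |∫ x, 1 / (x + t) ∂(spectralMeasure (wishart_isHermitian (∫ y, y ^ 2 ∂P) (X ω))) -
        ∫ x, 1 / (x + t) ∂(marchenkoPastur α)|} ≤
      ENNReal.ofReal (((m / n : ℝ) ^ 2 * (4 / t ^ 2 * ((∫ x, x ^ 4 ∂P) /
        (n * (∫ x, x ^ 2 ∂P) ^ 2) + 1 / n) + 2 / t ^ 2 * (1 / n) ^ 2)) / (t * ε / 2) ^ 2) := by
  have hPp := hP.isProb
  have hv := hP.second_moment_pos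
  set v := ∫ y, y ^ 2 ∂P
  set s' := ∫ x, 1 / (x + t) ∂(marchenkoPastur α)
  have hs' : 0 < s' := (stieltjes_marchenkoPastur hα ht).1
  have hn0 : (0 : ℝ) < n := by exact_mod_cast hn
  let s : (Fin n × Fin m → ℝ) → ℝ := fun q =>
    (gramResolvent (1 / ((n : ℝ) * v)) t (entryMatrix q)).trace / n
  have hsm : Measurable s := (measurable_trace_gramResolvent _ t).div_const _
  have hs : ∀ q, 0 ≤ s q := fun q =>
    div_nonneg (trace_gramResolvent_nonneg (by positivity) ht _) hn0.le
  have e : {ω | ε < |∫ x, 1 / (x + t) ∂(spectralMeasure (wishart_isHermitian v (X ω))) - s'|} =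
      {ω | (fun p : Fin n × Fin m => X ω p.1 p.2) ∈ {q | ε < |s q - s'|}} := by
    ext ω
    simp only [Set.mem_ofPred_eq]
    rw [integral_spectralMeasure_wishart hv ht]
    rfl
  rw [e, h.measure_preimage (measurableSet_lt measurable_const (hsm.sub_const _).abs)]
  obtain ⟨hint, hle⟩ := integral_selfConsistentError_sq_le (m := m) hP hn ht
  have hδ : 0 < (t * ε / 2) ^ 2 := by positivity
  have hsub : {q | ε < |s q - s'|} ⊆
      {q | (t * ε / 2) ^ 2 ≤ selfConsistentError (m / n) t (s q) ^ 2} := by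
    intro q hq
    have hq' : ε < |s q - s'| := hq
    have h1 := mul_abs_sub_le_selfConsistentError (r := m / n) (by positivity) ht (hs q) hs'.le
      (selfConsistentError_marchenkoPastur hα ht)
    change (t * ε / 2) ^ 2 ≤ _
    rw [← sq_abs (selfConsistentError _ _ _)]
    refine pow_le_pow_left₀ (by positivity) ?_ 2
    have := mul_le_mul_of_nonneg_left hq'.le ht.le
    linarith
  refine (measure_mono hsub).trans ?_
  rw [← ofReal_measureReal (measure_ne_top _ _)]
  refine ENNReal.ofReal_le_ofReal ?_
  rw [le_div_iff₀ hδ, mul_comm]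
  exact (mul_meas_ge_le_integral_of_nonneg (Eventually.of_forall fun _ => sq_nonneg _) hint _).trans
    hle

end Convergence

/-! ### Asymptotics of the entry laws -/

/-- The normalization makes the quotient for `k = 2` equal to `1` for every `n ≥ 1`. -/
theorem IsAsymptotic.two_eq_one {P : ℕ → Measure ℝ} {A : ℕ → ℝ}
    (hP : ∀ n, 1 ≤ n → IsEntryLaw (P n)) (hA : IsAsymptotic P A) : A 2 = 1 := by
  refine tendsto_nhds_unique (hA 2 (by norm_num)) (tendsto_const_nhds.congr' ?_)
  filter_upwards [eventually_ge_atTop 1] with n hn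
  have := (hP n hn).second_moment_pos
  norm_num [this.ne']

theorem IsAsymptotic.tendsto_four {P : ℕ → Measure ℝ} {A : ℕ → ℝ} (hA : IsAsymptotic P A)
    (h4 : A 4 = 0) :
    Tendsto (fun n : ℕ => (∫ x, x ^ 4 ∂(P n)) / (n * (∫ x, x ^ 2 ∂(P n)) ^ 2)) atTop (𝓝 0) := by
  have h := hA 4 (by norm_num)
  rw [h4] at h
  refine h.congr fun n => ?_
  norm_num

theorem exists_isAsymptotic_const {P : Measure ℝ} (hP : IsEntryLaw P) :
    ∃ A : ℕ → ℝ, IsAsymptotic (fun _ => P) A ∧ ∀ k, 2 < k → A k = 0 := by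
  have hv := hP.second_moment_pos
  refine ⟨fun k => if k = 2 then 1 else 0, fun k hk => ?_, fun k hk => if_neg hk.ne'⟩
  rcases lt_trichotomy k 2 with h | rfl | h
  · obtain rfl : k = 1 := by omega
    simp [hP.mean_zero]
  · refine tendsto_const_nhds.congr' ?_
    filter_upwards with n
    norm_num [hv.ne']
  · simp only [if_neg h.ne']
    have h2 : (2 : ℝ) < k := by exact_mod_cast h
    have h1 : Tendsto (fun n : ℕ => (n : ℝ) ^ ((k : ℝ) / 2 - 1)) atTop atTop :=
      (tendsto_rpow_atTop (by linarith)).comp tendsto_natCast_atTop_atTop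
    exact (h1.atTop_mul_const (Real.rpow_pos_of_pos hv _)).const_div_atTop _

/-! ### The limit law -/

section Limit

variable {Ω : ℕ → Type*} [∀ n, MeasurableSpace (Ω n)] {Pr : ∀ n, Measure (Ω n)}
  [∀ n, IsProbabilityMeasure (Pr n)] {m : ℕ → ℕ} {X : ∀ n, Ω n → Matrix (Fin n) (Fin (m n)) ℝ}
  {P : ℕ → Measure ℝ} {A : ℕ → ℝ} {α : ℝ}

theorem tendstoZeroInProb_stieltjes (hP : ∀ n, 1 ≤ n → IsEntryLaw (P n)) (hA : IsAsymptotic P A)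
    (hα : 0 < α) (hm : Tendsto (fun n : ℕ => (m n : ℝ) / (n : ℝ)) atTop (𝓝 α))
    (hX : ∀ n, 1 ≤ n → HasIIDEntries (Pr n) (X n) (P n)) (h4 : A 4 = 0) {t : ℝ} (ht : 0 < t) :
    TendstoZeroInProb Pr fun n ω =>
      ∫ x, 1 / (x + t) ∂(spectralMeasure (wishart_isHermitian (∫ y, y ^ 2 ∂(P n)) (X n ω))) -
        ∫ x, 1 / (x + t) ∂(marchenkoPastur α) := by
  intro ε hε
  have hn := tendsto_one_div_atTop_nhds_zero_nat (𝕜 := ℝ)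
  have hb := ENNReal.tendsto_ofReal (((hm.pow 2).mul ((((hA.tendsto_four h4).add hn).const_mul (4 / t ^ 2)).add
    ((hn.pow 2).const_mul (2 / t ^ 2)))).div_const ((t * ε / 2) ^ 2))
  have hr : ∀ᶠ n : ℕ in atTop, |α - (m n : ℝ) / (n : ℝ)| ≤ t * ε / 2 := by
    have h : Tendsto (fun n : ℕ => |α - (m n : ℝ) / (n : ℝ)|) atTop (𝓝 0) := by
      simpa using (hm.const_sub α).abs
    exact h.eventually_le_const (by positivity)
  have e : ENNReal.ofReal (α ^ 2 * (4 / t ^ 2 * (0 + 0) + 2 / t ^ 2 * 0 ^ 2) / (t * ε / 2) ^ 2) =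
      0 := by simp
  rw [e] at hb
  refine tendsto_of_tendsto_of_tendsto_of_le_of_le' tendsto_const_nhds hb
    (Eventually.of_forall fun _ => zero_le) ?_
  filter_upwards [hr, eventually_ge_atTop 1] with n hrn hn1
  exact (hX n hn1).measure_stieltjes_le (hP n hn1) hn1 hα ht hε hrn

theorem isSpectralLimit_marchenkoPastur (hP : ∀ n, 1 ≤ n → IsEntryLaw (P n))
    (hA : IsAsymptotic P A) (hα : 0 < α)
    (hm : Tendsto (fun n : ℕ => (m n : ℝ) / (n : ℝ)) atTop (𝓝 α))
    (hX : ∀ n, 1 ≤ n → HasIIDEntries (Pr n) (X n) (P n)) (h4 : A 4 = 0) :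
    IsSpectralLimit Pr X P (marchenkoPastur α) := by
  have hMP := isProbabilityMeasure_marchenkoPastur hα
  refine ⟨hMP, fun ε hε f => tendstoZeroInProb_integral (μ := fun n ω =>
    spectralMeasure (wishart_isHermitian (∫ y, y ^ 2 ∂(P n)) (X n ω)))
    (fun n hn ω => isProbabilityMeasure_spectralMeasure hn _) (fun n ω => ae_spectralMeasure _ ?_)
    (ae_mem_marchenkoPastur hα) (fun t ht => tendstoZeroInProb_stieltjes hP hA hα hm hX h4 ht)
    f ε hε⟩
  -- For `n = 0` nothing is known about `P 0`, but there are no eigenvalues.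
  rcases Nat.eq_zero_or_pos n with rfl | hn
  · exact fun i => i.elim0
  · exact wishart_eigenvalues_nonneg (hP n hn).second_moment_pos _

/-- For each test function the difference of the two integrals is a constant that tends to zero in
probability on probability spaces, hence is zero. -/
theorem IsSpectralLimit.unique {μ ν : Measure ℝ} (hμ : IsSpectralLimit Pr X P μ)
    (hν : IsSpectralLimit Pr X P ν) : μ = ν := by
  have := hμ.1
  have := hν.1
  refine ext_of_forall_integral_eq_of_IsFiniteMeasure fun f => ?_
  have h1 : TendstoZeroInProb Pr fun n ω =>
      (∫ x, f x ∂(spectralMeasure (wishart_isHermitian (∫ y, y ^ 2 ∂(P n)) (X n ω)))) -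
        ∫ x, f x ∂μ := fun ε hε => hμ.2 ε hε f
  have h2 : TendstoZeroInProb Pr fun n ω =>
      (∫ x, f x ∂(spectralMeasure (wishart_isHermitian (∫ y, y ^ 2 ∂(P n)) (X n ω)))) -
        ∫ x, f x ∂ν := fun ε hε => hν.2 ε hε f
  refine sub_eq_zero.1 (TendstoZeroInProb.eq_zero_of_const (Pr := Pr)
    ((h2.add (h1.const_mul (-1))).of_abs_le (Eventually.of_forall fun n ω => le_of_eq ?_)))
  congr 1
  ring

end Limit

theorem hasLimitMoments_iff {A : ℕ → ℝ} {α : ℝ} (hα : 0 < α) (h2 : A 2 = 1)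
    (hA : ∀ k, 2 < k → A k = 0) (μ : Measure ℝ) :
    HasLimitMoments A α μ ↔ μ = marchenkoPastur α := by
  have hMP := isProbabilityMeasure_marchenkoPastur hα
  constructor
  · rintro ⟨hμ, h⟩
    refine eq_of_forall_moment_eq (b := (1 + √α) ^ 2)
      ((ae_mem_marchenkoPastur hα).mono fun x hx => abs_le.2 ⟨by linarith [hx.1, hx.2], hx.2⟩)
      (fun k => ?_) fun k => ?_
    · rcases Nat.eq_zero_or_pos k with rfl | hk
      · simp
      · exact (h k hk).1
    · rcases Nat.eq_zero_or_pos k with rfl | hk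
      · simp
      · rw [(h k hk).2, limitMoment_eq_parityPoly h2 hA α hk, moment_marchenkoPastur hα]
  · rintro rfl
    exact ⟨hMP, fun k hk => ⟨integrable_pow_marchenkoPastur hα k, by
      rw [limitMoment_eq_parityPoly h2 hA α hk, moment_marchenkoPastur hα]⟩⟩

/-- The limit law `μ_{A,α}` is the law to which the spectral measures converge, and it is the law
with moments `limitMoment A α k`; if `A k = 0` for all `k > 2`, then the Marchenko–Pastur law, and
no other measure, is that law. A constant sequence of laws has such an asymptotic. -/
theorem mainTheorem5 :
    (∀ (P : ℕ → Measure ℝ) (A : ℕ → ℝ) (α : ℝ) (m : ℕ → ℕ)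
        (Ω : ℕ → Type*) [∀ n, MeasurableSpace (Ω n)] (Pr : ∀ n, Measure (Ω n))
        [∀ n, IsProbabilityMeasure (Pr n)] (X : ∀ n, Ω n → Matrix (Fin n) (Fin (m n)) ℝ),
        (∀ n, 1 ≤ n → IsEntryLaw (P n)) →
        IsAsymptotic P A →
        0 < α →
        Tendsto (fun n : ℕ => (m n : ℝ) / (n : ℝ)) atTop (𝓝 α) →
        (∀ n, 1 ≤ n → HasIIDEntries (Pr n) (X n) (P n)) →
        (∀ k, 2 < k → A k = 0) →
        ∀ μ : Measure ℝ,
          (IsSpectralLimit Pr X P μ ↔ μ = marchenkoPastur α) ∧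
          (HasLimitMoments A α μ ↔ μ = marchenkoPastur α)) ∧
    (∀ P : Measure ℝ, IsEntryLaw P →
        ∃ A : ℕ → ℝ, IsAsymptotic (fun _ => P) A ∧ ∀ k, 2 < k → A k = 0) := by
  refine ⟨?_, fun P hP => exists_isAsymptotic_const hP⟩
  intro P A α m Ω _ Pr _ X hP hAs hα hm hX hA μ
  have hMP := isSpectralLimit_marchenkoPastur hP hAs hα hm hX (hA 4 (by norm_num))
  refine ⟨⟨fun h => h.unique hMP, ?_⟩, hasLimitMoments_iff hα (hAs.two_eq_one hP) hA μ⟩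
  rintro rfl
  exact hMP
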